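/- Let $\Gamma$ be a rooted metric tree with root $o$, in which every vertex $y$ has finite generation $\mathrm{gen}(y)$ (the number of vertices $x$ with $o\prec x\preceq y$), every edge is a segment of positive finite length, and the number $b(y)$ of edges emanating from a vertex $y$ satisfies $b(o)=1$ and $1<b(y)<\infty$ for $y\neq o$. Let $|x|$ be the distance of $x\in\Gamma$ from $o$ and $dx$ the measure on $\Gamma$ induced by Lebesgue measure on the edges. Suppose that $\Gamma$ is regular: all vertices of the same generation have equal branching numbers and all edges of the same generation (that of the initial vertex) have equal lengths; write $b(y)=b_{\mathrm{gen}(y)}$ and $|y|=t_{\mathrm{gen}(y)}$ for every vertex $y$, and $R=\lim_{k\to\infty}t_k\in(0,\infty]$. Let $V:[0,R)\to\mathbb R$ be measurable and bounded below. Let $\mathbf A_V$ be the self-adjoint operator in $L^2(\Gamma)$ associated with the quadratic form $$\mathbf a_V[f]=\int_\Gamma\bigl(|f'(x)|^2+V(|x|)|f(x)|^2\bigr)\,dx$$ whose domain consists of the continuous functions $f$ on $\Gamma$ with $f(o)=0$ whose restriction to each edge is in $H^1$ and for which $\int_\Gamma(|f'|^2+|f|^2+|V(|x|)||f|^2)\,dx<\infty$.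 For $k\ge0$ let $g_k(t)=b_{k+1}\cdots b_n$ for $t_n<t\le t_{n+1}$, $n\ge k$ (so $g_k=1$ on $(t_k,t_{k+1}]$), and let $\mathcal A_{V,k}$ be the self-adjoint operator in $L^2((t_k,R),g_k\,dt)$ associated with the quadratic form $$a_{V,k}[u]=\int_{t_k}^R\bigl(|u'(t)|^2+V(t)|u(t)|^2\bigr)g_k(t)\,dt$$ whose domain consists of the locally absolutely continuous functions $u$ on $[t_k,R)$ with $u(t_k)=0$ and $\int_{t_k}^R(|u'|^2+|u|^2+|V||u|^2)g_k\,dt<\infty$. (If a form domain is not dense, the operator is understood as acting in its closure.) The spectrum of a self-adjoint operator is called discrete if it consists of isolated eigenvalues of finite multiplicity; for such an operator $\mathcal A$, bounded below, let $N(\lambda;\mathcal A)$ be the number of its eigenvalues in $(-\infty,\lambda)$, counted with multiplicities. Then the spectrum of $\mathbf A_V$ is discrete if and only if the spectrum of $\mathcal A_{V,0}$ is discrete. In that case the spectrum of every $\mathcal A_{V,k}$ is discrete, and for every $\lambda\in\mathbb R$ the number $N(\lambda;\mathbf A_V)$ is finite and $$N(\lambda;\mathbf A_V)=N(\lambda;\mathcal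 A_{V,0})+\sum_{k=1}^\infty b_1\cdots b_{k-1}(b_k-1)\,N(\lambda;\mathcal A_{V,k}).$$ -/

import Mathlib

open MeasureTheory Set
open scoped ENNReal ComplexConjugate Topology InnerProductSpace

noncomputable section

/-! ### Unbounded operators, given by their graphs -/

section Operators

variable {H : Type*} [NormedAddCommGroup H] [InnerProductSpace ℂ H]

/-- The resolvent set of the operator `A` with graph `G` (`(u, f) ∈ G` means `A u = f`):
the `z` for which `(A - z)⁻¹` is an everywhere defined bounded operator. -/
def graphResolventSet (G : Submodule ℂ (H × H)) : Set ℂ :=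
  {z | ∃ R : H →L[ℂ] H, ∀ u f : H, (u, f + z • u) ∈ G ↔ u = R f}

/-- The spectrum of the operator with graph `G`. -/
def graphSpectrum (G : Submodule ℂ (H × H)) : Set ℂ := (graphResolventSet G)ᶜ

/-- The eigenspace `ker (A - z)` of the operator `A` with graph `G`. -/
def graphEigenspace (G : Submodule ℂ (H × H)) (z : ℂ) : Submodule ℂ H :=
  G.comap (LinearMap.prod LinearMap.id (z • LinearMap.id))

/-- The spectrum is discrete: it consists of isolated eigenvalues of finite multiplicity. -/
def HasDiscreteSpectrum (G : Submodule ℂ (H × H)) : Prop :=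
  ∀ z ∈ graphSpectrum G,
    (∀ᶠ w in 𝓝[≠] z, w ∉ graphSpectrum G) ∧
      graphEigenspace G z ≠ ⊥ ∧ FiniteDimensional ℂ (graphEigenspace G z)

/-- `N(r; A)`: the number of eigenvalues in `(-∞, r)`, counted with multiplicities. -/
def eigenvalueCount (G : Submodule ℂ (H × H)) (r : ℝ) : ℕ∞ :=
  ∑' s : Iio r, Cardinal.toENat (Module.rank ℂ (graphEigenspace G ((s : ℝ) : ℂ)))

end Operators

/-! ### The operator associated with the form `∫ (|u'|² + q |u|²) dμ` -/

section Forms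

variable {X : Type*} [MeasurableSpace X] {μ : Measure X}

/-- The sesquilinear form `∫ (u' conj v' + q u conj v) dμ`, for `p = (v, v')` and `p' = (u, u')`. -/
def schrodingerForm (q : X → ℝ) (p p' : Lp ℂ 2 μ × Lp ℂ 2 μ) : ℂ :=
  ∫ x, (conj (p.2 x) * p'.2 x + (q x : ℂ) * (conj (p.1 x) * p'.1 x)) ∂μ

/-- `u` lies in the weighted space `L²_q`, that is `∫ |q| |u|² dμ < ∞`. -/
def MemWeightedL2 (q : X → ℝ) (u : Lp ℂ 2 μ) : Prop :=
  Integrable (fun x => q x * ‖u x‖ ^ 2) μ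

lemma MemWeightedL2.mul_integrable {q : X → ℝ} (hq : Measurable q) {u v : Lp ℂ 2 μ}
    (hu : MemWeightedL2 q u) (hv : MemWeightedL2 q v) :
    Integrable (fun x => (q x : ℂ) * (conj (v x) * u x)) μ := by
  refine (hu.norm.add hv.norm).mono' ?_ ?_
  · exact (Complex.measurable_ofReal.comp hq).aestronglyMeasurable.mul
      ((Complex.continuous_conj.comp_aestronglyMeasurable (Lp.aestronglyMeasurable v)).mul
        (Lp.aestronglyMeasurable u))
  · refine Filter.Eventually.of_forall fun x => ?_
    simp only [norm_mul, Complex.norm_real, RCLike.norm_conj, Pi.add_apply, norm_pow,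
      Real.norm_eq_abs, abs_norm]
    nlinarith [mul_nonneg (abs_nonneg (q x)) (sq_nonneg (‖u x‖ - ‖v x‖)),
      mul_nonneg (abs_nonneg (q x)) (mul_nonneg (norm_nonneg (u x)) (norm_nonneg (v x))),
      mul_nonneg (abs_nonneg (q x)) (sq_nonneg (‖u x‖ + ‖v x‖))]

lemma MemWeightedL2.add {q : X → ℝ} (hq : Measurable q) {u v : Lp ℂ 2 μ}
    (hu : MemWeightedL2 q u) (hv : MemWeightedL2 q v) : MemWeightedL2 q (u + v) := by
  refine ((hu.norm.const_mul 2).add (hv.norm.const_mul 2)).mono' ?_ ?_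
  · exact hq.aestronglyMeasurable.mul ((Lp.aestronglyMeasurable (u + v)).norm.pow 2)
  · filter_upwards [Lp.coeFn_add u v] with x hx
    simp only [hx, norm_mul, Pi.add_apply, norm_pow, Real.norm_eq_abs, abs_norm]
    have h1 : ‖u x + v x‖ ^ 2 ≤ 2 * (‖u x‖ ^ 2 + ‖v x‖ ^ 2) := by
      have h2 := norm_add_le (u x) (v x)
      nlinarith [norm_nonneg (u x + v x), sq_nonneg (‖u x‖ - ‖v x‖)]
    nlinarith [mul_le_mul_of_nonneg_left h1 (abs_nonneg (q x))]

lemma MemWeightedL2.smul {q : X → ℝ} (c : ℂ) {u : Lp ℂ 2 μ}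
    (hu : MemWeightedL2 q u) : MemWeightedL2 q (c • u) := by
  refine (hu.const_mul (‖c‖ ^ 2)).congr ?_
  filter_upwards [Lp.coeFn_smul c u] with x hx
  simp only [hx, Pi.smul_apply, norm_smul]
  ring

lemma MemWeightedL2.zero (q : X → ℝ) : MemWeightedL2 q (0 : Lp ℂ 2 μ) := by
  refine (integrable_zero X ℝ μ).congr ?_
  filter_upwards [Lp.coeFn_zero ℂ 2 μ] with x hx
  rw [hx]
  simp

/-- Let `W` be the graph of a derivation `u ↦ u'` in `L²(μ)`. The form domain consists of the
`u ∈ L²_q` in the domain of the derivation; we record `u` together with `u'`. -/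
def formDomain (W : Submodule ℂ (Lp ℂ 2 μ × Lp ℂ 2 μ)) (q : X → ℝ) (hq : Measurable q) :
    Submodule ℂ (Lp ℂ 2 μ × Lp ℂ 2 μ) where
  carrier := {p | p ∈ W ∧ MemWeightedL2 q p.1}
  add_mem' ha hb := ⟨W.add_mem ha.1 hb.1, ha.2.add hq hb.2⟩
  zero_mem' := ⟨W.zero_mem, MemWeightedL2.zero q⟩
  smul_mem' c _ ha := ⟨W.smul_mem c ha.1, ha.2.smul c⟩

lemma schrodingerForm_integrable {q : X → ℝ} (hq : Measurable q)
    {p p' : Lp ℂ 2 μ × Lp ℂ 2 μ} (hp : MemWeightedL2 q p.1) (hp' : MemWeightedL2 q p'.1) :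
    Integrable (fun x =>
      conj (p.2 x) * p'.2 x + (q x : ℂ) * (conj (p.1 x) * p'.1 x)) μ := by
  refine Integrable.add ?_ (hp'.mul_integrable hq hp)
  refine (L2.integrable_inner (𝕜 := ℂ) p.2 p'.2).congr (Filter.Eventually.of_forall fun x => ?_)
  simp [mul_comm]

lemma schrodingerForm_add {q : X → ℝ} (hq : Measurable q)
    {p a b : Lp ℂ 2 μ × Lp ℂ 2 μ} (hp : MemWeightedL2 q p.1) (ha : MemWeightedL2 q a.1)
    (hb : MemWeightedL2 q b.1) :
    schrodingerForm q p (a + b) = schrodingerForm q p a + schrodingerForm q p b := by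
  unfold schrodingerForm
  rw [← integral_add (schrodingerForm_integrable hq hp ha) (schrodingerForm_integrable hq hp hb)]
  refine integral_congr_ae ?_
  filter_upwards [Lp.coeFn_add a.1 b.1, Lp.coeFn_add a.2 b.2] with x h1 h2
  simp only [Prod.fst_add, Prod.snd_add, h1, h2, Pi.add_apply]
  ring

lemma schrodingerForm_smul (q : X → ℝ) (p a : Lp ℂ 2 μ × Lp ℂ 2 μ) (c : ℂ) :
    schrodingerForm q p (c • a) = c * schrodingerForm q p a := by
  unfold schrodingerForm
  rw [← integral_const_mul]
  refine integral_congr_ae ?_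
  filter_upwards [Lp.coeFn_smul c a.1, Lp.coeFn_smul c a.2] with x h1 h2
  simp only [Prod.smul_fst, Prod.smul_snd, h1, h2, Pi.smul_apply, smul_eq_mul]
  ring

/-- (The graph of) the self-adjoint operator `A` in `L²(μ)` associated with the form: `A u = f` iff
`u` is in the form domain and, for all `v` in the form domain, the value of the sesquilinear form at
`u, v` is the `L²`-inner product of `f` and `v`. If the form domain is not dense, this is
the self-adjoint linear relation whose operator part acts in the closure of the form domain; it has
the same resolvent set and the same eigenspaces as that operator part. -/
def formOperator (W : Submodule ℂ (Lp ℂ 2 μ × Lp ℂ 2 μ)) (q : X → ℝ) (hq : Measurable q) :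
    Submodule ℂ (Lp ℂ 2 μ × Lp ℂ 2 μ) where
  carrier := {r | ∃ u', (r.1, u') ∈ formDomain W q hq ∧
    ∀ p ∈ formDomain W q hq, schrodingerForm q p (r.1, u') = ⟪p.1, r.2⟫_ℂ}
  add_mem' := by
    rintro ⟨u, f⟩ ⟨v, g⟩ ⟨u', hu, hf⟩ ⟨v', hv, hg⟩
    refine ⟨u' + v', (formDomain W q hq).add_mem hu hv, fun p hp => ?_⟩
    have := schrodingerForm_add hq hp.2 hu.2 hv.2
    simp only [Prod.mk_add_mk] at this ⊢
    rw [this, hf p hp, hg p hp, inner_add_right]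
  zero_mem' := by
    refine ⟨0, (formDomain W q hq).zero_mem, fun p _ => ?_⟩
    have := schrodingerForm_smul q p 0 0
    rw [zero_smul, zero_mul] at this
    exact this.trans (inner_zero_right _).symm
  smul_mem' := by
    rintro c ⟨u, f⟩ ⟨u', hu, hf⟩
    refine ⟨c • u', (formDomain W q hq).smul_mem c hu, fun p hp => ?_⟩
    have := schrodingerForm_smul q p (u, u') c
    simp only [Prod.smul_mk] at this ⊢
    rw [this, hf p hp, inner_smul_right]

end Forms

/-! ### Absolutely continuous functions on a segment -/

/-- `f` is absolutely continuous on the segment `[a, b]` with derivative `g`. -/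
def IsPrimitiveOn (a b : ℝ) (f g : ℝ → ℂ) : Prop :=
  IntervalIntegrable g volume a b ∧ ∀ t ∈ Icc a b, f t = f a + ∫ s in a..t, g s

lemma IsPrimitiveOn.zero (a b : ℝ) : IsPrimitiveOn a b (fun _ => 0) (fun _ => 0) :=
  ⟨by simp, by simp⟩

lemma IsPrimitiveOn.add {a b : ℝ} {f g f' g' : ℝ → ℂ} (h : IsPrimitiveOn a b f g)
    (h' : IsPrimitiveOn a b f' g') :
    IsPrimitiveOn a b (fun t => f t + f' t) (fun t => g t + g' t) := by
  refine ⟨h.1.add h'.1, fun t ht => ?_⟩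
  have hsub : uIcc a t ⊆ uIcc a b := by
    rw [uIcc_of_le ht.1, uIcc_of_le (ht.1.trans ht.2)]
    exact Icc_subset_Icc_right ht.2
  rw [intervalIntegral.integral_add (h.1.mono_set hsub) (h'.1.mono_set hsub)]
  simp only [h.2 t ht, h'.2 t ht]
  ring

lemma IsPrimitiveOn.smul {a b : ℝ} {f g : ℝ → ℂ} (c : ℂ) (h : IsPrimitiveOn a b f g) :
    IsPrimitiveOn a b (fun t => c * f t) (fun t => c * g t) := by
  refine ⟨h.1.const_mul c, fun t ht => ?_⟩
  rw [intervalIntegral.integral_const_mul]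
  simp only [h.2 t ht]
  ring

/-! ### Rooted metric trees -/

/-- A rooted metric tree, given by the map that sends each vertex `y ≠ root` to the initial vertex
of the only edge `e_y⁻` that terminates at `y`. Every vertex has finite generation. -/
structure RootedMetricTree where
  /-- the vertices -/
  Vertex : Type*
  /-- the root -/
  root : Vertex
  /-- the initial vertex of the edge that terminates at a given vertex -/
  parent : Vertex → Vertex
  parent_root : parent root = root
  exists_iterate_parent : ∀ y, ∃ n : ℕ, parent^[n] y = root
  /-- `length y` is the length of the edge `e_y⁻` (of no meaning for `y = root`) -/
  length : Vertex → ℝ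
  length_pos : ∀ y, y ≠ root → 0 < length y

namespace RootedMetricTree

variable (T : RootedMetricTree)

/-- The generation of a vertex: the number of vertices `x` with `o ≺ x ≼ y`. -/
def gen (y : T.Vertex) : ℕ := sInf {n | T.parent^[n] y = T.root}

/-- The distance `|y|` of a vertex from the root. -/
def height (y : T.Vertex) : ℝ := ∑ i ∈ Finset.range (T.gen y), T.length (T.parent^[i] y)

/-- The branching number of a vertex: the number of edges emanating from it. -/
def branching (y : T.Vertex) : ℕ := {z | z ≠ T.root ∧ T.parent z = y}.ncard

/-- A tree is regular if all vertices of the same generation have equal branching numbers and all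
edges of the same generation (that of the initial vertex) have equal lengths. -/
def IsRegular : Prop :=
  (∀ y z, T.gen y = T.gen z → T.branching y = T.branching z) ∧
  (∀ y z, y ≠ T.root → z ≠ T.root → T.gen (T.parent y) = T.gen (T.parent z) →
    T.length y = T.length z)

instance : MeasurableSpace T.Vertex := ⊤

/-- The measure `dx` on the tree. A point `x` other than the root is given by the pair `(y, |x|)`
where `e_y⁻` is the edge with `x ∈ e_y⁻` and `|parent y| < |x| ≤ |y|`; on each edge, `dx` is the
Lebesgue measure. -/
def measure : Measure (T.Vertex × ℝ) :=
  Measure.sum fun y : {y : T.Vertex // y ≠ T.root} =>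
    (volume.restrict (Ioc (T.height (T.parent y)) (T.height y))).map (Prod.mk (y : T.Vertex))

/-- `F` (with `F y` the restriction to the closed edge `e_y⁻`, as a function of `|x|`) is a
continuous function on the tree that vanishes at the root and is absolutely continuous on each edge,
with derivative `G`. The values at the vertices are `c`. -/
def IsPrimitive (F G : T.Vertex → ℝ → ℂ) : Prop :=
  (∃ c : T.Vertex → ℂ, c T.root = 0 ∧ ∀ y, y ≠ T.root →
    F y (T.height (T.parent y)) = c (T.parent y) ∧ F y (T.height y) = c y) ∧
  ∀ y, y ≠ T.root → IsPrimitiveOn (T.height (T.parent y)) (T.height y) (F y) (G y)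

/-- The pairs `(f, f')` with `f` in the Sobolev space `H^{1,0}` of the tree: `f` is continuous,
`f(o) = 0`, the restriction of `f` to each edge is in `H¹`, and `f, f' ∈ L²`. -/
def sobolev : Submodule ℂ (Lp ℂ 2 T.measure × Lp ℂ 2 T.measure) where
  carrier := {p | ∃ F G : T.Vertex → ℝ → ℂ, T.IsPrimitive F G ∧
    (∀ᵐ x ∂T.measure, p.1 x = F x.1 x.2) ∧ ∀ᵐ x ∂T.measure, p.2 x = G x.1 x.2}
  add_mem' := by
    rintro p q ⟨F, G, ⟨⟨c, hc0, hc⟩, h⟩, hF, hG⟩ ⟨F', G', ⟨⟨c', hc0', hc'⟩, h'⟩, hF', hG'⟩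
    refine ⟨fun y t => F y t + F' y t, fun y t => G y t + G' y t,
      ⟨⟨fun y => c y + c' y, by simp [hc0, hc0'], fun y hy => ?_⟩,
        fun y hy => (h y hy).add (h' y hy)⟩, ?_, ?_⟩
    · simp only [(hc y hy).1, (hc y hy).2, (hc' y hy).1, (hc' y hy).2, and_self]
    · filter_upwards [hF, hF', Lp.coeFn_add p.1 q.1] with x h1 h2 h3
      exact h3.trans (by rw [Pi.add_apply, h1, h2])
    · filter_upwards [hG, hG', Lp.coeFn_add p.2 q.2] with x h1 h2 h3
      exact h3.trans (by rw [Pi.add_apply, h1, h2])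
  zero_mem' := by
    refine ⟨fun _ _ => 0, fun _ _ => 0, ⟨⟨fun _ => 0, rfl, by simp⟩,
      fun y _ => IsPrimitiveOn.zero _ _⟩, ?_, ?_⟩ <;>
    · filter_upwards [Lp.coeFn_zero ℂ 2 T.measure] with x hx
      exact hx
  smul_mem' := by
    rintro a p ⟨F, G, ⟨⟨c, hc0, hc⟩, h⟩, hF, hG⟩
    refine ⟨fun y t => a * F y t, fun y t => a * G y t,
      ⟨⟨fun y => a * c y, by simp [hc0], fun y hy => ?_⟩, fun y hy => (h y hy).smul a⟩, ?_, ?_⟩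
    · simp only [(hc y hy).1, (hc y hy).2, and_self]
    · filter_upwards [hF, Lp.coeFn_smul a p.1] with x h1 h3
      exact h3.trans (by rw [Pi.smul_apply, h1, smul_eq_mul])
    · filter_upwards [hG, Lp.coeFn_smul a p.2] with x h1 h3
      exact h3.trans (by rw [Pi.smul_apply, h1, smul_eq_mul])

/-- The Schrödinger operator `A_V = -Δ + V(|x|)` on the tree, defined by the form
`∫ (|f'|² + V(|x|) |f|²) dx` on `H^{1,0} ∩ L²_V`. -/
def schrodinger (V : ℝ → ℝ) (hV : Measurable V) :
    Submodule ℂ (Lp ℂ 2 T.measure × Lp ℂ 2 T.measure) :=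
  formOperator T.sobolev (fun x => V x.2) (hV.comp measurable_snd)

end RootedMetricTree

/-! ### The operators on the half-open intervals `[t_k, R)`, `R = lim t_n` -/

namespace RegularTree

variable (b : ℕ → ℕ) (t : ℕ → ℝ) (k : ℕ)

/-- The branching function: `g_k(s) = b_{k+1} ⋯ b_n` for `t_n < s ≤ t_{n+1}`, `n ≥ k` (so it is `1`
for `n = k`), and `g_k = 0` outside `(t_k, R)`. -/
def branchingFunction (s : ℝ) : ℝ≥0∞ :=
  ∑' n : ℕ, (Ioc (t (k + n)) (t (k + n + 1))).indicator
    (fun _ => ∏ j ∈ Finset.Ioc k (k + n), (b j : ℝ≥0∞)) s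

/-- The measure `g_k(s) ds` on `(t_k, R)`. -/
def weightedMeasure : Measure ℝ := volume.withDensity (branchingFunction b t k)

/-- The pairs `(u, u')` such that `u` is locally absolutely continuous on `[t_k, R)`,
`u(t_k) = 0`, and `u, u' ∈ L²((t_k, R), g_k)`. -/
def sobolev : Submodule ℂ
    (Lp ℂ 2 (weightedMeasure b t k) × Lp ℂ 2 (weightedMeasure b t k)) where
  carrier := {p | ∃ F G : ℝ → ℂ, F (t k) = 0 ∧ (∀ n, k ≤ n → IsPrimitiveOn (t k) (t n) F G) ∧
    (∀ᵐ s ∂weightedMeasure b t k, p.1 s = F s) ∧ ∀ᵐ s ∂weightedMeasure b t k, p.2 s = G s}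
  add_mem' := by
    rintro p q ⟨F, G, h0, h, hF, hG⟩ ⟨F', G', h0', h', hF', hG'⟩
    refine ⟨fun s => F s + F' s, fun s => G s + G' s, by simp [h0, h0'],
      fun n hn => (h n hn).add (h' n hn), ?_, ?_⟩
    · filter_upwards [hF, hF', Lp.coeFn_add p.1 q.1] with x h1 h2 h3
      exact h3.trans (by rw [Pi.add_apply, h1, h2])
    · filter_upwards [hG, hG', Lp.coeFn_add p.2 q.2] with x h1 h2 h3
      exact h3.trans (by rw [Pi.add_apply, h1, h2])
  zero_mem' := by
    refine ⟨fun _ => 0, fun _ => 0, rfl, fun n _ => IsPrimitiveOn.zero _ _, ?_, ?_⟩ <;>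
    · filter_upwards [Lp.coeFn_zero ℂ 2 (weightedMeasure b t k)] with x hx
      exact hx
  smul_mem' := by
    rintro a p ⟨F, G, h0, h, hF, hG⟩
    refine ⟨fun s => a * F s, fun s => a * G s, by simp [h0], fun n hn => (h n hn).smul a, ?_, ?_⟩
    · filter_upwards [hF, Lp.coeFn_smul a p.1] with x h1 h3
      exact h3.trans (by rw [Pi.smul_apply, h1, smul_eq_mul])
    · filter_upwards [hG, Lp.coeFn_smul a p.2] with x h1 h3
      exact h3.trans (by rw [Pi.smul_apply, h1, smul_eq_mul])

/-- The operator `A_{V,k}` in `L²((t_k, R), g_k)`, defined by the form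
`∫ (|u'|² + V |u|²) g_k ds` on the functions `u` with `u(t_k) = 0`. -/
def schrodinger (V : ℝ → ℝ) (hV : Measurable V) :
    Submodule ℂ (Lp ℂ 2 (weightedMeasure b t k) × Lp ℂ 2 (weightedMeasure b t k)) :=
  formOperator (sobolev b t k) V hV

end RegularTree

end

noncomputable section

/-! ### Compact operators between Hilbert spaces -/

section Compact

variable {E F F' : Type*} [NormedAddCommGroup E] [NormedSpace ℂ E]
  [NormedAddCommGroup F] [NormedSpace ℂ F] [NormedAddCommGroup F'] [NormedSpace ℂ F']

/-! Fix `m` with `V + m ≥ 1`. The form domain, with the squared norm `a_V[f] + m ‖f‖²`, is a Hilbert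
space. If `J` is its embedding into `L²`, the equation that defines the operator says that its
resolvent at `-m` is `J J*` (`isResolventAt_formOperator`). Hence the spectrum is discrete exactly
when `J` is compact (`IsResolventAt.hasDiscreteSpectrum_iff`), and the eigenspaces are those of `J
J*`. The same holds on each half-open interval, with an embedding `j_k`.

The tree is decomposed as follows. Take a function on the vertices of generation `k + 1` whose
values on the children of each vertex `y ≠ o` of generation `k` sum to zero, and continue it as a
constant along each subtree. The products of this amplitude with radial functions supported beyond
`t_k` form one part. Parts with different `k` are orthogonal, since the amplitude with the smaller
index is constant on the siblings over which the other one sums to zero. On each level the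
amplitudes span all functions (`eq_zero_of_sum_conj_amp_mul`). An orthonormal basis of the zero sum
space gives as many isometric copies of `L²(g_k)` as its dimension, which is `1` for `k = 0` and
`b_1 ⋯ b_{k-1} (b_k - 1)` for `k ≥ 1` (`finrank_zeroSumSpace_succ`).

These isometries commute with multiplication by radial functions. They and their adjoints, which are
weighted means over the points at a given distance from the root, respect the Sobolev spaces
(`embed_mem_sobolev`, `adj_embed_mem_sobolev`): the condition `u(t_k) = 0` corresponds to continuity
at the branching vertices. So `J` is the orthogonal sum of copies of the `j_k`, each eigenspace
splits accordingly, and the counting formula follows.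

If `J` is compact, so is every restriction `j_k`. Conversely, let `j_0` be compact. On `(t_k, R)`
the weight `g_0` is a constant multiple of `g_k`, so extension by zero, rescaled, makes `j_k` a
restriction of `j_0`. Hence `j_k` is compact, and `‖j_k‖ → 0` because the supports escape from every
`[0, t_n]` (`tendsto_norm_of_intertwine`). As each `k` occurs finitely often, `J` is a norm limit of
compact operators (`isCompactOperator_of_weighted`). -/

lemma IsCompactOperator.not_separated {S : E →L[ℂ] F} (hS : IsCompactOperator S)
    {x : ℕ → E} {C ε : ℝ} (hε : 0 < ε) (hx : ∀ n, ‖x n‖ ≤ C)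
    (hsep : ∀ i j, i ≠ j → ε ≤ ‖S (x i) - S (x j)‖) : False := by
  obtain ⟨K, hK, hK'⟩ :=
    IsCompactOperator.image_closedBall_subset_compact (f := (S : E →ₗ[ℂ] F)) hS C
  obtain ⟨y, -, ψ, hψ, hψy⟩ := hK.tendsto_subseq (x := fun n => S (x n))
    (fun n ↦ hK' ⟨x n, by simp [hx], rfl⟩)
  obtain ⟨N, hN⟩ := Metric.cauchySeq_iff'.1 hψy.cauchySeq ε hε
  have := hN (N + 1) (by simp)
  rw [dist_eq_norm] at this
  exact this.not_ge (hsep _ _ (fun h => by simpa using hψ.injective h))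

/-- Two points of the unit ball differ by at most `2` in norm, so if their images under `S` are
within `ε² / 2`, those under `T` are within `ε`. A finite net for the image under `S` therefore
yields one for the image under `T`. -/
lemma isCompactOperator_of_norm_sq_le [CompleteSpace F'] {S : E →L[ℂ] F} {T : E →L[ℂ] F'}
    (hS : IsCompactOperator S) (h : ∀ x, ‖T x‖ ^ 2 ≤ ‖S x‖ * ‖x‖) : IsCompactOperator T := by
  refine (isCompactOperator_iff_isCompact_closure_image_closedBall (T : E →ₗ[ℂ] F')
    one_pos).2 ?_
  refine TotallyBounded.isCompact_of_isClosed (TotallyBounded.closure ?_) isClosed_closure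
  have hS1 : TotallyBounded (S '' Metric.closedBall 0 1) :=
    (IsCompactOperator.isCompact_closure_image_closedBall (f := (S : E →ₗ[ℂ] F)) hS
      1).totallyBounded.subset subset_closure
  refine Metric.totallyBounded_iff.2 fun ε hε => ?_
  obtain ⟨t, hts, htf, ht⟩ := Metric.finite_approx_of_totallyBounded hS1 (ε ^ 2 / 2) (by positivity)
  have hts' : ∀ y ∈ t, ∃ x ∈ Metric.closedBall (0 : E) 1, S x = y := fun y hy => hts hy
  choose! g hg using hts'
  refine ⟨(fun y => T (g y)) '' t, htf.image _, ?_⟩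
  rintro _ ⟨x, hx, rfl⟩
  obtain ⟨y, hy, hxy⟩ := mem_iUnion₂.1 (ht ⟨x, hx, rfl⟩)
  refine mem_iUnion₂.2 ⟨_, ⟨y, hy, rfl⟩, ?_⟩
  rw [Metric.mem_ball, dist_eq_norm] at hxy ⊢
  have h1 := h (x - g y)
  rw [map_sub, map_sub, (hg y hy).2] at h1
  have h2 : ‖x - g y‖ ≤ 2 := by
    have h3 := (hg y hy).1
    rw [mem_closedBall_zero_iff] at h3 hx
    linarith [norm_sub_le x (g y)]
  have h4 : ‖T x - T (g y)‖ ^ 2 < ε ^ 2 := by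
    nlinarith [norm_nonneg (S x - y), norm_nonneg (x - g y)]
  exact lt_of_pow_lt_pow_left₀ 2 hε.le h4

lemma isCompactOperator_of_range_le {T : E →L[ℂ] F} (V : Submodule ℂ F) [FiniteDimensional ℂ V]
    (h : ∀ x, T x ∈ V) : IsCompactOperator T := by
  have : ProperSpace V := FiniteDimensional.proper ℂ V
  have h1 : IsCompactOperator (T.codRestrict V h) :=
    isCompactOperator_of_locallyCompactSpace_dom (T.codRestrict V h)
  exact h1.clm_comp V.subtypeL

lemma isCompactOperator_finset_sum {ι : Type*} (s : Finset ι) {T : ι → E →L[ℂ] F}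
    (h : ∀ i ∈ s, IsCompactOperator (T i)) : IsCompactOperator (∑ i ∈ s, T i : E →L[ℂ] F) := by
  classical
  induction s using Finset.induction_on with
  | empty => simpa using isCompactOperator_zero
  | insert a s ha ih =>
    rw [Finset.sum_insert ha]
    exact (h a (by simp)).add (ih fun i hi => h i (by simp [hi]))

lemma isCompactOperator_of_approx [CompleteSpace F] {T : E →L[ℂ] F}
    (h : ∀ ε > 0, ∃ S : E →L[ℂ] F, IsCompactOperator S ∧ ‖T - S‖ ≤ ε) : IsCompactOperator T := by
  have : T ∈ closure {S : E →L[ℂ] F | IsCompactOperator S} := by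
    refine Metric.mem_closure_iff.2 fun ε hε => ?_
    obtain ⟨S, hS, h1⟩ := h (ε / 2) (by positivity)
    exact ⟨S, hS, by rw [dist_eq_norm]; linarith⟩
  rwa [(isClosed_setOfPred_isCompactOperator (σ₁₂ := RingHom.id ℂ)).closure_eq] at this

variable {H K : Type*} [NormedAddCommGroup H] [InnerProductSpace ℂ H] [CompleteSpace H]
  [NormedAddCommGroup K] [InnerProductSpace ℂ K] [CompleteSpace K]

/-- Since `‖J* x‖² = ⟪J J* x, x⟫ ≤ ‖J J* x‖ ‖x‖`, compactness of `J J*` gives that of `J*`, hence of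
`J* J`; the same estimate with the roles exchanged then gives that of `J`. -/
lemma isCompactOperator_comp_adjoint_iff (J : K →L[ℂ] H) :
    IsCompactOperator (J ∘L J.adjoint) ↔ IsCompactOperator J := by
  have key : ∀ {H K : Type _} [NormedAddCommGroup H] [InnerProductSpace ℂ H] [CompleteSpace H]
      [NormedAddCommGroup K] [InnerProductSpace ℂ K] [CompleteSpace K] (J : K →L[ℂ] H),
      IsCompactOperator (J ∘L J.adjoint) → IsCompactOperator J.adjoint := by
    intro H K _ _ _ _ _ _ J hJ
    refine isCompactOperator_of_norm_sq_le hJ fun x => ?_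
    have : ‖J.adjoint x‖ ^ 2 = RCLike.re ⟪(J ∘L J.adjoint) x, x⟫_ℂ := by
      rw [ContinuousLinearMap.comp_apply, ← ContinuousLinearMap.adjoint_inner_right,
        inner_self_eq_norm_sq]
    rw [this]
    exact re_inner_le_norm _ _
  refine ⟨fun h => ?_, fun h => h.comp_clm _⟩
  have h1 := key J h
  have h2 : IsCompactOperator (J.adjoint ∘L J.adjoint.adjoint) := h1.comp_clm _
  have := isCompactOperator_of_norm_sq_le (T := J) h2 fun x => by
    have : ‖J x‖ ^ 2 = RCLike.re ⟪(J.adjoint ∘L J) x, x⟫_ℂ := by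
      rw [ContinuousLinearMap.comp_apply, ContinuousLinearMap.adjoint_inner_left,
        inner_self_eq_norm_sq]
    rw [this, ContinuousLinearMap.adjoint_adjoint]
    exact re_inner_le_norm _ _
  exact this

end Compact

/-! ### Operators given by a resolvent -/

section Resolvent

variable {H : Type*} [NormedAddCommGroup H] [InnerProductSpace ℂ H]

/-- `B` is the resolvent `(A + m)⁻¹` of the operator `A` with graph `G`. -/
def IsResolventAt (B : H →L[ℂ] H) (m : ℝ) (G : Submodule ℂ (H × H)) : Prop :=
  ∀ u g, (u, g) ∈ G ↔ u = B (g + (m : ℂ) • u)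

namespace IsResolventAt

variable {B : H →L[ℂ] H} {m : ℝ} {G : Submodule ℂ (H × H)}

/-- Membership `(u, f + z u) ∈ G` means `(1 - (z + m) B) u = B f`. So the resolvent at `z` is `(1 -
(z + m) B)⁻¹ B`, and in the other direction a resolvent `R` gives the inverse `1 + (z + m) R`. -/
lemma mem_graphResolventSet_iff (h : IsResolventAt B m G) (z : ℂ) :
    z ∈ graphResolventSet G ↔ IsUnit (1 - (z + m) • B) := by
  have h0 : ∀ u f, (u, f + z • u) ∈ G ↔ (1 - (z + m) • B) u = B f := by
    intro u f
    have : f + z • u + (m : ℂ) • u = f + (z + m) • u := by module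
    rw [h, this, map_add, map_smul, sub_apply,
      one_apply_eq_self, smul_apply, sub_eq_iff_eq_add]
  constructor
  · rintro ⟨R, hR⟩
    have hR' : ∀ f, (1 - (z + m) • B) (R f) = B f := fun f => (h0 _ _).1 ((hR _ _).2 rfl)
    have hinj : ∀ u, (1 - (z + m) • B) u = 0 → u = 0 := fun u hu => by
      have := (hR u 0).1 ((h0 u 0).2 (by rw [hu, map_zero]))
      rwa [map_zero] at this
    have h1 : (1 - (z + m) • B) * (1 + (z + m) • R) = 1 := by
      ext u
      simp only [mul_apply_eq_comp, add_apply, map_add,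
        smul_apply, map_smul, hR', one_apply_eq_self]
      simp
    have h2 : (1 + (z + m) • R) * (1 - (z + m) • B) = 1 := by
      ext u
      rw [← sub_eq_zero, one_apply_eq_self]
      apply hinj
      rw [map_sub, ← mul_apply_eq_comp, ← mul_assoc, h1, one_mul, sub_self]
    exact ⟨⟨_, _, h1, h2⟩, rfl⟩
  · rintro ⟨S, hS⟩
    refine ⟨(↑S⁻¹ : H →L[ℂ] H) * B, fun u f => ?_⟩
    rw [h0, ← hS]
    constructor
    · intro h1
      rw [mul_apply_eq_comp, ← h1, ← mul_apply_eq_comp, S.inv_mul]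
      rfl
    · rintro rfl
      rw [← mul_apply_eq_comp, ← mul_assoc, S.mul_inv, one_mul]

lemma mem_graphEigenspace_iff (h : IsResolventAt B m G) (z : ℂ) (u : H) :
    u ∈ graphEigenspace G z ↔ u = (z + m) • B u := by
  have : u ∈ graphEigenspace G z ↔ (u, z • u) ∈ G := by
    simp [graphEigenspace, Submodule.mem_comap]
  rw [this, h, ← add_smul, map_smul]

lemma add_ne_zero (h : IsResolventAt B m G) {z : ℂ} (hz : z ∈ graphSpectrum G) : z + m ≠ 0 := by
  intro h0
  apply hz
  rw [h.mem_graphResolventSet_iff, h0, zero_smul, sub_zero]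
  exact isUnit_one

lemma mem_graphSpectrum_iff (h : IsResolventAt B m G) {z : ℂ} (hz : z + m ≠ 0) :
    z ∈ graphSpectrum G ↔ (z + m)⁻¹ ∈ spectrum ℂ B := by
  have h1 : algebraMap ℂ (H →L[ℂ] H) (z + m)⁻¹ - B
      = (Units.mk0 _ hz)⁻¹ • (1 - (z + m) • B) := by
    ext u
    simp [Algebra.algebraMap_eq_smul_one, Units.smul_def, smul_sub, smul_smul, hz]
  rw [spectrum.mem_iff, h1, graphSpectrum, mem_compl_iff, h.mem_graphResolventSet_iff,
    isUnit_smul_iff]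

lemma graphEigenspace_eq (h : IsResolventAt B m G) {z : ℂ} (hz : z + m ≠ 0) :
    graphEigenspace G z = Module.End.eigenspace (B : Module.End ℂ H) (z + m)⁻¹ := by
  ext u
  rw [h.mem_graphEigenspace_iff, Module.End.mem_eigenspace_iff]
  change _ ↔ B u = _
  rw [eq_inv_smul_iff₀ hz, eq_comm]

lemma graphEigenspace_eq_bot (h : IsResolventAt B m G) {z : ℂ} (hz : z + m = 0) :
    graphEigenspace G z = ⊥ := by
  rw [eq_bot_iff]
  intro u hu
  rw [h.mem_graphEigenspace_iff, hz, zero_smul] at hu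
  exact hu

lemma finiteDimensional_graphEigenspace [CompleteSpace H] (h : IsResolventAt B m G)
    (hB : IsCompactOperator B) (z : ℂ) : FiniteDimensional ℂ (graphEigenspace G z) := by
  by_cases hz : z + m = 0
  · rw [h.graphEigenspace_eq_bot hz]
    infer_instance
  · rw [h.graphEigenspace_eq hz]
    exact ContinuousLinearMap.finite_dimensional_eigenspace hB _ (inv_ne_zero hz)

/-- Unit eigenvectors `u` for different `z` are orthogonal, hence at distance `√2`. Each is the
image under `B` of the vector `(z + m) u`, of norm at most `C + |m|`, so a compact `B` allows only
finitely many. -/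
lemma finite_eigenvalues (h : IsResolventAt B m G)
    (hB : IsCompactOperator B) (hsymm : (B : H →ₗ[ℂ] H).IsSymmetric) (C : ℝ) :
    {z : ℂ | ‖z‖ ≤ C ∧ graphEigenspace G z ≠ ⊥}.Finite := by
  by_contra hinf
  let ζ := Set.Infinite.natEmbedding _ hinf
  have h1 : ∀ n, ∃ u : H, u ∈ graphEigenspace G (ζ n) ∧ ‖u‖ = 1 := by
    intro n
    obtain ⟨u, hu, hu0⟩ := (Submodule.ne_bot_iff _).1 (ζ n).2.2
    refine ⟨((‖u‖⁻¹ : ℝ) : ℂ) • u, Submodule.smul_mem _ _ hu, ?_⟩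
    rw [norm_smul, Complex.norm_real, norm_inv, norm_norm, inv_mul_cancel₀ (norm_ne_zero_iff.2 hu0)]
  choose u hu hu1 using h1
  have hζ : ∀ n, (ζ n : ℂ) + m ≠ 0 := fun n hn => (ζ n).2.2 (h.graphEigenspace_eq_bot hn)
  have hB' : ∀ n, B (((ζ n : ℂ) + m) • u n) = u n := fun n => by
    rw [map_smul, ← (h.mem_graphEigenspace_iff _ _).1 (hu n)]
  refine hB.not_separated (x := fun n => ((ζ n : ℂ) + m) • u n) (C := C + |m|) one_pos ?_ ?_
  · intro n
    rw [norm_smul, hu1, mul_one]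
    refine (norm_add_le _ _).trans (add_le_add (ζ n).2.1 ?_)
    rw [Complex.norm_real, Real.norm_eq_abs]
  · intro i j hij
    simp only [hB']
    have hne : ((ζ i : ℂ) + m)⁻¹ ≠ ((ζ j : ℂ) + m)⁻¹ := fun h' =>
      hij (ζ.injective (Subtype.ext (by simpa using h')))
    have hor : ⟪u i, u j⟫_ℂ = 0 := by
      have hi := hu i
      have hj := hu j
      rw [h.graphEigenspace_eq (hζ _)] at hi hj
      exact hsymm.orthogonalFamily_eigenspaces hne ⟨u i, hi⟩ ⟨u j, hj⟩
    have h2 : ‖u i - u j‖ ^ 2 = 2 := by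
      rw [@norm_sub_sq ℂ, hor, hu1, hu1]
      norm_num
    nlinarith [norm_nonneg (u i - u j)]

lemma hasDiscreteSpectrum [CompleteSpace H] (h : IsResolventAt B m G)
    (hB : IsCompactOperator B) (hsymm : (B : H →ₗ[ℂ] H).IsSymmetric) :
    HasDiscreteSpectrum G := by
  have hev : ∀ z ∈ graphSpectrum G, graphEigenspace G z ≠ ⊥ := by
    intro z hz
    have hz0 := h.add_ne_zero hz
    rw [h.mem_graphSpectrum_iff hz0, ← hB.hasEigenvalue_iff_mem_spectrum (inv_ne_zero hz0)] at hz
    rw [h.graphEigenspace_eq hz0]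
    exact hz
  intro z hz
  refine ⟨?_, hev z hz, h.finiteDimensional_graphEigenspace hB z⟩
  -- The disc of radius `‖z‖ + 1` is a neighbourhood of `z`; it contains finitely many eigenvalues,
  -- and every spectral point is an eigenvalue.
  have hfin := h.finite_eigenvalues hB hsymm (‖z‖ + 1)
  have h1 : ∀ᶠ w in 𝓝[≠] z, w ∉ {z' : ℂ | ‖z'‖ ≤ ‖z‖ + 1 ∧ graphEigenspace G z' ≠ ⊥} := by
    have : ∀ᶠ w in 𝓝 z,
        w ∉ {z' : ℂ | ‖z'‖ ≤ ‖z‖ + 1 ∧ graphEigenspace G z' ≠ ⊥} \ {z} :=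
      hfin.sdiff.isClosed.isOpen_compl.mem_nhds (by simp)
    rw [eventually_nhdsWithin_iff]
    filter_upwards [this] with w hw hwz hw'
    exact hw ⟨hw', hwz⟩
  have h2 : ∀ᶠ w in 𝓝[≠] z, ‖w‖ < ‖z‖ + 1 :=
    (continuous_norm.continuousAt.eventually_lt continuousAt_const (by simp)).filter_mono
      nhdsWithin_le_nhds
  filter_upwards [h1, h2] with w hw1 hw2 hw3
  exact hw1 ⟨hw2.le, hev w hw3⟩

end IsResolventAt

end Resolvent
end

noncomputable section

/-! ### Discreteness of the spectrum and compactness of the resolvent -/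

section Discrete

variable {H K : Type*} [NormedAddCommGroup H] [InnerProductSpace ℂ H] [CompleteSpace H]
  [NormedAddCommGroup K] [InnerProductSpace ℂ K] [CompleteSpace K]

/-- The indicator of a point is continuous on a spectrum that does not accumulate there, so the
functional calculus gives the spectral projection. Its range lies in the eigenspace because the
functions `y` and `x` agree where the indicator is nonzero. -/
lemma isCompactOperator_cfc_indicator {B : H →L[ℂ] H} (hB : IsSelfAdjoint B) {x : ℝ}
    (hx : ∀ᶠ y in 𝓝[≠] x, y ∉ spectrum ℝ B)
    (hfin : FiniteDimensional ℂ (Module.End.eigenspace (B : Module.End ℂ H) (x : ℂ))) :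
    ContinuousOn (fun y : ℝ => if y = x then (1 : ℝ) else 0) (spectrum ℝ B) ∧
      IsCompactOperator (cfc (fun y : ℝ => if y = x then (1 : ℝ) else 0) B : H →L[ℂ] H) := by
  have hcont : ContinuousOn (fun y : ℝ => if y = x then (1 : ℝ) else 0) (spectrum ℝ B) := by
    intro y hy
    by_cases hyx : y = x
    · subst hyx
      have : ∀ᶠ w in 𝓝[spectrum ℝ B] y, w = y := by
        rw [eventually_nhdsWithin_iff] at hx ⊢
        filter_upwards [hx] with w hw hws
        by_contra hne
        exact hw hne hws
      refine Filter.Tendsto.congr' (f₁ := fun _ => if y = y then (1 : ℝ) else 0) ?_ tendsto_const_nhds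
      filter_upwards [this] with w hw
      rw [hw]
    · refine ContinuousAt.continuousWithinAt ?_
      refine (continuousAt_const (y := (0 : ℝ))).congr ?_
      filter_upwards [isOpen_ne.mem_nhds hyx] with w hw
      rw [if_neg hw]
  refine ⟨hcont, isCompactOperator_of_range_le
    (Module.End.eigenspace (B : Module.End ℂ H) (x : ℂ)) fun u => ?_⟩
  rw [Module.End.mem_eigenspace_iff]
  have h1 : B * cfc (fun y : ℝ => if y = x then (1 : ℝ) else 0) B
      = x • cfc (fun y : ℝ => if y = x then (1 : ℝ) else 0) B := by
    conv_lhs => enter [1]; rw [← cfc_id' ℝ B]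
    rw [← cfc_mul (fun y : ℝ => y) _ B continuousOn_id hcont, ← cfc_smul x _ B hcont]
    congr 1
    ext y
    split_ifs with h <;> simp [h]
  have h2 := congrArg (fun S : H →L[ℂ] H => S u) h1
  simpa using h2

/-- Under `y ↦ y⁻¹ - m` the nonzero spectrum of `B` corresponds to the spectrum of the operator, so
it consists of isolated points with finite-dimensional eigenspaces. Removing from `B` the spectral
parts with `|x| ≥ ε`, finite in number, leaves an operator of norm at most `ε`. -/
lemma IsResolventAt.isCompactOperator {B : H →L[ℂ] H} {m : ℝ} {G : Submodule ℂ (H × H)}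
    (h : IsResolventAt B m G) (hB : IsSelfAdjoint B) (hd : HasDiscreteSpectrum G) :
    IsCompactOperator B := by
  have hmem : ∀ y : ℝ, y ≠ 0 → (y ∈ spectrum ℝ B ↔ ((y⁻¹ - m : ℝ) : ℂ) ∈ graphSpectrum G) := by
    intro y hy
    have h0 : ((y⁻¹ - m : ℝ) : ℂ) + m = ((y⁻¹ : ℝ) : ℂ) := by push_cast; ring
    rw [h.mem_graphSpectrum_iff (by rw [h0]; exact_mod_cast inv_ne_zero hy), h0,
      ← Complex.ofReal_inv, inv_inv]
    rw [← spectrum.preimage_algebraMap (R := ℝ) ℂ]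
    rfl
  have hiso : ∀ x : ℝ, x ≠ 0 → x ∈ spectrum ℝ B → ∀ᶠ y in 𝓝[≠] x, y ∉ spectrum ℝ B := by
    intro x hx hxs
    have h1 := (hd _ ((hmem x hx).1 hxs)).1
    have h2 : Filter.Tendsto (fun y : ℝ => ((y⁻¹ - m : ℝ) : ℂ)) (𝓝[≠] x)
        (𝓝[≠] ((x⁻¹ - m : ℝ) : ℂ)) := by
      refine tendsto_nhdsWithin_iff.2 ⟨?_, ?_⟩
      · refine Filter.Tendsto.mono_left ?_ nhdsWithin_le_nhds
        have : ContinuousAt (fun y : ℝ => ((y⁻¹ - m : ℝ) : ℂ)) x :=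
          Complex.continuous_ofReal.continuousAt.comp
            ((continuousAt_inv₀ hx).sub continuousAt_const)
        exact this
      · filter_upwards [self_mem_nhdsWithin] with y hy h'
        apply hy
        have h' : ((y⁻¹ - m : ℝ) : ℂ) = ((x⁻¹ - m : ℝ) : ℂ) := h'
        have := Complex.ofReal_injective h'
        simpa using this
    have h3 : ∀ᶠ y in 𝓝[≠] x, y ≠ 0 :=
      (isOpen_ne.eventually_mem hx).filter_mono nhdsWithin_le_nhds
    filter_upwards [h2.eventually h1, h3] with y hy hy0 hys
    exact hy ((hmem y hy0).1 hys)
  have hcpt : ∀ x : ℝ, x ≠ 0 → x ∈ spectrum ℝ B →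
      ContinuousOn (fun y : ℝ => if y = x then (1 : ℝ) else 0) (spectrum ℝ B) ∧
      IsCompactOperator (cfc (fun y : ℝ => if y = x then (1 : ℝ) else 0) B : H →L[ℂ] H) := by
    intro x hx hxs
    refine isCompactOperator_cfc_indicator hB (hiso x hx hxs) ?_
    have h0 : ((x⁻¹ - m : ℝ) : ℂ) + m = ((x⁻¹ : ℝ) : ℂ) := by push_cast; ring
    have h1 := (hd _ ((hmem x hx).1 hxs)).2.2
    rw [h.graphEigenspace_eq (by rw [h0]; exact_mod_cast inv_ne_zero hx), h0,
      ← Complex.ofReal_inv, inv_inv] at h1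
    exact h1
  refine isCompactOperator_of_approx fun ε hε => ?_
  -- This set is compact; were it infinite, it would have an accumulation point, which is a nonzero
  -- and non-isolated point of the spectrum.
  have hfin : {x ∈ spectrum ℝ B | ε ≤ |x|}.Finite := by
    by_contra hinf
    have hc : IsCompact {x ∈ spectrum ℝ B | ε ≤ |x|} :=
      (spectrum.isCompact B).inter_right (isClosed_le continuous_const continuous_abs)
    obtain ⟨x, hx, hacc⟩ := Set.Infinite.exists_accPt_of_subset_isCompact hinf hc subset_rfl
    have hx0 : x ≠ 0 := by
      rintro rfl
      have := hx.2
      rw [abs_zero] at this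
      linarith
    rw [accPt_iff_frequently_nhdsNE] at hacc
    refine hacc ((hiso x hx0 hx.1).mono fun y hy hy' => hy hy'.1)
  let s := hfin.toFinset
  have hs : ∀ x ∈ s, x ≠ 0 ∧ x ∈ spectrum ℝ B := by
    intro x hx
    have hx := hfin.mem_toFinset.1 hx
    refine ⟨?_, hx.1⟩
    rintro rfl
    have := hx.2
    rw [abs_zero] at this
    linarith
  refine ⟨∑ x ∈ s, x • cfc (fun y : ℝ => if y = x then (1 : ℝ) else 0) B,
    isCompactOperator_finset_sum _ fun x hx => ?_, ?_⟩
  · exact (hcpt x (hs x hx).1 (hs x hx).2).2.smul x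
  · have h1 : ∑ x ∈ s, x • cfc (fun y : ℝ => if y = x then (1 : ℝ) else 0) B
        = cfc (fun y : ℝ => ∑ x ∈ s, x • (if y = x then (1 : ℝ) else 0)) B := by
      have h0 := cfc_sum (fun (x y : ℝ) => x • (if y = x then (1 : ℝ) else 0)) B s
        fun x hx => (hcpt x (hs x hx).1 (hs x hx).2).1.const_smul x
      have h0' : (∑ x ∈ s, fun y : ℝ => x • (if y = x then (1 : ℝ) else 0))
          = fun y : ℝ => ∑ x ∈ s, x • (if y = x then (1 : ℝ) else 0) := by
        ext y
        rw [Finset.sum_apply]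
      rw [h0'] at h0
      rw [h0]
      refine Finset.sum_congr rfl fun x hx => ?_
      rw [cfc_smul x _ B (hcpt x (hs x hx).1 (hs x hx).2).1]
    have h2 : ContinuousOn (fun y : ℝ => ∑ x ∈ s, x • (if y = x then (1 : ℝ) else 0))
        (spectrum ℝ B) :=
      continuousOn_finsetSum _ fun x hx => (hcpt x (hs x hx).1 (hs x hx).2).1.const_smul x
    rw [h1]
    conv_lhs => enter [1, 1]; rw [← cfc_id' ℝ B]
    rw [← cfc_sub (fun y : ℝ => y) _ B continuousOn_id h2]
    refine norm_cfc_le hε.le fun y hy => ?_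
    simp only [smul_eq_mul, mul_ite, mul_one, mul_zero, Finset.sum_ite_eq, s, hfin.mem_toFinset]
    split_ifs with h'
    · simp [hε.le]
    · rw [sub_zero, Real.norm_eq_abs]
      by_contra hlt
      exact h' (hfin.mem_toFinset.2 ⟨hy, (not_le.1 hlt).le⟩)

lemma isSelfAdjoint_comp_adjoint (J : K →L[ℂ] H) : IsSelfAdjoint (J ∘L J.adjoint) := by
  rw [ContinuousLinearMap.isSelfAdjoint_iff', ContinuousLinearMap.adjoint_comp,
    ContinuousLinearMap.adjoint_adjoint]

lemma IsResolventAt.hasDiscreteSpectrum_iff {J : K →L[ℂ] H} {m : ℝ} {G : Submodule ℂ (H × H)}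
    (h : IsResolventAt (J ∘L J.adjoint) m G) :
    HasDiscreteSpectrum G ↔ IsCompactOperator J := by
  rw [← isCompactOperator_comp_adjoint_iff]
  exact ⟨h.isCompactOperator (isSelfAdjoint_comp_adjoint J),
    fun hJ => h.hasDiscreteSpectrum hJ (isSelfAdjoint_comp_adjoint J).isSymmetric⟩

/-- For an eigenvector `u` with eigenvalue `s`, `‖u‖² = (s + m) ‖J* u‖²` forces `s > -m`.
Eigenvalues below `r` thus stay in a bounded interval, and `|r| + 2 |m|` is a crude bound for their
modulus. -/
lemma IsResolventAt.eigenvalueCount_ne_top {J : K →L[ℂ] H} {m : ℝ} {G : Submodule ℂ (H × H)}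
    (h : IsResolventAt (J ∘L J.adjoint) m G) (hJ : IsCompactOperator J) (r : ℝ) :
    eigenvalueCount G r ≠ ⊤ := by
  have hB := (isCompactOperator_comp_adjoint_iff J).2 hJ
  have hfin := h.finite_eigenvalues hB (isSelfAdjoint_comp_adjoint J).isSymmetric (|r| + 2 * |m|)
  have hfin' : {s : Iio r | graphEigenspace G ((s : ℝ) : ℂ) ≠ ⊥}.Finite := by
    refine Set.Finite.of_finite_image (f := fun s : Iio r => ((s : ℝ) : ℂ)) (hfin.subset ?_)
      (fun a _ b _ hab => Subtype.ext (Complex.ofReal_injective hab))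
    rintro _ ⟨s, hs, rfl⟩
    refine ⟨?_, hs⟩
    obtain ⟨u, hu, hu0⟩ := (Submodule.ne_bot_iff _).1 hs
    rw [h.mem_graphEigenspace_iff] at hu
    have h1 : ‖u‖ ^ 2 = (s + m) * ‖J.adjoint u‖ ^ 2 := by
      have h2 : ⟪u, u⟫_ℂ = ((s : ℝ) + m : ℂ) * ⟪J.adjoint u, J.adjoint u⟫_ℂ := by
        conv_lhs => enter [3]; rw [hu]
        rw [inner_smul_right, ContinuousLinearMap.comp_apply,
          ← ContinuousLinearMap.adjoint_inner_left]
      rw [inner_self_eq_norm_sq_to_K, inner_self_eq_norm_sq_to_K] at h2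
      rw [← Complex.ofReal_inj]
      push_cast
      exact h2
    have h3 : 0 < ‖u‖ ^ 2 := by positivity
    have h4 : 0 < (s : ℝ) + m := by
      by_contra hneg
      nlinarith [sq_nonneg ‖J.adjoint u‖]
    have h5 : (s : ℝ) < r := s.2
    rw [Complex.norm_real, Real.norm_eq_abs, abs_le]
    constructor
    · linarith [le_abs_self m, abs_nonneg r, abs_nonneg m]
    · linarith [le_abs_self r, abs_nonneg m]
  rw [eigenvalueCount, tsum_eq_sum (s := hfin'.toFinset)]
  · refine WithTop.sum_ne_top.2 fun s _ => ?_
    change Cardinal.toENat (Module.rank ℂ (graphEigenspace G ((s : ℝ) : ℂ))) ≠ (⊤ : ℕ∞)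
    rw [Cardinal.toENat_ne_top]
    have := h.finiteDimensional_graphEigenspace hB ((s : ℝ) : ℂ)
    exact Module.rank_lt_aleph0 ℂ _
  · intro s hs
    have : graphEigenspace G ((s : ℝ) : ℂ) = ⊥ := by
      by_contra hne
      exact hs (hfin'.mem_toFinset.2 hne)
    rw [this]
    simp

end Discrete
end

noncomputable section

/-! ### Sums of extended natural numbers -/

lemma ENat.hasSum_iSup {ι : Type*} (f : ι → ℕ∞) : HasSum f (⨆ s : Finset ι, ∑ i ∈ s, f i) :=
  tendsto_atTop_iSup fun _ _ h => Finset.sum_le_sum_of_subset h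

/-- Every such sum converges, so no `∑'` in the counting formula takes its default value, and sums
may be interchanged and regrouped freely. -/
lemma ENat.summable_all {ι : Type*} (f : ι → ℕ∞) : Summable f := (ENat.hasSum_iSup f).summable

lemma ENat.tsum_eq_iSup {ι : Type*} (f : ι → ℕ∞) :
    ∑' i, f i = ⨆ s : Finset ι, ∑ i ∈ s, f i := (ENat.hasSum_iSup f).tsum_eq

lemma ENat.tsum_comm_all {ι κ : Type*} (f : ι → κ → ℕ∞) :
    ∑' j, ∑' i, f i j = ∑' i, ∑' j, f i j :=
  Summable.tsum_comm' (ENat.summable_all _) (fun _ => ENat.summable_all _)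
    fun _ => ENat.summable_all _

lemma ENat.tsum_eq_top_of_infinite {ι : Type*} {f : ι → ℕ∞} (h : {i | f i ≠ 0}.Infinite) :
    ∑' i, f i = ⊤ := by
  rw [ENat.tsum_eq_iSup, ENat.eq_top_iff_forall_ge]
  intro n
  obtain ⟨s, hs, hn⟩ := h.exists_subset_card_eq n
  refine le_trans ?_ (le_iSup _ s)
  have : ∑ i ∈ s, (1 : ℕ∞) ≤ ∑ i ∈ s, f i :=
    Finset.sum_le_sum fun i hi => Order.one_le_iff_ne_zero.2 (hs hi)
  simpa [hn] using this

lemma toENat_rank_pi {ι : Type*} [Fintype ι] {E : ι → Type*} [∀ i, AddCommGroup (E i)]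
    [∀ i, Module ℂ (E i)] :
    Cardinal.toENat (Module.rank ℂ (∀ i, E i)) = ∑ i, Cardinal.toENat (Module.rank ℂ (E i)) := by
  by_cases h : ∀ i, Module.Finite ℂ (E i)
  · rw [← Module.finrank_eq_rank, Module.finrank_pi_fintype, Cardinal.toENat_nat]
    push_cast
    exact Finset.sum_congr rfl fun i _ => by
      rw [← Module.finrank_eq_rank, Cardinal.toENat_nat]
  · push Not at h
    obtain ⟨i, hi⟩ := h
    have h1 : Cardinal.toENat (Module.rank ℂ (E i)) = ⊤ := by
      rw [Cardinal.toENat_eq_top]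
      by_contra hlt
      exact hi (Module.rank_lt_aleph0_iff.1 (not_le.1 hlt))
    have h2 : Cardinal.toENat (Module.rank ℂ (∀ i, E i)) = ⊤ := by
      rw [Cardinal.toENat_eq_top]
      by_contra hlt
      have := Module.rank_lt_aleph0_iff.1 (not_le.1 hlt)
      exact hi (Module.Finite.of_surjective (LinearMap.proj i : (∀ i, E i) →ₗ[ℂ] E i)
        (LinearMap.proj_surjective i))
    rw [h2, eq_comm, eq_top_iff, ← h1]
    exact Finset.single_le_sum (f := fun i => Cardinal.toENat (Module.rank ℂ (E i)))
      (fun _ _ => zero_le) (Finset.mem_univ i)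

lemma toENat_rank_le_of_injective {E F : Type*} [AddCommGroup E] [AddCommGroup F] [Module ℂ E]
    [Module ℂ F] (f : E →ₗ[ℂ] F) (hf : Function.Injective f) :
    Cardinal.toENat (Module.rank ℂ E) ≤ Cardinal.toENat (Module.rank ℂ F) := by
  have := OrderHomClass.mono Cardinal.toENat (LinearMap.lift_rank_le_of_injective f hf)
  rwa [Cardinal.toENat_lift, Cardinal.toENat_lift] at this

/-! ### Orthogonal decompositions -/

section Decomposition

variable {ι : Type*} {H : Type*} [NormedAddCommGroup H] [InnerProductSpace ℂ H] [CompleteSpace H]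
  {E : ι → Type*} [∀ i, NormedAddCommGroup (E i)] [∀ i, InnerProductSpace ℂ (E i)]
  [∀ i, CompleteSpace (E i)]

/-- The adjoint of an isometry. -/
abbrev LinearIsometry.adj {E H : Type*} [NormedAddCommGroup H] [InnerProductSpace ℂ H]
    [CompleteSpace H] [NormedAddCommGroup E] [InnerProductSpace ℂ E] [CompleteSpace E]
    (U : E →ₗᵢ[ℂ] H) : H →L[ℂ] E := U.toContinuousLinearMap.adjoint

lemma LinearIsometry.adj_apply_self {E H : Type*} [NormedAddCommGroup H] [InnerProductSpace ℂ H]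
    [CompleteSpace H] [NormedAddCommGroup E] [InnerProductSpace ℂ E] [CompleteSpace E]
    (U : E →ₗᵢ[ℂ] H) (x : E) : U.adj (U x) = x :=
  congrArg (fun S : E →L[ℂ] E => S x) U.adjoint_comp_self

lemma LinearIsometry.norm_adj_apply_le {E H : Type*} [NormedAddCommGroup H] [InnerProductSpace ℂ H]
    [CompleteSpace H] [NormedAddCommGroup E] [InnerProductSpace ℂ E] [CompleteSpace E]
    (U : E →ₗᵢ[ℂ] H) (x : H) : ‖U.adj x‖ ≤ ‖x‖ := by
  have h : ‖U.adj‖ ≤ 1 := by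
    rw [LinearIsometryEquiv.norm_map]
    exact U.norm_toContinuousLinearMap_le
  simpa using U.adj.le_of_opNorm_le h x

variable {U : ∀ i, E i →ₗᵢ[ℂ] H}

lemma OrthogonalFamily.adj_apply_of_ne (hU : OrthogonalFamily ℂ E U) {i j : ι} (hij : i ≠ j)
    (x : E j) : (U i).adj (U j x) = 0 := by
  refine ext_inner_left ℂ fun y => ?_
  rw [ContinuousLinearMap.adjoint_inner_right, inner_zero_right]
  exact hU hij y x

/-- Bessel's inequality: the partial sum `y` satisfies `‖y‖² = re ⟪y, x⟫ ≤ ‖y‖ ‖x‖`. -/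
lemma OrthogonalFamily.sum_norm_sq_adj_le (hU : OrthogonalFamily ℂ E U) (s : Finset ι) (x : H) :
    ∑ i ∈ s, ‖(U i).adj x‖ ^ 2 ≤ ‖x‖ ^ 2 := by
  set y := ∑ i ∈ s, U i ((U i).adj x) with hy
  have h1 : ‖y‖ ^ 2 = ∑ i ∈ s, ‖(U i).adj x‖ ^ 2 := hU.norm_sum (fun i => (U i).adj x) s
  have h2 : RCLike.re ⟪y, x⟫_ℂ = ∑ i ∈ s, ‖(U i).adj x‖ ^ 2 := by
    rw [hy, sum_inner, map_sum]
    refine Finset.sum_congr rfl fun i _ => ?_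
    rw [← inner_self_eq_norm_sq (𝕜 := ℂ), ContinuousLinearMap.adjoint_inner_right]
    rfl
  have h3 := re_inner_le_norm (𝕜 := ℂ) y x
  rw [h2, ← h1] at h3
  rw [← h1]
  rcases (norm_nonneg y).eq_or_lt with h | h
  · rw [← h, zero_pow two_ne_zero]
    positivity
  · have : ‖y‖ ≤ ‖x‖ := by nlinarith
    gcongr

/-- The bound makes the orthogonal series of the components of `x` converge; its sum has the same
components as `x`, so totality identifies the two, and each partial sum has norm at most `C`. -/
lemma OrthogonalFamily.norm_le_of_sum_norm_sq_adj_le (hU : OrthogonalFamily ℂ E U)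
    (htot : ∀ x, (∀ i, (U i).adj x = 0) → x = 0) {x : H} {C : ℝ} (hC : 0 ≤ C)
    (h : ∀ s : Finset ι, ∑ i ∈ s, ‖(U i).adj x‖ ^ 2 ≤ C ^ 2) : ‖x‖ ≤ C := by
  have hsum : Summable fun i => ‖(U i).adj x‖ ^ 2 :=
    summable_of_sum_le (fun i => by positivity) h
  have hs := (hU.summable_iff_norm_sq_summable (fun i => (U i).adj x)).2 hsum
  obtain ⟨y, hy⟩ := hs
  have hyx : y = x := by
    rw [← sub_eq_zero]
    refine htot _ fun i => ?_
    rw [map_sub, sub_eq_zero]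
    have h1 := hy.mapL (U i).adj
    refine h1.unique ?_
    convert hasSum_single i ?_ using 1
    · rw [LinearIsometry.adj_apply_self]
    · intro j hj
      exact hU.adj_apply_of_ne hj.symm _
  subst hyx
  have h2 : Filter.Tendsto (fun s : Finset ι => ‖∑ i ∈ s, U i ((U i).adj y)‖) Filter.atTop
      (𝓝 ‖y‖) := (continuous_norm.tendsto _).comp hy
  refine le_of_tendsto' h2 fun s => ?_
  have h3 := hU.norm_sum (fun i => (U i).adj y) s
  have h4 := h s
  rw [← h3] at h4
  exact (pow_le_pow_iff_left₀ (norm_nonneg _) hC two_ne_zero).1 h4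

/-- The dimension of a subspace that is reduced by an orthogonal decomposition is the sum of the
dimensions of its parts. -/
lemma OrthogonalFamily.toENat_rank_eq_tsum (hU : OrthogonalFamily ℂ E U)
    (htot : ∀ x, (∀ i, (U i).adj x = 0) → x = 0) (M : Submodule ℂ H)
    (N : ∀ i, Submodule ℂ (E i)) (hN : ∀ i, ∀ x ∈ N i, U i x ∈ M)
    (hM : ∀ i, ∀ x ∈ M, (U i).adj x ∈ N i) :
    Cardinal.toENat (Module.rank ℂ M) = ∑' i, Cardinal.toENat (Module.rank ℂ (N i)) := by
  classical
  apply le_antisymm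
  -- With finitely many nontrivial parts, the components in these determine a vector of `M` by
  -- totality; with infinitely many, the right-hand side is `⊤`.
  · by_cases hfin : {i | Cardinal.toENat (Module.rank ℂ (N i)) ≠ 0}.Finite
    · rw [tsum_eq_sum (s := hfin.toFinset) (by simp), ← Finset.sum_coe_sort, ← toENat_rank_pi]
      let f : M →ₗ[ℂ] ∀ i : hfin.toFinset, N i := LinearMap.pi fun i =>
        (((U i).adj : H →ₗ[ℂ] E i).restrict (hM i))
      refine toENat_rank_le_of_injective f ?_
      rw [← LinearMap.ker_eq_bot, LinearMap.ker_eq_bot']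
      intro x hx
      refine Subtype.ext (htot _ fun i => ?_)
      by_cases hi : i ∈ hfin.toFinset
      · exact congrArg Subtype.val (congrFun hx ⟨i, hi⟩)
      · have h0 : Cardinal.toENat (Module.rank ℂ (N i)) = 0 := by simpa using hi
        rw [Cardinal.toENat_eq_zero, rank_zero_iff] at h0
        exact congrArg Subtype.val (Subsingleton.elim (⟨_, hM i x x.2⟩ : N i) 0)
    · rw [ENat.tsum_eq_top_of_infinite hfin]
      exact le_top
  -- Each finite subfamily of the `N i` embeds in `M` by summation, since orthogonality lets the
  -- components be recovered.
  · rw [ENat.tsum_eq_iSup]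
    refine iSup_le fun s => ?_
    rw [← Finset.sum_coe_sort, ← toENat_rank_pi]
    let g : (∀ i : s, N i) →ₗ[ℂ] H :=
      ∑ i : s, ((U i).toLinearMap ∘ₗ (N i).subtype) ∘ₗ LinearMap.proj i
    have hg : ∀ x, g x = ∑ i : s, U i (x i) := fun x => by simp [g]
    have hgM : ∀ x, g x ∈ M := fun x => by
      rw [hg]
      exact Submodule.sum_mem _ fun i _ => hN i _ (x i).2
    refine toENat_rank_le_of_injective (g.codRestrict M hgM) ?_
    rw [← LinearMap.ker_eq_bot, LinearMap.ker_eq_bot']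
    intro x hx
    have hx0 : g x = 0 := congrArg Subtype.val hx
    ext i
    have h1 : (U i).adj (g x) = x i := by
      rw [hg, map_sum, Finset.sum_eq_single i, LinearIsometry.adj_apply_self]
      · intro j _ hj
        exact hU.adj_apply_of_ne (fun h => hj (Subtype.ext h.symm)) _
      · simp
    rw [← h1, hx0]
    simp

variable {K : Type*} [NormedAddCommGroup K] [InnerProductSpace ℂ K] [CompleteSpace K]
  {F : ι → Type*} [∀ i, NormedAddCommGroup (F i)] [∀ i, InnerProductSpace ℂ (F i)]
  [∀ i, CompleteSpace (F i)] {UK : ∀ i, F i →ₗᵢ[ℂ] K} {J : K →L[ℂ] H} {j : ∀ i, F i →L[ℂ] E i}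

/-- If the embedding of the form domain is the orthogonal sum of compact embeddings whose norms
tend to zero, then it is compact. -/
lemma OrthogonalFamily.isCompactOperator (hU : OrthogonalFamily ℂ E U)
    (htot : ∀ x, (∀ i, (U i).adj x = 0) → x = 0) (hUK : OrthogonalFamily ℂ F UK)
    (hadj : ∀ i x, j i ((UK i).adj x) = (U i).adj (J x))
    (hj : ∀ i, IsCompactOperator (j i)) (hfin : ∀ ε > 0, {i | ε < ‖j i‖}.Finite) :
    IsCompactOperator J := by
  classical
  refine isCompactOperator_of_approx fun ε hε => ?_
  refine ⟨∑ i ∈ (hfin ε hε).toFinset, (U i).toContinuousLinearMap ∘L j i ∘L (UK i).adj,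
    isCompactOperator_finset_sum _ fun i _ => ?_, ?_⟩
  · exact ((hj i).comp_clm _).clm_comp _
  refine ContinuousLinearMap.opNorm_le_bound _ hε.le fun x => ?_
  refine hU.norm_le_of_sum_norm_sq_adj_le htot (by positivity) fun s => ?_
  -- The components with `‖j i‖ > ε` cancel, and each remaining one is `j i` applied to a component
  -- of `x`.
  have h1 : ∀ i, ‖(U i).adj ((J - ∑ i ∈ (hfin ε hε).toFinset,
      (U i).toContinuousLinearMap ∘L j i ∘L (UK i).adj) x)‖ ≤ ε * ‖(UK i).adj x‖ := by
    intro i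
    rw [sub_apply, map_sub, sum_apply, map_sum, ← hadj]
    by_cases hi : i ∈ (hfin ε hε).toFinset
    · rw [Finset.sum_eq_single_of_mem i hi]
      · have h2 : (U i).adj (((U i).toContinuousLinearMap ∘L j i ∘L (UK i).adj) x)
            = j i ((UK i).adj x) := (U i).adj_apply_self _
        rw [h2, sub_self, norm_zero]
        positivity
      · intro k _ hk
        exact hU.adj_apply_of_ne hk.symm _
    · rw [Finset.sum_eq_zero, sub_zero]
      · have hi' : ‖j i‖ ≤ ε := by simpa using hi
        exact (j i).le_of_opNorm_le hi' _
      · intro k hk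
        exact hU.adj_apply_of_ne (i := i) (j := k) (fun h => hi (h.symm ▸ hk)) _
  calc _ ≤ ∑ i ∈ s, (ε * ‖(UK i).adj x‖) ^ 2 :=
        Finset.sum_le_sum fun i _ => by gcongr; exact h1 i
    _ = ε ^ 2 * ∑ i ∈ s, ‖(UK i).adj x‖ ^ 2 := by
        rw [Finset.mul_sum]
        exact Finset.sum_congr rfl fun i _ => by ring
    _ ≤ ε ^ 2 * ‖x‖ ^ 2 := by
        gcongr
        exact hUK.sum_norm_sq_adj_le s x
    _ = (ε * ‖x‖) ^ 2 := by ring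

/-- The eigenvalue counting function of an orthogonal sum. -/
lemma OrthogonalFamily.eigenvalueCount_eq_tsum (hU : OrthogonalFamily ℂ E U)
    (htot : ∀ x, (∀ i, (U i).adj x = 0) → x = 0)
    (hmap : ∀ i x, J (UK i x) = U i (j i x))
    (hadj : ∀ i x, j i ((UK i).adj x) = (U i).adj (J x))
    {m : ℝ} {G : Submodule ℂ (H × H)} {g : ∀ i, Submodule ℂ (E i × E i)}
    (hG : IsResolventAt (J ∘L J.adjoint) m G)
    (hg : ∀ i, IsResolventAt (j i ∘L (j i).adjoint) m (g i)) (r : ℝ) :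
    eigenvalueCount G r = ∑' i, eigenvalueCount (g i) r := by
  -- The adjoints of the two intertwining relations; together with these relations they show that `J
  -- J*` is intertwined with each `j i (j i)*`, both by `U i` and by its adjoint.
  have hmap' : ∀ i x, (UK i).adj (J.adjoint x) = (j i).adjoint ((U i).adj x) := fun i x => by
    refine ext_inner_left ℂ fun y => ?_
    simp only [ContinuousLinearMap.adjoint_inner_right]
    exact congrArg (fun w => ⟪w, x⟫_ℂ) (hmap i y)
  have hadj' : ∀ i x, J.adjoint (U i x) = UK i ((j i).adjoint x) := fun i x => by
    refine ext_inner_left ℂ fun y => ?_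
    rw [ContinuousLinearMap.adjoint_inner_right]
    have h1 := ContinuousLinearMap.adjoint_inner_left (U i).toContinuousLinearMap x (J y)
    have h2 := ContinuousLinearMap.adjoint_inner_left (UK i).toContinuousLinearMap
      ((j i).adjoint x) y
    have h3 := ContinuousLinearMap.adjoint_inner_right (j i) ((UK i).adj y) x
    exact h1.symm.trans ((congrArg (fun w => ⟪w, x⟫_ℂ) (hadj i y)).symm.trans (h3.symm.trans h2))
  unfold eigenvalueCount
  rw [ENat.tsum_comm_all]
  refine tsum_congr fun s => ?_
  refine hU.toENat_rank_eq_tsum htot _ _ (fun i x hx => ?_) fun i x hx => ?_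
  · rw [(hg i).mem_graphEigenspace_iff] at hx
    rw [hG.mem_graphEigenspace_iff, ContinuousLinearMap.comp_apply, hadj', hmap, ← map_smul]
    exact congrArg (U i) hx
  · rw [hG.mem_graphEigenspace_iff] at hx
    rw [(hg i).mem_graphEigenspace_iff, ContinuousLinearMap.comp_apply, ← hmap', hadj, ← map_smul]
    exact congrArg (U i).adj hx

lemma isCompactOperator_of_intertwine {E F : Type*} [NormedAddCommGroup E] [InnerProductSpace ℂ E]
    [CompleteSpace E] [NormedAddCommGroup F] [InnerProductSpace ℂ F]
    {U : E →ₗᵢ[ℂ] H} {UK : F →ₗᵢ[ℂ] K} {j : F →L[ℂ] E} (hmap : ∀ x, J (UK x) = U (j x))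
    (hJ : IsCompactOperator J) : IsCompactOperator j := by
  have h : j = U.adj ∘L J ∘L UK.toContinuousLinearMap := by
    ext x
    exact ((congrArg U.adj (hmap x)).trans (U.adj_apply_self _)).symm
  rw [h]
  exact (hJ.comp_clm UK.toContinuousLinearMap).clm_comp U.adj

/-- A compact embedding restricted to a sequence of subspaces that tend weakly to zero. -/
lemma tendsto_norm_of_intertwine {E F : ℕ → Type*} [∀ i, NormedAddCommGroup (E i)]
    [∀ i, InnerProductSpace ℂ (E i)] [∀ i, CompleteSpace (E i)] [∀ i, NormedAddCommGroup (F i)]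
    [∀ i, InnerProductSpace ℂ (F i)]
    {U : ∀ i, E i →ₗᵢ[ℂ] H} {UK : ∀ i, F i →ₗᵢ[ℂ] K} {j : ∀ i, F i →L[ℂ] E i}
    (hmap : ∀ i x, J (UK i x) = U i (j i x)) (hJ : IsCompactOperator J)
    (hU : ∀ x, Filter.Tendsto (fun i => ‖(U i).adj x‖) Filter.atTop (𝓝 0)) :
    Filter.Tendsto (fun i => ‖j i‖) Filter.atTop (𝓝 0) := by
  refine Metric.tendsto_atTop.2 fun ε hε => ?_
  have htb : TotallyBounded (J '' Metric.closedBall 0 1) :=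
    (IsCompactOperator.isCompact_closure_image_closedBall (f := (J : K →ₗ[ℂ] H)) hJ
      1).totallyBounded.subset subset_closure
  obtain ⟨t, htf, ht⟩ := Metric.totallyBounded_iff.1 htb (ε / 4) (by positivity)
  -- The adjoints are contractions, so their smallness on the finite net `t` carries over to the
  -- whole image of the unit ball under `J`.
  have h1 : ∀ᶠ i in Filter.atTop, ∀ y ∈ t, ‖(U i).adj y‖ < ε / 4 :=
    (Filter.eventually_all_finite htf).2 fun y _ =>
      (hU y).eventually_lt_const (by positivity)
  obtain ⟨N, hN⟩ := Filter.eventually_atTop.1 h1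
  refine ⟨N, fun n hn => ?_⟩
  rw [Real.dist_eq, sub_zero, abs_norm]
  refine lt_of_le_of_lt (b := ε / 2) ?_ (by linarith)
  refine ContinuousLinearMap.opNorm_le_of_unit_norm (by positivity) fun x hx => ?_
  obtain ⟨y, hy, hxy⟩ := mem_iUnion₂.1 (ht ⟨UK n x, by simp [hx], rfl⟩)
  rw [Metric.mem_ball, dist_eq_norm] at hxy
  have h2 : j n x = (U n).adj (J (UK n x) - y) + (U n).adj y := by
    rw [map_sub, sub_add_cancel, hmap, LinearIsometry.adj_apply_self]
  rw [h2]
  have h3 := (U n).norm_adj_apply_le (J (UK n x) - y)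
  linarith [norm_add_le ((U n).adj (J (UK n x) - y)) ((U n).adj y), hN n hn y hy]

end Decomposition
end

noncomputable section

/-! ### Multiplication operators and weighted compositions -/

section Multiplication

variable {X : Type*} [MeasurableSpace X] {μ : Measure X}

lemma memLp_mul_of_norm_le_one {φ : X → ℂ} (hφ : Measurable φ) (hb : ∀ x, ‖φ x‖ ≤ 1)
    (u : Lp ℂ 2 μ) : MemLp (fun x => φ x * u x) 2 μ := by
  refine (Lp.memLp u).mono (hφ.aestronglyMeasurable.mul (Lp.aestronglyMeasurable u)) ?_
  refine Filter.Eventually.of_forall fun x => ?_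
  rw [norm_mul]
  exact mul_le_of_le_one_left (norm_nonneg _) (hb x)

/-- Multiplication by a function with values in the unit disc. -/
def mulOperator (φ : X → ℂ) (hφ : Measurable φ) (hb : ∀ x, ‖φ x‖ ≤ 1) :
    Lp ℂ 2 μ →L[ℂ] Lp ℂ 2 μ :=
  LinearMap.mkContinuous
    { toFun := fun u => (memLp_mul_of_norm_le_one hφ hb u).toLp
      map_add' := fun u v => by
        refine Lp.ext ?_
        filter_upwards [MemLp.coeFn_toLp (memLp_mul_of_norm_le_one hφ hb (u + v)),
          MemLp.coeFn_toLp (memLp_mul_of_norm_le_one hφ hb u),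
          MemLp.coeFn_toLp (memLp_mul_of_norm_le_one hφ hb v), Lp.coeFn_add u v,
          Lp.coeFn_add (memLp_mul_of_norm_le_one hφ hb u).toLp
            (memLp_mul_of_norm_le_one hφ hb v).toLp] with x h1 h2 h3 h4 h5
        rw [h1, h5, Pi.add_apply, h2, h3, h4, Pi.add_apply, mul_add]
      map_smul' := fun c u => by
        refine Lp.ext ?_
        filter_upwards [MemLp.coeFn_toLp (memLp_mul_of_norm_le_one hφ hb (c • u)),
          MemLp.coeFn_toLp (memLp_mul_of_norm_le_one hφ hb u), Lp.coeFn_smul c u,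
          Lp.coeFn_smul c (memLp_mul_of_norm_le_one hφ hb u).toLp] with x h1 h2 h3 h4
        rw [h1, RingHom.id_apply, h4, Pi.smul_apply, h2, h3, Pi.smul_apply, smul_eq_mul,
          smul_eq_mul, mul_left_comm] } 1 fun u => by
    rw [one_mul]
    refine Lp.norm_le_norm_of_ae_le ?_
    filter_upwards [MemLp.coeFn_toLp (memLp_mul_of_norm_le_one hφ hb u)] with x h1
    refine (congrArg norm h1).le.trans ?_
    rw [norm_mul]
    exact mul_le_of_le_one_left (norm_nonneg _) (hb x)

lemma coeFn_mulOperator {φ : X → ℂ} (hφ : Measurable φ) (hb : ∀ x, ‖φ x‖ ≤ 1) (u : Lp ℂ 2 μ) :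
    mulOperator φ hφ hb u =ᵐ[μ] fun x => φ x * u x :=
  MemLp.coeFn_toLp (memLp_mul_of_norm_le_one hφ hb u)

variable {Y : Type*} [MeasurableSpace Y] {ν : Measure Y} {A : Y → ℂ} {π : Y → X}

/-- The preimage under `π` of a `μ`-null set is negligible only where `A ≠ 0`. This is enough for `A
· (u ∘ π)` to be well defined almost everywhere. -/
lemma ae_of_map_withDensity (hA : Measurable A) (hπ : Measurable π)
    (h : (ν.withDensity fun y => ‖A y‖ₑ ^ 2).map π = μ) {Q : X → Prop} (hQ : ∀ᵐ x ∂μ, Q x) :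
    ∀ᵐ y ∂ν, A y ≠ 0 → Q (π y) := by
  rw [← h] at hQ
  have h1 := (ae_withDensity_iff (hA.enorm.pow_const 2)).1 (ae_of_ae_map hπ.aemeasurable hQ)
  filter_upwards [h1] with y hy hy0
  exact hy (by simpa using hy0)

lemma eLpNorm_mul_comp (hA : Measurable A) (hπ : Measurable π)
    (h : (ν.withDensity fun y => ‖A y‖ₑ ^ 2).map π = μ) {u : X → ℂ} (hu : Measurable u) :
    eLpNorm (fun y => A y * u (π y)) 2 ν = eLpNorm u 2 μ := by
  rw [eLpNorm_eq_lintegral_rpow_enorm_toReal two_ne_zero ENNReal.ofNat_ne_top,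
    eLpNorm_eq_lintegral_rpow_enorm_toReal two_ne_zero ENNReal.ofNat_ne_top]
  congr 1
  rw [← h, lintegral_map (by fun_prop) hπ, lintegral_withDensity_eq_lintegral_mul _
    (hA.enorm.pow_const 2) (by fun_prop)]
  refine lintegral_congr fun y => ?_
  simp only [enorm_mul, ENNReal.toReal_ofNat, ENNReal.rpow_ofNat, Pi.mul_apply, mul_pow]

lemma memLp_mul_comp (hA : Measurable A) (hπ : Measurable π)
    (h : (ν.withDensity fun y => ‖A y‖ₑ ^ 2).map π = μ) (u : Lp ℂ 2 μ) :
    MemLp (fun y => A y * u (π y)) 2 ν := by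
  have hu := (Lp.stronglyMeasurable u).measurable
  refine ⟨(hA.mul (hu.comp hπ)).aestronglyMeasurable, ?_⟩
  rw [eLpNorm_mul_comp hA hπ h hu]
  exact (Lp.memLp u).2

/-- The isometry `u ↦ A · (u ∘ π)`. -/
def weightedComp (A : Y → ℂ) (π : Y → X) (hA : Measurable A) (hπ : Measurable π)
    (h : (ν.withDensity fun y => ‖A y‖ₑ ^ 2).map π = μ) : Lp ℂ 2 μ →ₗᵢ[ℂ] Lp ℂ 2 ν where
  toFun u := (memLp_mul_comp hA hπ h u).toLp
  map_add' u v := by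
    refine Lp.ext ?_
    filter_upwards [MemLp.coeFn_toLp (memLp_mul_comp hA hπ h (u + v)),
      MemLp.coeFn_toLp (memLp_mul_comp hA hπ h u),
      MemLp.coeFn_toLp (memLp_mul_comp hA hπ h v),
      ae_of_map_withDensity hA hπ h (Lp.coeFn_add u v),
      Lp.coeFn_add (memLp_mul_comp hA hπ h u).toLp
        (memLp_mul_comp hA hπ h v).toLp] with x h1 h2 h3 h4 h5
    rw [h1, h5, Pi.add_apply, h2, h3, ← mul_add]
    by_cases hx : A x = 0
    · simp [hx]
    · rw [h4 hx, Pi.add_apply]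
  map_smul' c u := by
    refine Lp.ext ?_
    filter_upwards [MemLp.coeFn_toLp (memLp_mul_comp hA hπ h (c • u)),
      MemLp.coeFn_toLp (memLp_mul_comp hA hπ h u),
      ae_of_map_withDensity hA hπ h (Lp.coeFn_smul c u),
      Lp.coeFn_smul c (memLp_mul_comp hA hπ h u).toLp] with x h1 h2 h3 h4
    rw [h1, RingHom.id_apply, h4, Pi.smul_apply, h2]
    by_cases hx : A x = 0
    · simp [hx]
    · rw [h3 hx, Pi.smul_apply, smul_eq_mul, smul_eq_mul, mul_left_comm]
  norm_map' u := by
    change ‖(memLp_mul_comp hA hπ h u).toLp‖ = ‖u‖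
    rw [Lp.norm_toLp, eLpNorm_mul_comp hA hπ h (Lp.stronglyMeasurable u).measurable, Lp.norm_def]

lemma coeFn_weightedComp (hA : Measurable A) (hπ : Measurable π)
    (h : (ν.withDensity fun y => ‖A y‖ₑ ^ 2).map π = μ) (u : Lp ℂ 2 μ) :
    weightedComp A π hA hπ h u =ᵐ[ν] fun y => A y * u (π y) :=
  MemLp.coeFn_toLp (memLp_mul_comp hA hπ h u)

lemma coeFn_weightedComp_of_ae (hA : Measurable A) (hπ : Measurable π)
    (h : (ν.withDensity fun y => ‖A y‖ₑ ^ 2).map π = μ) {u : Lp ℂ 2 μ} {F : X → ℂ}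
    (hF : ∀ᵐ x ∂μ, u x = F x) :
    ∀ᵐ y ∂ν, weightedComp A π hA hπ h u y = A y * F (π y) := by
  filter_upwards [coeFn_weightedComp hA hπ h u, ae_of_map_withDensity hA hπ h hF] with y h1 h2
  rw [h1]
  by_cases hy : A y = 0
  · simp [hy]
  · rw [h2 hy]

lemma weightedComp_mulOperator (hA : Measurable A) (hπ : Measurable π)
    (h : (ν.withDensity fun y => ‖A y‖ₑ ^ 2).map π = μ)
    {φ : X → ℂ} (hφ : Measurable φ) (hb : ∀ x, ‖φ x‖ ≤ 1) (u : Lp ℂ 2 μ) :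
    weightedComp A π hA hπ h (mulOperator φ hφ hb u)
      = mulOperator (fun y => φ (π y)) (hφ.comp hπ) (fun y => hb (π y))
          (weightedComp A π hA hπ h u) := by
  refine Lp.ext ?_
  filter_upwards [coeFn_weightedComp_of_ae hA hπ h (coeFn_mulOperator hφ hb u),
    coeFn_mulOperator (hφ.comp hπ) (fun y => hb (π y)) (weightedComp A π hA hπ h u),
    coeFn_weightedComp hA hπ h u] with y h1 h2 h3
  rw [h1]
  refine Eq.trans ?_ h2.symm
  rw [h3]
  simp only [Function.comp_apply]
  ring

end Multiplication

/-! ### The form domain as a Hilbert space -/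

section FormSpace

section Weight

variable {X : Type*}

/-- The function `(q + m)^{-1/2}`, where `q + m ≥ 1`. -/
def formWeight (q : X → ℝ) (m : ℝ) (x : X) : ℂ := ((√(max 1 (q x + m)))⁻¹ : ℝ)

lemma measurable_formWeight [MeasurableSpace X] {q : X → ℝ} (hq : Measurable q) (m : ℝ) :
    Measurable (formWeight q m) := by
  unfold formWeight
  fun_prop

lemma norm_formWeight_le (q : X → ℝ) (m : ℝ) (x : X) : ‖formWeight q m x‖ ≤ 1 := by
  rw [formWeight, Complex.norm_real, Real.norm_eq_abs, abs_of_nonneg (by positivity)]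
  exact inv_le_one_of_one_le₀ (Real.one_le_sqrt.2 (le_max_left _ _))

lemma conj_formWeight (q : X → ℝ) (m : ℝ) (x : X) :
    conj (formWeight q m x) = formWeight q m x := Complex.conj_ofReal _

lemma formWeight_ne_zero (q : X → ℝ) (m : ℝ) (x : X) : formWeight q m x ≠ 0 := by
  have : 0 < √(max 1 (q x + m)) := Real.sqrt_pos.2 (lt_max_of_lt_left one_pos)
  rw [formWeight]
  exact_mod_cast (inv_pos.2 this).ne'

lemma formWeight_mul_self {q : X → ℝ} {m : ℝ} {x : X} (h : 1 ≤ q x + m) :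
    ((q x : ℂ) + m) * (formWeight q m x * formWeight q m x) = 1 := by
  have h1 : 0 < q x + m := by linarith
  have h2 : (√(q x + m))⁻¹ * (√(q x + m))⁻¹ = (q x + m)⁻¹ := by
    rw [← mul_inv, Real.mul_self_sqrt h1.le]
  rw [formWeight, max_eq_right h, ← Complex.ofReal_mul, h2, ← Complex.ofReal_add,
    ← Complex.ofReal_mul, mul_inv_cancel₀ h1.ne', Complex.ofReal_one]

end Weight

variable {X : Type*} [MeasurableSpace X] {μ : Measure X}

/-- Multiplication by `(q + m)^{-1/2}`. -/
def formMul (μ : Measure X) {q : X → ℝ} (hq : Measurable q) (m : ℝ) : Lp ℂ 2 μ →L[ℂ] Lp ℂ 2 μ :=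
  mulOperator (formWeight q m) (measurable_formWeight hq m) (norm_formWeight_le q m)

lemma coeFn_formMul {q : X → ℝ} (hq : Measurable q) (m : ℝ) (u : Lp ℂ 2 μ) :
    formMul μ hq m u =ᵐ[μ] fun x => formWeight q m x * u x := coeFn_mulOperator _ _ u

lemma inner_formMul {q : X → ℝ} (hq : Measurable q) (m : ℝ) (u v : Lp ℂ 2 μ) :
    ⟪formMul μ hq m u, v⟫_ℂ = ⟪u, formMul μ hq m v⟫_ℂ := by
  rw [L2.inner_def, L2.inner_def]
  refine integral_congr_ae ?_
  filter_upwards [coeFn_formMul hq m u, coeFn_formMul hq m v] with x h1 h2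
  rw [h1, h2]
  simp only [RCLike.inner_apply, map_mul, conj_formWeight]
  ring

/-- The form domain, as the subspace of the pairs `((q + m)^{1/2} u, u')` of `L² ⊕ L²`. -/
def formSpace (W : Submodule ℂ (Lp ℂ 2 μ × Lp ℂ 2 μ)) {q : X → ℝ} (hq : Measurable q) (m : ℝ) :
    Submodule ℂ (WithLp 2 (Lp ℂ 2 μ × Lp ℂ 2 μ)) :=
  W.comap ((((formMul μ hq m).comp (WithLp.fstL 2 ℂ (Lp ℂ 2 μ) (Lp ℂ 2 μ))).prod
    (WithLp.sndL 2 ℂ (Lp ℂ 2 μ) (Lp ℂ 2 μ))) :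
      WithLp 2 (Lp ℂ 2 μ × Lp ℂ 2 μ) →ₗ[ℂ] Lp ℂ 2 μ × Lp ℂ 2 μ)

lemma mem_formSpace {W : Submodule ℂ (Lp ℂ 2 μ × Lp ℂ 2 μ)} {q : X → ℝ} {hq : Measurable q}
    {m : ℝ} {κ : WithLp 2 (Lp ℂ 2 μ × Lp ℂ 2 μ)} :
    κ ∈ formSpace W hq m ↔ (formMul μ hq m κ.fst, κ.snd) ∈ W := Iff.rfl

/-- Recording `(q + m)^{1/2} u` in place of `u` makes the form domain the preimage of `W` under a
bounded operator, so completeness needs only that `W` is closed. -/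
lemma isClosed_formSpace {W : Submodule ℂ (Lp ℂ 2 μ × Lp ℂ 2 μ)}
    (hW : IsClosed (W : Set (Lp ℂ 2 μ × Lp ℂ 2 μ))) {q : X → ℝ} (hq : Measurable q) (m : ℝ) :
    IsClosed (formSpace W hq m : Set (WithLp 2 (Lp ℂ 2 μ × Lp ℂ 2 μ))) :=
  hW.preimage (ContinuousLinearMap.continuous
    (((formMul μ hq m).comp (WithLp.fstL 2 ℂ (Lp ℂ 2 μ) (Lp ℂ 2 μ))).prod
    (WithLp.sndL 2 ℂ (Lp ℂ 2 μ) (Lp ℂ 2 μ))))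

/-- The embedding of the form domain into `L²`. -/
def formEmbedding (W : Submodule ℂ (Lp ℂ 2 μ × Lp ℂ 2 μ)) {q : X → ℝ} (hq : Measurable q)
    (m : ℝ) : formSpace W hq m →L[ℂ] Lp ℂ 2 μ :=
  (formMul μ hq m).comp ((WithLp.fstL 2 ℂ (Lp ℂ 2 μ) (Lp ℂ 2 μ)).comp (formSpace W hq m).subtypeL)

lemma formEmbedding_apply (W : Submodule ℂ (Lp ℂ 2 μ × Lp ℂ 2 μ)) {q : X → ℝ} (hq : Measurable q)
    (m : ℝ) (κ : formSpace W hq m) :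
    formEmbedding W hq m κ = formMul μ hq m (κ : WithLp 2 (Lp ℂ 2 μ × Lp ℂ 2 μ)).fst := rfl

/-- As `u` is in `L²`, integrability of `q |u|²` and of `(q + m) |u|²` are equivalent, and the
latter says that `u` divided by the form weight is in `L²`. -/
lemma memWeightedL2_iff {q : X → ℝ} (hq : Measurable q) {m : ℝ} (hm : ∀ᵐ x ∂μ, 1 ≤ q x + m)
    (u : Lp ℂ 2 μ) : MemWeightedL2 q u ↔ ∃ w, formMul μ hq m w = u := by
  have hu2 : Integrable (fun x => ‖u x‖ ^ 2) μ := (Lp.memLp u).integrable_norm_pow two_ne_zero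
  have hu := (Lp.stronglyMeasurable u).measurable
  constructor
  · intro h
    have h1 : Integrable (fun x => (q x + m) * ‖u x‖ ^ 2) μ := by
      refine (Integrable.add h (hu2.const_mul m)).congr (Filter.Eventually.of_forall fun x => ?_)
      simp only [Pi.add_apply]
      ring
    have hmeas : Measurable fun x => (formWeight q m x)⁻¹ * u x :=
      (measurable_formWeight hq m).inv.mul hu
    have h2 : MemLp (fun x => (formWeight q m x)⁻¹ * u x) 2 μ := by
      refine (memLp_two_iff_integrable_sq_norm hmeas.aestronglyMeasurable).2 (h1.congr ?_)
      filter_upwards [hm] with x hx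
      have h3 := congrArg norm (formWeight_mul_self hx)
      have h0 : ‖formWeight q m x‖ ≠ 0 := norm_ne_zero_iff.2 (formWeight_ne_zero q m x)
      rw [norm_mul, norm_mul, norm_one, ← Complex.ofReal_add, Complex.norm_real,
        Real.norm_eq_abs, abs_of_nonneg (by linarith)] at h3
      rw [norm_mul, norm_inv, mul_pow, inv_pow]
      have h4 : (q x + m) = (‖formWeight q m x‖ ^ 2)⁻¹ := by
        exact eq_inv_of_mul_eq_one_left (by rw [sq, h3])
      rw [h4]
    refine ⟨h2.toLp, Lp.ext ?_⟩
    filter_upwards [coeFn_formMul hq m h2.toLp, h2.coeFn_toLp] with x h3 h4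
    rw [h3, h4, mul_inv_cancel_left₀ (formWeight_ne_zero q m x)]
  · rintro ⟨w, rfl⟩
    have hw2 : Integrable (fun x => ‖w x‖ ^ 2) μ := (Lp.memLp w).integrable_norm_pow two_ne_zero
    refine (hw2.sub (hu2.const_mul m)).congr ?_
    filter_upwards [hm, coeFn_formMul hq m w] with x hx h1
    have h3 := congrArg norm (formWeight_mul_self hx)
    rw [norm_mul, norm_mul, norm_one, ← Complex.ofReal_add, Complex.norm_real,
      Real.norm_eq_abs, abs_of_nonneg (by linarith)] at h3
    simp only [Pi.sub_apply, h1, norm_mul]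
    linear_combination (- ‖w x‖ ^ 2) * h3

/-- The cancellation `(q + m) · ((q + m)^{-1/2})² = 1` turns the shifted form into the inner product
of `formSpace`. -/
lemma schrodingerForm_formMul {q : X → ℝ} (hq : Measurable q) {m : ℝ}
    (hm : ∀ᵐ x ∂μ, 1 ≤ q x + m) (w v w' v' : Lp ℂ 2 μ) :
    schrodingerForm q (formMul μ hq m w, v) (formMul μ hq m w', v')
      + m * ⟪formMul μ hq m w, formMul μ hq m w'⟫_ℂ = ⟪w, w'⟫_ℂ + ⟪v, v'⟫_ℂ := by
  rw [schrodingerForm, L2.inner_def, L2.inner_def, L2.inner_def, ← integral_const_mul,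
    ← integral_add, ← integral_add (L2.integrable_inner w w') (L2.integrable_inner v v')]
  · refine integral_congr_ae ?_
    filter_upwards [hm, coeFn_formMul hq m w, coeFn_formMul hq m w'] with x hx h1 h2
    simp only [h1, h2, RCLike.inner_apply, map_mul, conj_formWeight]
    linear_combination (conj (w x) * w' x) * formWeight_mul_self hx
  · exact schrodingerForm_integrable hq ((memWeightedL2_iff hq hm _).2 ⟨w, rfl⟩)
      ((memWeightedL2_iff hq hm _).2 ⟨w', rfl⟩)
  · exact (L2.integrable_inner _ _).const_mul _

lemma mem_formDomain_iff (W : Submodule ℂ (Lp ℂ 2 μ × Lp ℂ 2 μ)) {q : X → ℝ} (hq : Measurable q)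
    {m : ℝ} (hm : ∀ᵐ x ∂μ, 1 ≤ q x + m) (p : Lp ℂ 2 μ × Lp ℂ 2 μ) :
    p ∈ formDomain W q hq ↔ ∃ κ : formSpace W hq m,
      p = (formMul μ hq m (κ : WithLp 2 (Lp ℂ 2 μ × Lp ℂ 2 μ)).fst,
        (κ : WithLp 2 (Lp ℂ 2 μ × Lp ℂ 2 μ)).snd) := by
  constructor
  · rintro ⟨h1, h2⟩
    obtain ⟨w, hw⟩ := (memWeightedL2_iff hq hm _).1 h2
    have hp : p = (formMul μ hq m w, p.2) := by rw [hw]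
    rw [hp] at h1
    exact ⟨⟨WithLp.toLp 2 (w, p.2), h1⟩, hp⟩
  · rintro ⟨κ, rfl⟩
    exact ⟨κ.2, (memWeightedL2_iff hq hm _).2 ⟨_, rfl⟩⟩

/-- For `u = J κ`, the defining equation becomes `⟪κ', κ⟫ = ⟪J κ', g + m u⟫` for all `κ'`, that is
`κ = J* (g + m u)`. No density of the form domain is needed. -/
lemma isResolventAt_formOperator (W : Submodule ℂ (Lp ℂ 2 μ × Lp ℂ 2 μ)) {q : X → ℝ}
    (hq : Measurable q) {m : ℝ} (hm : ∀ᵐ x ∂μ, 1 ≤ q x + m) [CompleteSpace (formSpace W hq m)] :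
    IsResolventAt (formEmbedding W hq m ∘L (formEmbedding W hq m).adjoint) m
      (formOperator W q hq) := by
  have key : ∀ κ κ' : formSpace W hq m,
      schrodingerForm q (formMul μ hq m (κ : WithLp 2 (Lp ℂ 2 μ × Lp ℂ 2 μ)).fst,
        (κ : WithLp 2 (Lp ℂ 2 μ × Lp ℂ 2 μ)).snd)
        (formMul μ hq m (κ' : WithLp 2 (Lp ℂ 2 μ × Lp ℂ 2 μ)).fst,
        (κ' : WithLp 2 (Lp ℂ 2 μ × Lp ℂ 2 μ)).snd)
      = ⟪κ, κ'⟫_ℂ - m * ⟪formEmbedding W hq m κ, formEmbedding W hq m κ'⟫_ℂ := fun κ κ' => by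
    rw [eq_sub_iff_add_eq]
    exact schrodingerForm_formMul hq hm _ _ _ _
  intro u g
  constructor
  · rintro ⟨u', hu', h⟩
    obtain ⟨κ, hκ⟩ := (mem_formDomain_iff W hq hm _).1 hu'
    have hu : u = formEmbedding W hq m κ := congrArg Prod.fst hκ
    have h1 : κ = (formEmbedding W hq m).adjoint (g + (m : ℂ) • u) := by
      refine ext_inner_left ℂ fun κ' => ?_
      have h2 := h _ ((mem_formDomain_iff W hq hm _).2 ⟨κ', rfl⟩)
      have h3 : (u, u') = _ := hκ
      simp only [h3] at h2
      rw [key] at h2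
      rw [ContinuousLinearMap.adjoint_inner_right, inner_add_right, inner_smul_right, hu]
      exact sub_eq_iff_eq_add.1 h2
    rw [ContinuousLinearMap.comp_apply, ← h1, hu]
  · intro hu
    set κ := (formEmbedding W hq m).adjoint (g + (m : ℂ) • u) with hκ
    have hu : u = formEmbedding W hq m κ := hu
    refine ⟨(κ : WithLp 2 (Lp ℂ 2 μ × Lp ℂ 2 μ)).snd,
      (mem_formDomain_iff W hq hm _).2 ⟨κ, Prod.ext hu rfl⟩, fun p hp => ?_⟩
    obtain ⟨κ', rfl⟩ := (mem_formDomain_iff W hq hm _).1 hp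
    simp only [hu]
    rw [formEmbedding_apply, key]
    have h1 : ⟪κ', κ⟫_ℂ = ⟪formEmbedding W hq m κ', g + (m : ℂ) • u⟫_ℂ := by
      rw [hκ, ContinuousLinearMap.adjoint_inner_right]
    rw [h1, inner_add_right, inner_smul_right, ← hu, add_sub_cancel_right]
    rfl

end FormSpace

/-! ### Isometries between form domains -/

section Transport

variable {X Y : Type*} [MeasurableSpace X] [MeasurableSpace Y] {μ : Measure X} {ν : Measure Y}
  {W : Submodule ℂ (Lp ℂ 2 μ × Lp ℂ 2 μ)} {W' : Submodule ℂ (Lp ℂ 2 ν × Lp ℂ 2 ν)}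
  {q : X → ℝ} {hq : Measurable q} {q' : Y → ℝ} {hq' : Measurable q'} {m : ℝ}

/-- An isometry that commutes with the derivation and with `q` acts between the form domains. -/
def formTransport (U : Lp ℂ 2 μ →ₗᵢ[ℂ] Lp ℂ 2 ν)
    (hM : ∀ u, U (formMul μ hq m u) = formMul ν hq' m (U u))
    (hW : ∀ p ∈ W, (U p.1, U p.2) ∈ W') : formSpace W hq m →ₗᵢ[ℂ] formSpace W' hq' m where
  toFun κ := ⟨WithLp.toLp 2 (U (κ : WithLp 2 (Lp ℂ 2 μ × Lp ℂ 2 μ)).fst,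
    U (κ : WithLp 2 (Lp ℂ 2 μ × Lp ℂ 2 μ)).snd), by
      have h := hW _ (mem_formSpace.1 κ.2)
      rw [hM] at h
      exact h⟩
  map_add' κ κ' := by
    exact Subtype.ext (congrArg (WithLp.toLp 2) (Prod.ext (map_add U _ _) (map_add U _ _)))
  map_smul' c κ := by
    exact Subtype.ext (congrArg (WithLp.toLp 2) (Prod.ext (map_smul U c _) (map_smul U c _)))
  norm_map' κ := by
    change ‖WithLp.toLp 2 (U (κ : WithLp 2 (Lp ℂ 2 μ × Lp ℂ 2 μ)).fst,
      U (κ : WithLp 2 (Lp ℂ 2 μ × Lp ℂ 2 μ)).snd)‖ = ‖(κ : WithLp 2 (Lp ℂ 2 μ × Lp ℂ 2 μ))‖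
    rw [WithLp.prod_norm_eq_of_L2, WithLp.prod_norm_eq_of_L2]
    change √(‖U _‖ ^ 2 + ‖U _‖ ^ 2) = _
    rw [U.norm_map, U.norm_map]

variable {U : Lp ℂ 2 μ →ₗᵢ[ℂ] Lp ℂ 2 ν} (hM : ∀ u, U (formMul μ hq m u) = formMul ν hq' m (U u))
  (hW : ∀ p ∈ W, (U p.1, U p.2) ∈ W')

lemma formEmbedding_formTransport (κ : formSpace W hq m) :
    formEmbedding W' hq' m (formTransport U hM hW κ) = U (formEmbedding W hq m κ) :=
  (hM _).symm

lemma adj_formMul (hM : ∀ u, U (formMul μ hq m u) = formMul ν hq' m (U u))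
    (f : Lp ℂ 2 ν) : U.adj (formMul ν hq' m f) = formMul μ hq m (U.adj f) := by
  refine ext_inner_left ℂ fun y => ?_
  rw [ContinuousLinearMap.adjoint_inner_right, ← inner_formMul, ← inner_formMul,
    ContinuousLinearMap.adjoint_inner_right]
  exact congrArg (fun w => ⟪w, f⟫_ℂ) (hM y).symm

/-- The adjoint of the transport acts as `U*` on both components. This is legitimate because `hW'`
keeps the result in the form domain. -/
lemma formEmbedding_adj_formTransport [CompleteSpace (formSpace W hq m)]
    [CompleteSpace (formSpace W' hq' m)] (hW' : ∀ p ∈ W', (U.adj p.1, U.adj p.2) ∈ W)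
    (κ : formSpace W' hq' m) :
    formEmbedding W hq m ((formTransport U hM hW).adj κ) = U.adj (formEmbedding W' hq' m κ) := by
  have hmem : WithLp.toLp 2 (U.adj (κ : WithLp 2 (Lp ℂ 2 ν × Lp ℂ 2 ν)).fst,
      U.adj (κ : WithLp 2 (Lp ℂ 2 ν × Lp ℂ 2 ν)).snd) ∈ formSpace W hq m := by
    have h := hW' _ (mem_formSpace.1 κ.2)
    rw [adj_formMul hM] at h
    exact h
  have h1 : (formTransport U hM hW).adj κ = ⟨_, hmem⟩ := by
    refine ext_inner_left ℂ fun κ' => ?_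
    rw [ContinuousLinearMap.adjoint_inner_right]
    have h2 := ContinuousLinearMap.adjoint_inner_right U.toContinuousLinearMap
      (κ' : WithLp 2 (Lp ℂ 2 μ × Lp ℂ 2 μ)).fst (κ : WithLp 2 (Lp ℂ 2 ν × Lp ℂ 2 ν)).fst
    have h3 := ContinuousLinearMap.adjoint_inner_right U.toContinuousLinearMap
      (κ' : WithLp 2 (Lp ℂ 2 μ × Lp ℂ 2 μ)).snd (κ : WithLp 2 (Lp ℂ 2 ν × Lp ℂ 2 ν)).snd
    exact (congrArg₂ (· + ·) h2 h3).symm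
  rw [h1, formEmbedding_apply, formEmbedding_apply, adj_formMul hM]
  rfl

lemma formTransport_orthogonalFamily {ι : Type*} {Z : ι → Type*} [∀ i, MeasurableSpace (Z i)]
    {ρ : ∀ i, Measure (Z i)} {Wi : ∀ i, Submodule ℂ (Lp ℂ 2 (ρ i) × Lp ℂ 2 (ρ i))}
    {qi : ∀ i, Z i → ℝ} {hqi : ∀ i, Measurable (qi i)} {Ui : ∀ i, Lp ℂ 2 (ρ i) →ₗᵢ[ℂ] Lp ℂ 2 ν}
    (hMi : ∀ i u, Ui i (formMul (ρ i) (hqi i) m u) = formMul ν hq' m (Ui i u))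
    (hWi : ∀ i, ∀ p ∈ Wi i, (Ui i p.1, Ui i p.2) ∈ W')
    (hU : OrthogonalFamily ℂ (fun i => Lp ℂ 2 (ρ i)) Ui) :
    OrthogonalFamily ℂ (fun i => formSpace (Wi i) (hqi i) m)
      (fun i => formTransport (Ui i) (hMi i) (hWi i)) := by
  intro i j hij κ κ'
  have h1 := hU hij (κ : WithLp 2 (Lp ℂ 2 (ρ i) × Lp ℂ 2 (ρ i))).fst
    (κ' : WithLp 2 (Lp ℂ 2 (ρ j) × Lp ℂ 2 (ρ j))).fst
  have h2 := hU hij (κ : WithLp 2 (Lp ℂ 2 (ρ i) × Lp ℂ 2 (ρ i))).snd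
    (κ' : WithLp 2 (Lp ℂ 2 (ρ j) × Lp ℂ 2 (ρ j))).snd
  exact (congrArg₂ (· + ·) h1 h2).trans (add_zero _)

end Transport
end

noncomputable section

/-! ### Combinatorics of regular trees -/

namespace RootedMetricTree

section Gen

variable (T : RootedMetricTree)

lemma iterate_gen (y : T.Vertex) : T.parent^[T.gen y] y = T.root :=
  Nat.sInf_mem (T.exists_iterate_parent y)

lemma gen_root : T.gen T.root = 0 := Nat.sInf_eq_zero.2 (Or.inl rfl)

lemma gen_eq_zero_iff {y : T.Vertex} : T.gen y = 0 ↔ y = T.root := by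
  constructor
  · intro h
    have := T.iterate_gen y
    rwa [h] at this
  · rintro rfl
    exact T.gen_root

lemma gen_parent {y : T.Vertex} (hy : y ≠ T.root) : T.gen (T.parent y) + 1 = T.gen y := by
  have h0 : T.gen y ≠ 0 := fun h => hy (T.gen_eq_zero_iff.1 h)
  obtain ⟨n, hn⟩ := Nat.exists_eq_succ_of_ne_zero h0
  apply le_antisymm
  · rw [hn]
    have h1 := T.iterate_gen y
    rw [hn] at h1
    exact Nat.succ_le_succ (Nat.sInf_le h1)
  · exact Nat.sInf_le (T.iterate_gen (T.parent y))

lemma ne_root_of_gen {y : T.Vertex} {n : ℕ} (h : T.gen y = n + 1) : y ≠ T.root := by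
  rintro rfl
  rw [T.gen_root] at h
  omega

lemma gen_parent_eq {y : T.Vertex} {n : ℕ} (h : T.gen y = n + 1) : T.gen (T.parent y) = n := by
  have := T.gen_parent (T.ne_root_of_gen h)
  omega

lemma height_root : T.height T.root = 0 := by simp [height, T.gen_root]

lemma height_parent {y : T.Vertex} (hy : y ≠ T.root) :
    T.height y = T.height (T.parent y) + T.length y := by
  rw [height, height, ← T.gen_parent hy, Finset.sum_range_succ']
  rfl

/-- The function that is constant, equal to `a v`, on the subtree of each vertex `v` of
generation `k + 1`, and vanishes on the vertices of generation at most `k`. -/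
def amplitude (k : ℕ) (a : T.Vertex → ℂ) (z : T.Vertex) : ℂ :=
  if k < T.gen z then a (T.parent^[T.gen z - (k + 1)] z) else 0

variable {T} {k : ℕ} {a : T.Vertex → ℂ} {z : T.Vertex}

lemma amplitude_of_le (h : T.gen z ≤ k) : T.amplitude k a z = 0 := if_neg h.not_gt

lemma amplitude_of_eq (h : T.gen z = k + 1) : T.amplitude k a z = a z := by
  rw [amplitude, if_pos (by omega), h]
  simp

lemma amplitude_of_lt (h : k + 1 < T.gen z) : T.amplitude k a z = T.amplitude k a (T.parent z) := by
  have hz : z ≠ T.root := by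
    rintro rfl
    rw [T.gen_root] at h
    omega
  have h1 := T.gen_parent hz
  rw [amplitude, amplitude, if_pos (by omega), if_pos (by omega)]
  have h2 : T.gen z - (k + 1) = (T.gen (T.parent z) - (k + 1)) + 1 := by omega
  rw [h2, Function.iterate_succ_apply]

end Gen

/-- The tree is regular, with branching numbers `b` and with the vertices at the heights `t`. -/
structure IsRegularWith (T : RootedMetricTree) (b : ℕ → ℕ) (t : ℕ → ℝ) : Prop where
  branching_root : T.branching T.root = 1
  one_lt_branching : ∀ y, y ≠ T.root → 1 < T.branching y
  branching_eq : ∀ y, T.branching y = b (T.gen y)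
  height_eq : ∀ y, T.height y = t (T.gen y)

namespace IsRegularWith

variable {T : RootedMetricTree} {b : ℕ → ℕ} {t : ℕ → ℝ} (R : T.IsRegularWith b t)

include R

lemma branching_pos (y : T.Vertex) : 0 < T.branching y := by
  by_cases h : y = T.root
  · rw [h, R.branching_root]
    exact one_pos
  · exact one_pos.trans (R.one_lt_branching y h)

lemma finite_children (y : T.Vertex) : {z | z ≠ T.root ∧ T.parent z = y}.Finite :=
  Set.finite_of_ncard_pos (R.branching_pos y)

lemma exists_child (y : T.Vertex) : ∃ z, z ≠ T.root ∧ T.parent z = y :=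
  Set.nonempty_of_ncard_ne_zero (R.branching_pos y).ne'

lemma exists_gen_eq (n : ℕ) : ∃ y, T.gen y = n := by
  induction n with
  | zero => exact ⟨_, T.gen_root⟩
  | succ n ih =>
    obtain ⟨y, hy⟩ := ih
    obtain ⟨z, hz, hzy⟩ := R.exists_child y
    exact ⟨z, by rw [← T.gen_parent hz, hzy, hy]⟩

lemma finite_gen_eq (n : ℕ) : {y | T.gen y = n}.Finite := by
  induction n with
  | zero =>
    refine (Set.finite_singleton T.root).subset fun y hy => ?_
    exact T.gen_eq_zero_iff.1 hy
  | succ n ih =>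
    refine (ih.biUnion fun y _ => R.finite_children y).subset fun z hz => ?_
    exact mem_biUnion (T.gen_parent_eq hz) ⟨T.ne_root_of_gen hz, rfl⟩

lemma b_pos (n : ℕ) : 0 < b n := by
  obtain ⟨y, hy⟩ := R.exists_gen_eq n
  rw [← hy, ← R.branching_eq]
  exact R.branching_pos y

lemma b_zero : b 0 = 1 := by
  rw [← R.branching_root, R.branching_eq, T.gen_root]

lemma one_lt_b (n : ℕ) : 1 < b (n + 1) := by
  obtain ⟨y, hy⟩ := R.exists_gen_eq (n + 1)
  rw [← hy, ← R.branching_eq]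
  exact R.one_lt_branching y (T.ne_root_of_gen hy)

lemma t_zero : t 0 = 0 := by rw [← T.gen_root, ← R.height_eq, T.height_root]

lemma t_strictMono : StrictMono t := by
  refine strictMono_nat_of_lt_succ fun n => ?_
  obtain ⟨y, hy⟩ := R.exists_gen_eq (n + 1)
  have h := T.ne_root_of_gen hy
  have h1 := T.height_parent h
  rw [R.height_eq, R.height_eq, hy, T.gen_parent_eq hy] at h1
  linarith [T.length_pos y h]

/-- The vertices of generation `n`. -/
def level (n : ℕ) : Finset T.Vertex := (R.finite_gen_eq n).toFinset

/-- The terminal vertices of the edges that emanate from `y`. -/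
def children (y : T.Vertex) : Finset T.Vertex := (R.finite_children y).toFinset

lemma mem_level {n : ℕ} {y : T.Vertex} : y ∈ R.level n ↔ T.gen y = n := by simp [level]

lemma mem_children {y z : T.Vertex} : z ∈ R.children y ↔ z ≠ T.root ∧ T.parent z = y := by
  simp [children]

lemma card_children (y : T.Vertex) : (R.children y).card = b (T.gen y) := by
  rw [← R.branching_eq, branching, children, Set.ncard_eq_toFinset_card _ (R.finite_children y)]

lemma sum_level_succ {M : Type*} [AddCommMonoid M] (n : ℕ) (f : T.Vertex → M) :
    ∑ z ∈ R.level (n + 1), f z = ∑ y ∈ R.level n, ∑ z ∈ R.children y, f z := by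
  classical
  rw [← Finset.sum_fiberwise_of_maps_to (s := R.level (n + 1)) (t := R.level n) (g := T.parent)]
  · refine Finset.sum_congr rfl fun y hy => Finset.sum_congr ?_ fun _ _ => rfl
    ext z
    rw [Finset.mem_filter, R.mem_level, R.mem_children]
    rw [R.mem_level] at hy
    constructor
    · rintro ⟨h1, h2⟩
      exact ⟨T.ne_root_of_gen h1, h2⟩
    · rintro ⟨h1, h2⟩
      refine ⟨?_, h2⟩
      rw [← T.gen_parent h1, h2, hy]
  · intro z hz
    rw [R.mem_level] at hz ⊢
    exact T.gen_parent_eq hz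

lemma sum_level_succ_of_parent (n : ℕ) (f : T.Vertex → ℂ) :
    ∑ z ∈ R.level (n + 1), f (T.parent z) = b n * ∑ y ∈ R.level n, f y := by
  rw [R.sum_level_succ, Finset.mul_sum]
  refine Finset.sum_congr rfl fun y hy => ?_
  rw [Finset.sum_congr rfl fun z hz => by rw [(R.mem_children.1 hz).2], Finset.sum_const,
    R.card_children, R.mem_level.1 hy, nsmul_eq_mul]

lemma card_level_succ (n : ℕ) : (R.level (n + 1)).card = (R.level n).card * b n := by
  rw [Finset.card_eq_sum_ones, R.sum_level_succ, Finset.card_eq_sum_ones, Finset.sum_mul]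
  refine Finset.sum_congr rfl fun y hy => ?_
  rw [← Finset.card_eq_sum_ones, R.card_children, R.mem_level.1 hy, one_mul]

lemma card_level_eq_prod (n : ℕ) : (R.level (n + 1)).card = ∏ j ∈ Finset.Icc 1 n, b j := by
  induction n with
  | zero =>
    have : R.level 0 = {T.root} := by
      ext y
      rw [R.mem_level, T.gen_eq_zero_iff, Finset.mem_singleton]
    rw [R.card_level_succ, this, R.b_zero]
    simp
  | succ n ih => rw [R.card_level_succ, ih, Finset.prod_Icc_succ_top (by omega)]

omit R in
/-- The value of the branching function `g_k` on `(t_n, t_{n+1}]`. -/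
def weight (b : ℕ → ℕ) (k n : ℕ) : ℕ := if k ≤ n then ∏ j ∈ Finset.Ioc k n, b j else 0

omit R in
lemma weight_of_lt {k n : ℕ} (h : n < k) : weight b k n = 0 := if_neg h.not_ge

omit R in
lemma weight_self (k : ℕ) : weight b k k = 1 := by simp [weight]

omit R in
lemma weight_succ {k n : ℕ} (h : k ≤ n) : weight b k (n + 1) = weight b k n * b (n + 1) := by
  rw [weight, weight, if_pos h, if_pos (by omega), Finset.prod_Ioc_succ_top (by omega)]

lemma weight_pos {k n : ℕ} (h : k ≤ n) : 0 < weight b k n := by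
  rw [weight, if_pos h]
  exact Finset.prod_pos fun j _ => R.b_pos j

/-- Each value is repeated once for every child, so passing from level `n + 1` to level `n + 2`
multiplies the sum by `b (n + 1)`. -/
lemma sum_level_of_parent {k n : ℕ} (hkn : k ≤ n) {f : T.Vertex → ℂ}
    (hf : ∀ z, k + 1 < T.gen z → f z = f (T.parent z)) :
    ∑ z ∈ R.level (n + 1), f z = weight b k n * ∑ z ∈ R.level (k + 1), f z := by
  induction n, hkn using Nat.le_induction with
  | base => rw [weight_self, Nat.cast_one, one_mul]
  | succ n hkn ih =>
    rw [Finset.sum_congr rfl fun z hz => hf z (by rw [R.mem_level.1 hz]; omega),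
      R.sum_level_succ_of_parent, ih, weight_succ hkn]
    push_cast
    ring

lemma sum_conj_amplitude_mul_amplitude (k n : ℕ) (a a' : T.Vertex → ℂ) :
    ∑ z ∈ R.level (n + 1), conj (T.amplitude k a z) * T.amplitude k a' z
      = weight b k n * ∑ z ∈ R.level (k + 1), conj (a z) * a' z := by
  by_cases hkn : k ≤ n
  · rw [R.sum_level_of_parent hkn]
    · congr 1
      refine Finset.sum_congr rfl fun z hz => ?_
      rw [amplitude_of_eq (R.mem_level.1 hz), amplitude_of_eq (R.mem_level.1 hz)]
    · intro z hz
      rw [amplitude_of_lt hz, amplitude_of_lt hz]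
  · rw [weight_of_lt (by omega), Nat.cast_zero, zero_mul]
    refine Finset.sum_eq_zero fun z hz => ?_
    rw [amplitude_of_le (a := a') (by rw [R.mem_level.1 hz]; omega), mul_zero]

/-- The values of `a` on the children of each vertex `y ≠ o` of generation `k` sum to zero. -/
def SumsToZero (k : ℕ) (a : T.Vertex → ℂ) : Prop :=
  ∀ y, T.gen y = k → y ≠ T.root → ∑ z ∈ R.children y, a z = 0

/-- It suffices to treat level `k' + 1`. There the amplitude of index `k < k'` is constant on
siblings and factors out of a sum over siblings that vanishes; their parent has generation `k' > 0`,
so it is not the root. -/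
lemma sum_conj_amplitude_mul_of_sumsToZero {k k' : ℕ} (hk : k < k') {a a' : T.Vertex → ℂ}
    (ha' : R.SumsToZero k' a') (n : ℕ) :
    ∑ z ∈ R.level (n + 1), conj (T.amplitude k a z) * T.amplitude k' a' z = 0 := by
  by_cases hkn : k' ≤ n
  · rw [R.sum_level_of_parent hkn]
    · refine mul_eq_zero_of_right _ ?_
      rw [R.sum_level_succ]
      refine Finset.sum_eq_zero fun y hy => ?_
      have hgy := R.mem_level.1 hy
      have hgz : ∀ z ∈ R.children y, T.gen z = k' + 1 := fun z hz => by
        rw [← T.gen_parent (R.mem_children.1 hz).1, (R.mem_children.1 hz).2, hgy]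
      have h1 : ∀ z ∈ R.children y, conj (T.amplitude k a z) * T.amplitude k' a' z
          = conj (T.amplitude k a y) * a' z := fun z hz => by
        rw [amplitude_of_eq (hgz z hz), amplitude_of_lt (by rw [hgz z hz]; omega),
          (R.mem_children.1 hz).2]
      rw [Finset.sum_congr rfl h1, ← Finset.mul_sum, ha' y hgy, mul_zero]
      rintro rfl
      rw [T.gen_root] at hgy
      omega
    · intro z hz
      rw [amplitude_of_lt (k := k) (by omega), amplitude_of_lt (k := k') hz]
  · refine Finset.sum_eq_zero fun z hz => ?_
    rw [amplitude_of_le (k := k') (by rw [R.mem_level.1 hz]; omega), mul_zero]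

/-- Extension by zero of a function on the vertices of generation `n`. -/
def extend {n : ℕ} (a : EuclideanSpace ℂ (R.level n)) (z : T.Vertex) : ℂ :=
  open Classical in if h : z ∈ R.level n then a ⟨z, h⟩ else 0

lemma extend_coe {n : ℕ} (a : EuclideanSpace ℂ (R.level n)) (z : R.level n) :
    R.extend a z = a z := by
  rw [extend, dif_pos z.2]

lemma extend_add {n : ℕ} (a a' : EuclideanSpace ℂ (R.level n)) (z : T.Vertex) :
    R.extend (a + a') z = R.extend a z + R.extend a' z := by
  unfold extend
  split_ifs <;> simp

lemma extend_smul {n : ℕ} (c : ℂ) (a : EuclideanSpace ℂ (R.level n)) (z : T.Vertex) :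
    R.extend (c • a) z = c * R.extend a z := by
  unfold extend
  split_ifs <;> simp

lemma inner_eq_sum_extend {n : ℕ} (a a' : EuclideanSpace ℂ (R.level n)) :
    ⟪a, a'⟫_ℂ = ∑ z ∈ R.level n, conj (R.extend a z) * R.extend a' z := by
  rw [← Finset.sum_coe_sort, PiLp.inner_apply]
  refine Finset.sum_congr rfl fun z _ => ?_
  rw [R.extend_coe, R.extend_coe, RCLike.inner_apply, mul_comm]

/-- The functions on the vertices of generation `k + 1` whose values on the children of each
vertex `y ≠ o` sum to zero. -/
def zeroSumSpace (k : ℕ) : Submodule ℂ (EuclideanSpace ℂ (R.level (k + 1))) where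
  carrier := {a | R.SumsToZero k (R.extend a)}
  add_mem' ha ha' := fun y hy hy' => by
    rw [Finset.sum_congr rfl fun z _ => R.extend_add _ _ z, Finset.sum_add_distrib, ha y hy hy',
      ha' y hy hy', add_zero]
  zero_mem' := fun y hy hy' => by
    refine Finset.sum_eq_zero fun z _ => ?_
    unfold extend
    split_ifs <;> simp
  smul_mem' c a ha := fun y hy hy' => by
    rw [Finset.sum_congr rfl fun z _ => R.extend_smul _ _ z, ← Finset.mul_sum, ha y hy hy',
      mul_zero]

/-- The only vertex of generation `0` is the root, where no condition is imposed, and a single edge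
emanates from it. -/
lemma finrank_zeroSumSpace_zero : Module.finrank ℂ (R.zeroSumSpace 0) = 1 := by
  have h : R.zeroSumSpace 0 = ⊤ := by
    rw [eq_top_iff]
    intro a _ y hy hy'
    exact absurd (T.gen_eq_zero_iff.1 hy) hy'
  rw [h, finrank_top, finrank_euclideanSpace, Fintype.card_coe, R.card_level_eq_prod]
  simp

/-- Rank and nullity of the map that sums over the children of each vertex of generation `k + 1`. -/
lemma finrank_zeroSumSpace_succ (k : ℕ) : Module.finrank ℂ (R.zeroSumSpace (k + 1))
    = (∏ j ∈ Finset.Icc 1 k, b j) * (b (k + 1) - 1) := by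
  let S : EuclideanSpace ℂ (R.level (k + 1 + 1)) →ₗ[ℂ] (R.level (k + 1) → ℂ) :=
    { toFun := fun a y => ∑ z ∈ R.children y, R.extend a z
      map_add' := fun a a' => by
        ext y
        rw [Finset.sum_congr rfl fun z _ => R.extend_add _ _ z, Finset.sum_add_distrib]
        rfl
      map_smul' := fun c a => by
        ext y
        rw [Finset.sum_congr rfl fun z _ => R.extend_smul _ _ z, ← Finset.mul_sum]
        rfl }
  have hker : S.ker = R.zeroSumSpace (k + 1) := by
    ext a
    rw [LinearMap.mem_ker]
    constructor
    · intro h y hy _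
      exact congrFun h ⟨y, R.mem_level.2 hy⟩
    · intro h
      ext y
      exact h y (R.mem_level.1 y.2) (T.ne_root_of_gen (R.mem_level.1 y.2))
  have hsurj : Function.Surjective S := by
    intro c
    -- A preimage of `c`: the value at each vertex is shared equally among its `b (k + 1)` children.
    refine ⟨WithLp.toLp 2 fun z => c ⟨T.parent z, R.mem_level.2
      (T.gen_parent_eq (R.mem_level.1 z.2))⟩ / b (k + 1), ?_⟩
    ext y
    have hy := R.mem_level.1 y.2
    have h1 : ∀ z ∈ R.children y, R.extend (WithLp.toLp 2 fun z : R.level (k + 1 + 1) =>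
        c ⟨T.parent z, R.mem_level.2 (T.gen_parent_eq (R.mem_level.1 z.2))⟩ / (b (k + 1) : ℂ)) z
        = c y / b (k + 1) := by
      intro z hz
      have hz' := R.mem_children.1 hz
      have hzl : z ∈ R.level (k + 1 + 1) := by
        rw [R.mem_level, ← T.gen_parent hz'.1, hz'.2, hy]
      rw [extend, dif_pos hzl]
      have hy' : (⟨T.parent z, R.mem_level.2 (T.gen_parent_eq (R.mem_level.1 hzl))⟩ :
          R.level (k + 1)) = y := Subtype.ext hz'.2
      change c ⟨T.parent z, _⟩ / _ = _
      rw [hy']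
    change ∑ z ∈ R.children y, _ = _
    rw [Finset.sum_congr rfl h1, Finset.sum_const, R.card_children, hy, nsmul_eq_mul,
      mul_div_cancel₀ _ (by exact_mod_cast (R.b_pos _).ne')]
  have h1 := S.finrank_range_add_finrank_ker
  rw [LinearMap.range_eq_top.2 hsurj, finrank_top, hker, finrank_euclideanSpace, Fintype.card_coe,
    Module.finrank_fintype_fun_eq_card, Fintype.card_coe, R.card_level_succ (k + 1),
    R.card_level_eq_prod] at h1
  rw [Nat.mul_sub_one]
  omega

/-- An orthonormal basis of the zero sum space. -/
def basis (k : ℕ) : OrthonormalBasis (Fin (Module.finrank ℂ (R.zeroSumSpace k))) ℂ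
    (R.zeroSumSpace k) := stdOrthonormalBasis ℂ (R.zeroSumSpace k)

/-- The index set of the decomposition of `L²` of the tree. -/
abbrev Index : Type := Σ k : ℕ, Fin (Module.finrank ℂ (R.zeroSumSpace k))

/-- The functions on the vertices that define the parts of the decomposition. -/
def amp (i : R.Index) : T.Vertex → ℂ :=
  T.amplitude i.1 (R.extend (R.basis i.1 i.2 : EuclideanSpace ℂ (R.level (i.1 + 1))))

lemma sum_conj_amp_mul_amp_self (i : R.Index) (n : ℕ) :
    ∑ z ∈ R.level (n + 1), conj (R.amp i z) * R.amp i z = weight b i.1 n := by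
  unfold amp
  rw [R.sum_conj_amplitude_mul_amplitude, ← R.inner_eq_sum_extend]
  have h := (R.basis i.1).inner_eq_one i.2
  rw [Submodule.coe_inner] at h
  rw [h, mul_one]

lemma sum_conj_amp_mul_amp_of_ne {i j : R.Index} (hij : i ≠ j) (n : ℕ) :
    ∑ z ∈ R.level (n + 1), conj (R.amp i z) * R.amp j z = 0 := by
  obtain ⟨k, i⟩ := i
  obtain ⟨k', j⟩ := j
  unfold amp
  rcases lt_trichotomy k k' with h | h | h
  · exact R.sum_conj_amplitude_mul_of_sumsToZero h (R.basis k' j).2 n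
  · subst h
    rw [R.sum_conj_amplitude_mul_amplitude, ← R.inner_eq_sum_extend]
    have h := (R.basis k).inner_eq_zero (i := i) (j := j) (fun h => hij (by rw [h]))
    rw [Submodule.coe_inner] at h
    rw [h, mul_zero]
  · have := R.sum_conj_amplitude_mul_of_sumsToZero h
      (a := R.extend (R.basis k' j : EuclideanSpace ℂ (R.level (k' + 1)))) (R.basis k i).2 n
    rw [← map_eq_zero (starRingEnd ℂ), map_sum]
    rw [← this]
    refine Finset.sum_congr rfl fun z _ => ?_
    rw [map_mul, Complex.conj_conj, mul_comm]

lemma amp_of_le {i : R.Index} {z : T.Vertex} (h : T.gen z ≤ i.1) : R.amp i z = 0 :=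
  amplitude_of_le h

lemma amp_of_lt {i : R.Index} {z : T.Vertex} (h : i.1 + 1 < T.gen z) :
    R.amp i z = R.amp i (T.parent z) := amplitude_of_lt h

lemma sum_children_amp {i : R.Index} {y : T.Vertex} (hy : T.gen y = i.1) (hy' : y ≠ T.root) :
    ∑ z ∈ R.children y, R.amp i z = 0 := by
  rw [← (R.basis i.1 i.2).2 y hy hy']
  refine Finset.sum_congr rfl fun z hz => amplitude_of_eq ?_
  rw [← T.gen_parent (R.mem_children.1 hz).1, (R.mem_children.1 hz).2, hy]

/-- On level `n + 1` the amplitudes of index `n` are an orthonormal basis of the zero sum space, in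
which `a` can be expanded. -/
lemma sum_conj_mul_eq_zero_of_sumsToZero {n : ℕ} {c : T.Vertex → ℂ}
    (h : ∀ i : R.Index, i.1 = n → ∑ z ∈ R.level (n + 1), conj (R.amp i z) * c z = 0)
    {a : T.Vertex → ℂ} (ha : R.SumsToZero n a) :
    ∑ z ∈ R.level (n + 1), conj (a z) * c z = 0 := by
  have hext : ∀ f : T.Vertex → ℂ, ∀ z ∈ R.level (n + 1),
      R.extend (WithLp.toLp 2 fun z : R.level (n + 1) => f z) z = f z := fun f z hz => by
    rw [extend, dif_pos hz]
  let C : EuclideanSpace ℂ (R.level (n + 1)) := WithLp.toLp 2 fun z => c z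
  have hmem : (WithLp.toLp 2 fun z : R.level (n + 1) => a z) ∈ R.zeroSumSpace n := by
    intro y hy hy'
    rw [← ha y hy hy']
    refine Finset.sum_congr rfl fun z hz => hext a z ?_
    rw [R.mem_level, ← T.gen_parent (R.mem_children.1 hz).1, (R.mem_children.1 hz).2, hy]
  have h1 : ∀ j, ⟪(R.basis n j : EuclideanSpace ℂ (R.level (n + 1))), C⟫_ℂ = 0 := by
    intro j
    rw [R.inner_eq_sum_extend, ← h ⟨n, j⟩ rfl]
    refine Finset.sum_congr rfl fun z hz => ?_
    rw [hext c z hz, amp, amplitude_of_eq (R.mem_level.1 hz)]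
  have h2 := (R.basis n).sum_repr' ⟨_, hmem⟩
  have h3 : ⟪(WithLp.toLp 2 fun z : R.level (n + 1) => a z), C⟫_ℂ = 0 := by
    have h4 := congrArg (fun x : R.zeroSumSpace n =>
      ⟪(x : EuclideanSpace ℂ (R.level (n + 1))), C⟫_ℂ) h2
    simp only [Submodule.coe_sum, Submodule.coe_smul, sum_inner, inner_smul_left, h1, mul_zero,
      Finset.sum_const_zero] at h4
    exact h4.symm
  rw [R.inner_eq_sum_extend] at h3
  rw [← h3]
  exact Finset.sum_congr rfl fun z hz => by rw [hext a z hz, hext c z hz]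

/-- On each level, the functions `amp i` span. -/
lemma eq_zero_of_sum_conj_amp_mul (n : ℕ) {c : T.Vertex → ℂ}
    (h : ∀ i : R.Index, i.1 ≤ n → ∑ z ∈ R.level (n + 1), conj (R.amp i z) * c z = 0) :
    ∀ z ∈ R.level (n + 1), c z = 0 := by
  classical
  induction n generalizing c with
  | zero =>
    intro z hz
    have h1 := R.sum_conj_mul_eq_zero_of_sumsToZero (fun i hi => h i hi.le)
      (a := fun v => if v = z then 1 else 0)
      (fun y hy hy' => absurd (T.gen_eq_zero_iff.1 hy) hy')
    simpa [apply_ite, hz] using h1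
  | succ n ih =>
    -- Testing against the difference of the point masses at two siblings, which sums to zero, shows
    -- that `c` agrees on siblings. So `c` descends to the previous level, where the induction
    -- hypothesis applies after division by `b (n + 1)`.
    have hsib : ∀ z ∈ R.level (n + 1 + 1), ∀ z' ∈ R.level (n + 1 + 1),
        T.parent z = T.parent z' → c z = c z' := by
      intro z hz z' hz' hp
      have h1 := R.sum_conj_mul_eq_zero_of_sumsToZero (fun i hi => h i hi.le)
        (a := fun v => (if v = z then 1 else 0) - (if v = z' then 1 else 0)) (by
          intro y hy hy'
          have h2 := T.ne_root_of_gen (R.mem_level.1 hz)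
          have h3 := T.ne_root_of_gen (R.mem_level.1 hz')
          simp [R.mem_children, h2, h3, hp])
      simp only [map_sub, apply_ite (starRingEnd ℂ), map_one, map_zero, sub_mul, ite_mul, one_mul,
        zero_mul, Finset.sum_sub_distrib, Finset.sum_ite_eq', hz, hz', if_true] at h1
      exact sub_eq_zero.1 h1
    choose ch hch1 hch2 using R.exists_child
    have hch : ∀ y ∈ R.level (n + 1), ch y ∈ R.level (n + 1 + 1) := fun y hy => by
      rw [R.mem_level, ← T.gen_parent (hch1 y), hch2, R.mem_level.1 hy]
    have hpar : ∀ z ∈ R.level (n + 1 + 1), T.parent z ∈ R.level (n + 1) := fun z hz =>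
      R.mem_level.2 (T.gen_parent_eq (R.mem_level.1 hz))
    have hc : ∀ z ∈ R.level (n + 1 + 1), c z = c (ch (T.parent z)) := fun z hz =>
      hsib z hz _ (hch _ (hpar z hz)) (hch2 _).symm
    have h0 := ih (c := fun y => c (ch y)) (fun i hi => by
      have h1 := h i (by omega)
      rw [Finset.sum_congr rfl fun z hz => by
        rw [hc z hz, R.amp_of_lt (i := i) (by rw [R.mem_level.1 hz]; omega)],
        R.sum_level_succ_of_parent (n + 1) (fun y => conj (R.amp i y) * c (ch y))] at h1
      exact (mul_eq_zero.1 h1).resolve_left (by exact_mod_cast (R.b_pos _).ne'))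
    intro z hz
    rw [hc z hz]
    exact h0 _ (hpar z hz)

end IsRegularWith

end RootedMetricTree
end

noncomputable section

/-! ### Integration on regular trees -/

/-- Lebesgue measure on the interval `(t_n, t_{n+1}]`. -/
def stepMeasure (t : ℕ → ℝ) (n : ℕ) : Measure ℝ := volume.restrict (Ioc (t n) (t (n + 1)))

instance (t : ℕ → ℝ) (n : ℕ) : IsFiniteMeasure (stepMeasure t n) :=
  inferInstanceAs (IsFiniteMeasure (volume.restrict (Ioc (t n) (t (n + 1)))))

lemma ae_stepMeasure_mem (t : ℕ → ℝ) (n : ℕ) : ∀ᵐ s ∂stepMeasure t n, s ∈ Ioc (t n) (t (n + 1)) :=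
  ae_restrict_mem measurableSet_Ioc

/-- The number `n` with `s ∈ (t_n, t_{n+1}]`. -/
def stepIndex (t : ℕ → ℝ) (s : ℝ) : ℕ := sInf {n | s ≤ t (n + 1)}

lemma stepIndex_eq {t : ℕ → ℝ} (ht : StrictMono t) {n : ℕ} {s : ℝ}
    (hs : s ∈ Ioc (t n) (t (n + 1))) : stepIndex t s = n := by
  apply le_antisymm (Nat.sInf_le hs.2)
  refine le_csInf ⟨n, hs.2⟩ fun j hj => ?_
  by_contra hlt
  have h1 : t (j + 1) ≤ t n := ht.monotone (by omega)
  exact absurd hs.1 (not_lt.2 (le_trans hj h1))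

namespace RootedMetricTree

instance (T : RootedMetricTree) : DiscreteMeasurableSpace T.Vertex := ⟨fun _ => trivial⟩

lemma measurableEmbedding_mk {T : RootedMetricTree} (z : T.Vertex) :
    MeasurableEmbedding (Prod.mk z : ℝ → T.Vertex × ℝ) :=
  MeasurableEmbedding.prodMk_left z MeasurableEmbedding.id

namespace IsRegularWith

variable {T : RootedMetricTree} {b : ℕ → ℕ} {t : ℕ → ℝ} (R : T.IsRegularWith b t)

include R

lemma measure_eq_sum : T.measure = Measure.sum fun n =>
    ∑ z ∈ R.level (n + 1), (stepMeasure t n).map (Prod.mk z) := by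
  classical
  ext s hs
  rw [RootedMetricTree.measure, Measure.sum_apply _ hs, Measure.sum_apply _ hs]
  set f : T.Vertex → ℝ≥0∞ := fun z =>
    ((volume.restrict (Ioc (T.height (T.parent z)) (T.height z))).map (Prod.mk z)) s with hf
  have h1 : ∀ n, (∑ z ∈ R.level (n + 1), (stepMeasure t n).map (Prod.mk z)) s
      = ∑' z, if T.gen z = n + 1 then f z else 0 := by
    intro n
    rw [Measure.coe_finsetSum, Finset.sum_apply, tsum_eq_sum (s := R.level (n + 1))]
    · refine Finset.sum_congr rfl fun z hz => ?_
      have hz := R.mem_level.1 hz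
      rw [if_pos hz, hf, stepMeasure]
      simp only [R.height_eq, hz, T.gen_parent_eq hz]
    · intro z hz
      exact if_neg fun h => hz (R.mem_level.2 h)
  have h2 : ∑' y : {y : T.Vertex // y ≠ T.root}, f y
      = ∑' z, ∑' n, if T.gen z = n + 1 then f z else 0 := by
    have h0 := tsum_subtype {y : T.Vertex | y ≠ T.root} f
    refine h0.trans (tsum_congr fun z => ?_)
    by_cases hz : z = T.root
    · rw [indicator_of_notMem (by simpa using hz), eq_comm, ENNReal.tsum_eq_zero]
      intro n
      rw [hz, T.gen_root, if_neg (by omega)]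
    · rw [indicator_of_mem (by simpa using hz), tsum_eq_single (T.gen (T.parent z)),
        if_pos (T.gen_parent hz).symm]
      intro n hn
      refine if_neg fun h => hn ?_
      rw [T.gen_parent_eq h]
  exact h2.trans ((ENNReal.tsum_comm).trans (tsum_congr fun n => (h1 n).symm))

lemma lintegral_measure (f : T.Vertex × ℝ → ℝ≥0∞) : ∫⁻ x, f x ∂T.measure
    = ∑' n, ∑ z ∈ R.level (n + 1), ∫⁻ s, f (z, s) ∂stepMeasure t n := by
  rw [R.measure_eq_sum, lintegral_sum_measure]
  refine tsum_congr fun n => ?_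
  rw [lintegral_finsetSum_measure]
  exact Finset.sum_congr rfl fun z _ => (measurableEmbedding_mk z).lintegral_map f

lemma integrable_step {f : T.Vertex × ℝ → ℂ} (hf : Integrable f T.measure) {n : ℕ} {z : T.Vertex}
    (hz : z ∈ R.level (n + 1)) : Integrable (fun s => f (z, s)) (stepMeasure t n) := by
  rw [R.measure_eq_sum] at hf
  have h1 := hf.mono_measure (Measure.le_sum _ n)
  rw [integrable_finsetSum_measure] at h1
  exact (measurableEmbedding_mk z).integrable_map_iff.1 (h1 z hz)

lemma integral_measure {f : T.Vertex × ℝ → ℂ} (hf : Integrable f T.measure) : ∫ x, f x ∂T.measure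
    = ∑' n, ∑ z ∈ R.level (n + 1), ∫ s, f (z, s) ∂stepMeasure t n := by
  have hf' := hf
  rw [R.measure_eq_sum] at hf'
  rw [R.measure_eq_sum, integral_sum_measure hf']
  refine tsum_congr fun n => ?_
  have h1 := hf'.mono_measure (Measure.le_sum _ n)
  rw [integrable_finsetSum_measure] at h1
  rw [integral_finsetSum_measure h1]
  exact Finset.sum_congr rfl fun z _ => (measurableEmbedding_mk z).integral_map f

lemma ae_measure_iff {Q : T.Vertex × ℝ → Prop} : (∀ᵐ x ∂T.measure, Q x) ↔
    ∀ n, ∀ z ∈ R.level (n + 1), ∀ᵐ s ∂stepMeasure t n, Q (z, s) := by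
  rw [R.measure_eq_sum, Measure.ae_sum_iff]
  refine forall_congr' fun n => ?_
  rw [ae_finsetSum_measure_iff]
  exact forall₂_congr fun z _ => (measurableEmbedding_mk z).ae_map_iff

omit R in
lemma weightedMeasure_eq_sum (b : ℕ → ℕ) (t : ℕ → ℝ) (k : ℕ) :
    RegularTree.weightedMeasure b t k
      = Measure.sum fun n => (weight b k n : ℝ≥0∞) • stepMeasure t n := by
  have h1 : RegularTree.branchingFunction b t k
      = ∑' n : ℕ, (Ioc (t (k + n)) (t (k + n + 1))).indicator
      (fun _ => ∏ j ∈ Finset.Ioc k (k + n), (b j : ℝ≥0∞)) := by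
    ext s
    rw [RegularTree.branchingFunction, tsum_apply (Pi.summable.2 fun s => ENNReal.summable)]
  rw [RegularTree.weightedMeasure, h1, withDensity_tsum fun n =>
    measurable_const.indicator measurableSet_Ioc]
  ext s hs
  rw [Measure.sum_apply _ hs, Measure.sum_apply _ hs,
    ← (add_right_injective k).tsum_eq (f := fun n => ((weight b k n : ℝ≥0∞) • stepMeasure t n) s)]
  · refine tsum_congr fun n => ?_
    rw [withDensity_indicator measurableSet_Ioc, withDensity_const, stepMeasure, weight,
      if_pos (by omega), Nat.cast_prod]
  -- The steps with `n < k` have weight `0`, so reindexing by `k + n` loses nothing.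
  · intro n hn
    refine ⟨n - k, ?_⟩
    have : ¬ n < k := fun h => hn (by simp [weight_of_lt h])
    simp only
    omega

omit R in
lemma lintegral_weightedMeasure (k : ℕ) (f : ℝ → ℝ≥0∞) :
    ∫⁻ s, f s ∂(RegularTree.weightedMeasure b t k)
      = ∑' n, (weight b k n : ℝ≥0∞) * ∫⁻ s, f s ∂stepMeasure t n := by
  rw [weightedMeasure_eq_sum, lintegral_sum_measure]
  exact tsum_congr fun n => by rw [lintegral_smul_measure, smul_eq_mul]

omit R in
lemma integral_weightedMeasure {k : ℕ} {f : ℝ → ℂ}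
    (hf : Integrable f (RegularTree.weightedMeasure b t k)) :
    ∫ s, f s ∂(RegularTree.weightedMeasure b t k)
      = ∑' n, (weight b k n : ℂ) * ∫ s, f s ∂stepMeasure t n := by
  rw [weightedMeasure_eq_sum] at hf ⊢
  rw [integral_sum_measure hf]
  refine tsum_congr fun n => ?_
  rw [integral_smul_measure, ENNReal.toReal_natCast, Complex.real_smul, Complex.ofReal_natCast]

lemma ae_weightedMeasure_iff {k : ℕ} {Q : ℝ → Prop} :
    (∀ᵐ s ∂(RegularTree.weightedMeasure b t k), Q s) ↔
      ∀ n, k ≤ n → ∀ᵐ s ∂stepMeasure t n, Q s := by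
  rw [weightedMeasure_eq_sum, Measure.ae_sum_iff]
  refine forall_congr' fun n => ?_
  by_cases h : k ≤ n
  · rw [Measure.ae_ennreal_smul_measure_iff (by exact_mod_cast (R.weight_pos h).ne')]
    simp [h]
  · rw [weight_of_lt (by omega)]
    simp [h]

lemma sum_enorm_amp_sq (i : R.Index) (n : ℕ) :
    ∑ z ∈ R.level (n + 1), ‖R.amp i z‖ₑ ^ 2 = (weight b i.1 n : ℝ≥0∞) := by
  have h1 : ((∑ z ∈ R.level (n + 1), ‖R.amp i z‖ ^ 2 : ℝ) : ℂ) = ((weight b i.1 n : ℝ) : ℂ) := by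
    rw [Complex.ofReal_natCast, ← R.sum_conj_amp_mul_amp_self i n]
    push_cast
    exact Finset.sum_congr rfl fun z _ => (Complex.conj_mul' _).symm
  have h2 := Complex.ofReal_injective h1
  rw [← ENNReal.ofReal_natCast, ← h2, ENNReal.ofReal_sum_of_nonneg fun _ _ => by positivity]
  refine Finset.sum_congr rfl fun z _ => ?_
  rw [ENNReal.ofReal_pow (norm_nonneg _), ofReal_norm]

omit R in
lemma measurable_comp_fst (a : T.Vertex → ℂ) : Measurable fun x : T.Vertex × ℝ => a x.1 :=
  (measurable_from_top (f := a)).comp measurable_fst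

/-- On each level the squares of the normalized amplitude add up to the value of the branching
function; this is what makes the embedding isometric. -/
lemma map_withDensity_amp (i : R.Index) :
    (T.measure.withDensity fun x => ‖R.amp i x.1‖ₑ ^ 2).map Prod.snd
      = RegularTree.weightedMeasure b t i.1 := by
  ext s hs
  rw [Measure.map_apply measurable_snd hs, withDensity_apply _ (measurable_snd hs),
    ← lintegral_indicator (measurable_snd hs), R.lintegral_measure, weightedMeasure_eq_sum,
    Measure.sum_apply _ hs]
  refine tsum_congr fun n => ?_
  rw [Measure.smul_apply, smul_eq_mul, ← R.sum_enorm_amp_sq, Finset.sum_mul]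
  refine Finset.sum_congr rfl fun z _ => ?_
  have : (fun s' => (Prod.snd ⁻¹' s : Set (T.Vertex × ℝ)).indicator
      (fun x => ‖R.amp i x.1‖ₑ ^ 2) (z, s')) = s.indicator fun _ => ‖R.amp i z‖ₑ ^ 2 := by
    ext s'
    rfl
  rw [this, lintegral_indicator hs, setLIntegral_const]

/-- The embedding of the part with index `i` into `L²` of the tree. -/
def embed (i : R.Index) : Lp ℂ 2 (RegularTree.weightedMeasure b t i.1) →ₗᵢ[ℂ] Lp ℂ 2 T.measure :=
  weightedComp (fun x => R.amp i x.1) Prod.snd (measurable_comp_fst _) measurable_snd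
    (R.map_withDensity_amp i)

lemma coeFn_embed_of_ae (i : R.Index) {u : Lp ℂ 2 (RegularTree.weightedMeasure b t i.1)}
    {F : ℝ → ℂ} (hF : ∀ᵐ s ∂(RegularTree.weightedMeasure b t i.1), u s = F s) :
    ∀ᵐ x ∂T.measure, R.embed i u x = R.amp i x.1 * F x.2 :=
  coeFn_weightedComp_of_ae _ _ _ hF

/-- The weighted mean over the points of the tree at distance `s` from the root. -/
def fiberMean (i : R.Index) (f : T.Vertex → ℝ → ℂ) (s : ℝ) : ℂ :=
  (weight b i.1 (stepIndex t s) : ℂ)⁻¹ *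
    ∑ z ∈ R.level (stepIndex t s + 1), conj (R.amp i z) * f z s

lemma fiberMean_eq (i : R.Index) (f : T.Vertex → ℝ → ℂ) {n : ℕ} {s : ℝ}
    (hs : s ∈ Ioc (t n) (t (n + 1))) : R.fiberMean i f s
      = (weight b i.1 n : ℂ)⁻¹ * ∑ z ∈ R.level (n + 1), conj (R.amp i z) * f z s := by
  rw [fiberMean, stepIndex_eq R.t_strictMono hs]

/-- Cauchy–Schwarz on one level, where the squared amplitudes add up to the weight. -/
lemma weight_mul_norm_fiberMean_sq_le (i : R.Index) (n : ℕ) (c : T.Vertex → ℂ) :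
    (weight b i.1 n : ℝ≥0∞) *
        ‖(weight b i.1 n : ℂ)⁻¹ * ∑ z ∈ R.level (n + 1), conj (R.amp i z) * c z‖ₑ ^ 2
      ≤ ∑ z ∈ R.level (n + 1), ‖c z‖ₑ ^ 2 := by
  by_cases hk : i.1 ≤ n
  swap
  · rw [weight_of_lt (by omega)]
    simp
  set w : ℝ := (weight b i.1 n : ℝ) with hw
  have hw0 : 0 < w := Nat.cast_pos.2 (R.weight_pos hk)
  have h1 : ∑ z ∈ R.level (n + 1), ‖R.amp i z‖ ^ 2 = w := by
    have : ((∑ z ∈ R.level (n + 1), ‖R.amp i z‖ ^ 2 : ℝ) : ℂ) = (w : ℂ) := by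
      rw [hw, Complex.ofReal_natCast, ← R.sum_conj_amp_mul_amp_self i n]
      push_cast
      exact Finset.sum_congr rfl fun z _ => (Complex.conj_mul' _).symm
    exact Complex.ofReal_injective this
  have h2 : ‖∑ z ∈ R.level (n + 1), conj (R.amp i z) * c z‖ ^ 2
      ≤ w * ∑ z ∈ R.level (n + 1), ‖c z‖ ^ 2 := by
    rw [← h1]
    refine le_trans ?_ (Finset.sum_mul_sq_le_sq_mul_sq _ _ _)
    gcongr
    refine (norm_sum_le _ _).trans (Finset.sum_le_sum fun z _ => ?_)
    rw [norm_mul, RCLike.norm_conj]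
  have h3 : w * ‖((w : ℝ) : ℂ)⁻¹ * ∑ z ∈ R.level (n + 1), conj (R.amp i z) * c z‖ ^ 2
      ≤ ∑ z ∈ R.level (n + 1), ‖c z‖ ^ 2 := by
    rw [norm_mul, norm_inv, Complex.norm_real, Real.norm_of_nonneg hw0.le, mul_pow, inv_pow]
    calc _ = w⁻¹ * ‖∑ z ∈ R.level (n + 1), conj (R.amp i z) * c z‖ ^ 2 := by
          field_simp
      _ ≤ w⁻¹ * (w * ∑ z ∈ R.level (n + 1), ‖c z‖ ^ 2) := by gcongr
      _ = _ := by field_simp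
  have h4 := ENNReal.ofReal_le_ofReal h3
  rw [ENNReal.ofReal_mul hw0.le, ENNReal.ofReal_pow (norm_nonneg _), ofReal_norm, hw,
    ENNReal.ofReal_natCast, ENNReal.ofReal_sum_of_nonneg fun _ _ => by positivity,
    Complex.ofReal_natCast] at h4
  refine h4.trans (le_of_eq (Finset.sum_congr rfl fun z _ => ?_))
  rw [ENNReal.ofReal_pow (norm_nonneg _), ofReal_norm]

lemma memLp_fiberMean (i : R.Index) (f : Lp ℂ 2 T.measure) :
    MemLp (R.fiberMean i fun z s => f (z, s)) 2 (RegularTree.weightedMeasure b t i.1) := by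
  have hf := (Lp.stronglyMeasurable f).measurable
  have heq : ∀ n, R.fiberMean i (fun z s => f (z, s)) =ᵐ[stepMeasure t n] fun s =>
      (weight b i.1 n : ℂ)⁻¹ * ∑ z ∈ R.level (n + 1), conj (R.amp i z) * f (z, s) := fun n => by
    filter_upwards [ae_stepMeasure_mem t n] with s hs
    rw [R.fiberMean_eq i _ hs]
  have hmeas : ∀ n, Measurable fun s : ℝ =>
      (weight b i.1 n : ℂ)⁻¹ * ∑ z ∈ R.level (n + 1), conj (R.amp i z) * f (z, s) := fun n =>
    (Finset.measurable_fun_sum _ fun z _ =>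
      (hf.comp measurable_prodMk_left).const_mul _).const_mul _
  constructor
  · rw [weightedMeasure_eq_sum, aestronglyMeasurable_sum_measure_iff]
    intro n
    exact ((hmeas n).aestronglyMeasurable.congr (heq n).symm).smul_measure _
  · have hfin := (Lp.memLp f).2
    rw [eLpNorm_lt_top_iff_lintegral_rpow_enorm_lt_top two_ne_zero ENNReal.ofNat_ne_top] at hfin ⊢
    refine lt_of_le_of_lt ?_ hfin
    rw [lintegral_weightedMeasure, R.lintegral_measure]
    refine ENNReal.tsum_le_tsum fun n => ?_
    simp only [ENNReal.toReal_ofNat, ENNReal.rpow_ofNat]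
    rw [← lintegral_const_mul' _ _ (ENNReal.natCast_ne_top _), ← lintegral_finsetSum
      (f := fun z s => ‖f (z, s)‖ₑ ^ 2) _ fun z _ =>
        ((hf.comp measurable_prodMk_left).enorm.pow_const 2)]
    refine lintegral_mono_ae ?_
    filter_upwards [heq n] with s hs
    rw [hs]
    exact R.weight_mul_norm_fiberMean_sq_le i n fun z => f (z, s)

/-- In the inner product with an embedded `u`, the factor `conj (u s)` comes out of the sum over
each level, and what remains is the weight times the mean. Levels with `n < i.1` contribute zero on
both sides. -/
lemma coeFn_adj_embed (i : R.Index) (f : Lp ℂ 2 T.measure) :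
    (R.embed i).adj f =ᵐ[RegularTree.weightedMeasure b t i.1]
      R.fiberMean i fun z s => f (z, s) := by
  have key : (R.embed i).adj f = (R.memLp_fiberMean i f).toLp := by
    refine ext_inner_left ℂ fun u => ?_
    rw [ContinuousLinearMap.adjoint_inner_right, L2.inner_def, L2.inner_def,
      R.integral_measure (L2.integrable_inner _ _), integral_weightedMeasure
        (L2.integrable_inner _ _)]
    refine tsum_congr fun n => ?_
    have hu := R.ae_measure_iff.1 (R.coeFn_embed_of_ae i (u := u) (F := u) (ae_of_all _ fun _ => rfl))
    rw [← integral_finsetSum _ fun z hz => R.integrable_step (L2.integrable_inner _ f) hz,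
      ← integral_const_mul]
    by_cases hk : i.1 ≤ n
    · have hg := R.ae_weightedMeasure_iff.1 (R.memLp_fiberMean i f).coeFn_toLp n hk
      refine integral_congr_ae ?_
      have hu' : ∀ᵐ s ∂stepMeasure t n, ∀ z ∈ R.level (n + 1),
          R.embed i u (z, s) = R.amp i z * u s := by
        rw [Filter.eventually_all_finset]
        exact fun z hz => hu n z hz
      filter_upwards [hg, hu', ae_stepMeasure_mem t n] with s h1 h2 h3
      have hw : (weight b i.1 n : ℂ) ≠ 0 := by exact_mod_cast (R.weight_pos hk).ne'
      rw [h1, R.fiberMean_eq i _ h3, RCLike.inner_apply, mul_assoc, ← mul_assoc,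
        mul_inv_cancel₀ hw, one_mul, Finset.sum_mul]
      refine Finset.sum_congr rfl fun z hz => ?_
      have h4 : ((R.embed i).toContinuousLinearMap u) (z, s) = R.amp i z * u s := h2 z hz
      rw [h4, RCLike.inner_apply, map_mul]
      ring
    · rw [weight_of_lt (by omega)]
      simp only [Nat.cast_zero, zero_mul, integral_zero]
      refine integral_eq_zero_of_ae ?_
      have hu' : ∀ᵐ s ∂stepMeasure t n, ∀ z ∈ R.level (n + 1),
          R.embed i u (z, s) = R.amp i z * u s := by
        rw [Filter.eventually_all_finset]
        exact fun z hz => hu n z hz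
      filter_upwards [hu'] with s h2
      refine Finset.sum_eq_zero fun z hz => ?_
      have h4 : ((R.embed i).toContinuousLinearMap u) (z, s) = R.amp i z * u s := h2 z hz
      rw [h4, R.amp_of_le (by rw [R.mem_level.1 hz]; omega), zero_mul, inner_zero_left]
  rw [key]
  exact MemLp.coeFn_toLp _

lemma orthogonalFamily_embed : OrthogonalFamily ℂ
    (fun i : R.Index => Lp ℂ 2 (RegularTree.weightedMeasure b t i.1)) R.embed := by
  intro i j hij u v
  have h0 : (R.embed i).adj (R.embed j v) = 0 := by
    refine Lp.ext ?_
    have hv := R.ae_measure_iff.1 (R.coeFn_embed_of_ae j (u := v) (F := v) (ae_of_all _ fun _ => rfl))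
    refine (R.coeFn_adj_embed i _).trans (Filter.EventuallyEq.trans ?_ (Lp.coeFn_zero ℂ 2 _).symm)
    refine R.ae_weightedMeasure_iff.2 fun n hn => ?_
    have hv' : ∀ᵐ s ∂stepMeasure t n, ∀ z ∈ R.level (n + 1),
        R.embed j v (z, s) = R.amp j z * v s := by
      rw [Filter.eventually_all_finset]
      exact fun z hz => hv n z hz
    filter_upwards [hv', ae_stepMeasure_mem t n] with s h1 h2
    rw [R.fiberMean_eq i _ h2, Finset.sum_congr rfl fun z hz => by rw [h1 z hz, ← mul_assoc],
      ← Finset.sum_mul, R.sum_conj_amp_mul_amp_of_ne hij, zero_mul, mul_zero]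
    rfl
  have h1 := ContinuousLinearMap.adjoint_inner_right (R.embed i).toContinuousLinearMap u
    (R.embed j v)
  rw [h0, inner_zero_right] at h1
  exact h1.symm

/-- The index set is countable, so for almost every `s` all means vanish at once. At such `s` the
spanning property on the finite level applies pointwise. -/
lemma eq_zero_of_adj_embed (f : Lp ℂ 2 T.measure) (h : ∀ i, (R.embed i).adj f = 0) : f = 0 := by
  refine Lp.ext (Filter.EventuallyEq.trans ?_ (Lp.coeFn_zero ℂ 2 _).symm)
  refine R.ae_measure_iff.2 fun n z hz => ?_
  have h1 : ∀ i : R.Index, i.1 ≤ n → ∀ᵐ s ∂stepMeasure t n,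
      ∑ z ∈ R.level (n + 1), conj (R.amp i z) * f (z, s) = 0 := by
    intro i hi
    have h2 := R.ae_weightedMeasure_iff.1 (R.coeFn_adj_embed i f) n hi
    rw [h i] at h2
    have h3 := R.ae_weightedMeasure_iff.1
      (Lp.coeFn_zero ℂ 2 (RegularTree.weightedMeasure b t i.1)) n hi
    filter_upwards [h2, h3, ae_stepMeasure_mem t n] with s h4 h5 h6
    rw [h5, R.fiberMean_eq i _ h6, Pi.zero_apply, eq_comm, mul_eq_zero] at h4
    exact h4.resolve_left (inv_ne_zero (by exact_mod_cast (R.weight_pos hi).ne'))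
  have h2 : ∀ᵐ s ∂stepMeasure t n, ∀ i : R.Index, i.1 ≤ n →
      ∑ z ∈ R.level (n + 1), conj (R.amp i z) * f (z, s) = 0 := by
    rw [ae_all_iff]
    intro i
    by_cases hi : i.1 ≤ n
    · filter_upwards [h1 i hi] with s hs _
      exact hs
    · exact ae_of_all _ fun s hi' => absurd hi' hi
  filter_upwards [h2] with s hs
  exact R.eq_zero_of_sum_conj_amp_mul n (c := fun z => f (z, s)) hs z hz

end IsRegularWith

end RootedMetricTree
end

noncomputable section

/-! ### Absolutely continuous functions -/

namespace IsPrimitiveOn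

variable {a b c : ℝ} {F G F' G' : ℝ → ℂ}

lemma refl (a : ℝ) (F G : ℝ → ℂ) : IsPrimitiveOn a a F G :=
  ⟨IntervalIntegrable.refl, fun s hs => by
    rw [Icc_self, mem_singleton_iff] at hs
    rw [hs, intervalIntegral.integral_same, add_zero]⟩

lemma trans (hab : a ≤ b) (hbc : b ≤ c) (h : IsPrimitiveOn a b F G) (h' : IsPrimitiveOn b c F G) :
    IsPrimitiveOn a c F G := by
  refine ⟨h.1.trans h'.1, fun s hs => ?_⟩
  rcases le_total s b with hsb | hsb
  · exact h.2 s ⟨hs.1, hsb⟩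
  · rw [h'.2 s ⟨hsb, hs.2⟩, h.2 b ⟨hab, le_rfl⟩, add_assoc,
      intervalIntegral.integral_add_adjacent_intervals h.1]
    refine h'.1.mono_set ?_
    rw [uIcc_of_le hsb, uIcc_of_le hbc]
    exact Icc_subset_Icc_right hs.2

lemma mono {a' b' : ℝ} (h : IsPrimitiveOn a b F G) (ha : a ≤ a') (hab : a' ≤ b') (hb : b' ≤ b) :
    IsPrimitiveOn a' b' F G := by
  have hi : ∀ {x y}, a ≤ x → x ≤ y → y ≤ b → IntervalIntegrable G volume x y := by
    intro x y h1 h2 h3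
    refine h.1.mono_set ?_
    rw [uIcc_of_le h2, uIcc_of_le (h1.trans (h2.trans h3))]
    exact Icc_subset_Icc h1 h3
  refine ⟨hi ha hab hb, fun s hs => ?_⟩
  rw [h.2 s ⟨ha.trans hs.1, hs.2.trans hb⟩, h.2 a' ⟨ha, hab.trans hb⟩, add_assoc,
    intervalIntegral.integral_add_adjacent_intervals (hi le_rfl ha (hab.trans hb))
      (hi ha hs.1 (hs.2.trans hb))]

lemma congr (hab : a ≤ b) (h : IsPrimitiveOn a b F G) (hF : ∀ s ∈ Icc a b, F' s = F s)
    (hG : ∀ s ∈ Ioc a b, G' s = G s) : IsPrimitiveOn a b F' G' := by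
  refine ⟨h.1.congr ?_, fun s hs => ?_⟩
  · rw [uIoc_of_le hab]
    exact fun s hs => (hG s hs).symm
  · rw [hF s hs, hF a ⟨le_rfl, hab⟩, h.2 s hs]
    congr 1
    refine intervalIntegral.integral_congr_ae (ae_of_all _ fun x hx => ?_)
    rw [uIoc_of_le hs.1] at hx
    exact (hG x ⟨hx.1, hx.2.trans hs.2⟩).symm

lemma finset_sum {ι : Type*} (s : Finset ι) {f g : ι → ℝ → ℂ} (e : ι → ℂ)
    (h : ∀ i ∈ s, IsPrimitiveOn a b (f i) (g i)) :
    IsPrimitiveOn a b (fun x => ∑ i ∈ s, e i * f i x) (fun x => ∑ i ∈ s, e i * g i x) := by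
  classical
  induction s using Finset.induction_on with
  | empty => simpa using IsPrimitiveOn.zero a b
  | insert i s hi ih =>
    simp only [Finset.sum_insert hi]
    exact ((h i (by simp)).smul (e i)).add (ih fun j hj => h j (by simp [hj]))

end IsPrimitiveOn

/-! ### The decomposition of the Sobolev space -/

namespace RootedMetricTree

namespace IsRegularWith

variable {T : RootedMetricTree} {b : ℕ → ℕ} {t : ℕ → ℝ} (R : T.IsRegularWith b t)

include R

lemma height_of_gen {y : T.Vertex} {n : ℕ} (hy : T.gen y = n + 1) :
    T.height (T.parent y) = t n ∧ T.height y = t (n + 1) :=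
  ⟨by rw [R.height_eq, T.gen_parent_eq hy], by rw [R.height_eq, hy]⟩

omit R in
lemma exists_gen_eq_succ {y : T.Vertex} (hy : y ≠ T.root) : ∃ n, T.gen y = n + 1 :=
  ⟨_, (T.gen_parent hy).symm⟩

lemma t_le {m n : ℕ} (h : m ≤ n) : t m ≤ t n := R.t_strictMono.monotone h

/-- The amplitude can jump only at vertices of generation `i.1`, whose height is `t i.1`, where `F`
vanishes; further out it is constant along branches, so the product is continuous. -/
lemma embed_mem_sobolev (i : R.Index) {p : Lp ℂ 2 (RegularTree.weightedMeasure b t i.1) ×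
    Lp ℂ 2 (RegularTree.weightedMeasure b t i.1)} (hp : p ∈ RegularTree.sobolev b t i.1) :
    (R.embed i p.1, R.embed i p.2) ∈ T.sobolev := by
  obtain ⟨F, G, h0, h, hF, hG⟩ := hp
  refine ⟨fun z s => R.amp i z * F s, fun z s => R.amp i z * G s, ⟨⟨fun y =>
    R.amp i y * F (t (T.gen y)), ?_, fun y hy => ?_⟩, fun y hy => ?_⟩,
    R.coeFn_embed_of_ae i hF, R.coeFn_embed_of_ae i hG⟩
  · beta_reduce
    rw [R.amp_of_le (i := i) (z := T.root) (by rw [T.gen_root]; omega), zero_mul]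
  · obtain ⟨n, hn⟩ := exists_gen_eq_succ hy
    beta_reduce
    rw [(R.height_of_gen hn).1, (R.height_of_gen hn).2, T.gen_parent_eq hn, hn]
    refine ⟨?_, rfl⟩
    rcases lt_trichotomy n i.1 with h1 | h1 | h1
    · rw [R.amp_of_le (i := i) (z := y) (by omega),
        R.amp_of_le (i := i) (z := T.parent y) (by rw [T.gen_parent_eq hn]; omega)]
    · rw [h1, h0, mul_zero, mul_zero]
    · rw [R.amp_of_lt (i := i) (z := y) (by omega)]
  · obtain ⟨n, hn⟩ := exists_gen_eq_succ hy
    rw [(R.height_of_gen hn).1, (R.height_of_gen hn).2]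
    by_cases h1 : i.1 ≤ n
    · exact ((h (n + 1) (by omega)).mono (R.t_le h1) (R.t_le (by omega)) le_rfl).smul _
    · beta_reduce
      rw [R.amp_of_le (i := i) (z := y) (by omega)]
      simpa using IsPrimitiveOn.zero _ _

lemma fiberMean_start (i : R.Index) {F : T.Vertex → ℝ → ℂ} {c : T.Vertex → ℂ} (hc0 : c T.root = 0)
    (hc : ∀ y, y ≠ T.root → F y (T.height (T.parent y)) = c (T.parent y) ∧ F y (T.height y) = c y) :
    R.fiberMean i F (t i.1) = 0 := by
  rcases Nat.eq_zero_or_pos i.1 with h | h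
  -- The point `t 0` lies in no interval `(t_n, t_{n+1}]`, but the infimum still gives the index
  -- `0`, and the mean there involves only the value at the root.
  · have h1 : stepIndex t (t i.1) = 0 := by
      rw [stepIndex, Nat.sInf_eq_zero]
      exact Or.inl (R.t_le (by omega))
    rw [fiberMean, h1, Finset.sum_eq_zero, mul_zero]
    intro z hz
    have hz := R.mem_level.1 hz
    have h2 := (hc z (T.ne_root_of_gen hz)).1
    rw [(R.height_of_gen hz).1, T.gen_eq_zero_iff.1 (T.gen_parent_eq hz), hc0] at h2
    rw [h, h2, mul_zero]
  · obtain ⟨k, hk⟩ := Nat.exists_eq_succ_of_ne_zero h.ne'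
    have h1 : t i.1 ∈ Ioc (t k) (t (k + 1)) := by
      rw [hk]
      exact ⟨R.t_strictMono (Nat.lt_succ_self k), le_rfl⟩
    -- The point `t_k` belongs to the step before `k`, whose weight is `0`; the mean is zero because
    -- `0⁻¹ = 0`.
    rw [R.fiberMean_eq i _ h1, weight_of_lt (by omega)]
    simp

/-- Continuity of the mean at `t n`: its value there is computed on the edges that end at this
height, the right-hand side on those that start there. For `n = i.1` the latter vanishes, by the
zero sum condition or the condition at the root. For larger `n` the number `b n` of equal terms from
each vertex cancels the growth of the weight. -/
lemma fiberMean_node (i : R.Index) {F : T.Vertex → ℝ → ℂ} {c : T.Vertex → ℂ} (hc0 : c T.root = 0)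
    (hc : ∀ y, y ≠ T.root → F y (T.height (T.parent y)) = c (T.parent y) ∧ F y (T.height y) = c y)
    {n : ℕ} (hn : i.1 ≤ n) : R.fiberMean i F (t n)
      = (weight b i.1 n : ℂ)⁻¹ * ∑ z ∈ R.level (n + 1), conj (R.amp i z) * F z (t n) := by
  have h1 : ∀ z ∈ R.level (n + 1), conj (R.amp i z) * F z (t n)
      = conj (R.amp i z) * c (T.parent z) := fun z hz => by
    have hz := R.mem_level.1 hz
    have h2 := (hc z (T.ne_root_of_gen hz)).1
    rw [(R.height_of_gen hz).1] at h2
    rw [h2]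
  rw [Finset.sum_congr rfl h1]
  rcases hn.eq_or_lt with h | h
  · subst h
    rw [R.fiberMean_start i hc0 hc, R.sum_level_succ, Finset.sum_eq_zero, mul_zero]
    intro y hy
    rw [Finset.sum_congr rfl fun z hz => by rw [(R.mem_children.1 hz).2], ← Finset.sum_mul]
    by_cases hy' : y = T.root
    · rw [hy', hc0, mul_zero]
    · rw [← map_sum, R.sum_children_amp (R.mem_level.1 hy) hy', map_zero, zero_mul]
  · obtain ⟨k, rfl⟩ : ∃ k, n = k + 1 := ⟨n - 1, by omega⟩
    rw [R.fiberMean_eq i F (n := k) ⟨R.t_strictMono (Nat.lt_succ_self k), le_rfl⟩]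
    have h2 : ∀ z ∈ R.level (k + 1), conj (R.amp i z) * F z (t (k + 1))
        = conj (R.amp i z) * c z := fun z hz => by
      have hz := R.mem_level.1 hz
      have h2 := (hc z (T.ne_root_of_gen hz)).2
      rw [(R.height_of_gen hz).2] at h2
      rw [h2]
    have h3 : ∀ z ∈ R.level (k + 1 + 1), conj (R.amp i z) * c (T.parent z)
        = conj (R.amp i (T.parent z)) * c (T.parent z) := fun z hz => by
      rw [R.amp_of_lt (i := i) (z := z) (by rw [R.mem_level.1 hz]; omega)]
    rw [Finset.sum_congr rfl h2, Finset.sum_congr rfl h3,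
      R.sum_level_succ_of_parent (k + 1) (fun y => conj (R.amp i y) * c y), weight_succ (by omega)]
    have hb : (b (k + 1) : ℂ) ≠ 0 := by exact_mod_cast (R.b_pos _).ne'
    push_cast
    rw [mul_inv, mul_assoc, inv_mul_cancel_left₀ hb]

lemma adj_embed_mem_sobolev (i : R.Index) {p : Lp ℂ 2 T.measure × Lp ℂ 2 T.measure}
    (hp : p ∈ T.sobolev) :
    ((R.embed i).adj p.1, (R.embed i).adj p.2) ∈ RegularTree.sobolev b t i.1 := by
  obtain ⟨F, G, ⟨⟨c, hc0, hc⟩, h⟩, hF, hG⟩ := hp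
  have hae : ∀ (f : Lp ℂ 2 T.measure) (F : T.Vertex → ℝ → ℂ),
      (∀ᵐ x ∂T.measure, f x = F x.1 x.2) →
      ∀ᵐ s ∂(RegularTree.weightedMeasure b t i.1), (R.embed i).adj f s = R.fiberMean i F s := by
    intro f F hf
    have h1 : ∀ᵐ s ∂(RegularTree.weightedMeasure b t i.1),
        R.fiberMean i (fun z s => f (z, s)) s = R.fiberMean i F s := by
      refine R.ae_weightedMeasure_iff.2 fun n _ => ?_
      have h2 : ∀ᵐ s ∂stepMeasure t n, ∀ z ∈ R.level (n + 1), f (z, s) = F z s := by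
        rw [Filter.eventually_all_finset]
        exact fun z hz => R.ae_measure_iff.1 hf n z hz
      filter_upwards [h2, ae_stepMeasure_mem t n] with s h3 h4
      rw [R.fiberMean_eq i _ h4, R.fiberMean_eq i _ h4]
      congr 1
      exact Finset.sum_congr rfl fun z hz => by rw [h3 z hz]
    filter_upwards [R.coeFn_adj_embed i f, h1] with s h2 h3
    rw [h2, h3]
  refine ⟨R.fiberMean i F, R.fiberMean i G, R.fiberMean_start i hc0 hc, fun n hn => ?_,
    hae _ _ hF, hae _ _ hG⟩
  -- On one step the mean is a fixed linear combination of primitives on finitely many edges;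
  -- `fiberMean_node` supplies the value at its left endpoint, and the steps are glued by
  -- `IsPrimitiveOn.trans`.
  induction n, hn using Nat.le_induction with
  | base => exact IsPrimitiveOn.refl _ _ _
  | succ n hn ih =>
    refine ih.trans (R.t_le hn) (R.t_le (by omega)) ?_
    refine IsPrimitiveOn.congr (R.t_le (by omega)) ((IsPrimitiveOn.finset_sum (f := F) (g := G)
      (R.level (n + 1)) (fun z => conj (R.amp i z)) fun z hz => ?_).smul (weight b i.1 n : ℂ)⁻¹) ?_ ?_
    · have hz := R.mem_level.1 hz
      have h1 := h z (T.ne_root_of_gen hz)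
      rwa [(R.height_of_gen hz).1, (R.height_of_gen hz).2] at h1
    · intro s hs
      rcases hs.1.eq_or_lt with h1 | h1
      · rw [← h1, R.fiberMean_node i hc0 hc hn]
      · rw [R.fiberMean_eq i F ⟨h1, hs.2⟩]
    · intro s hs
      rw [R.fiberMean_eq i G hs]

lemma map_stepMeasure_le {n : ℕ} {z : T.Vertex} (hz : z ∈ R.level (n + 1)) :
    (stepMeasure t n).map (Prod.mk z) ≤ T.measure := by
  rw [R.measure_eq_sum]
  refine le_trans ?_ (Measure.le_sum _ n)
  exact Finset.single_le_sum (f := fun z => (stepMeasure t n).map (Prod.mk z))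
    (fun _ _ => Measure.zero_le _) hz

lemma memLp_edge {n : ℕ} {z : T.Vertex} (hz : z ∈ R.level (n + 1)) (f : Lp ℂ 2 T.measure) :
    MemLp (fun s => f (z, s)) 2 (stepMeasure t n) :=
  (measurableEmbedding_mk z).memLp_map_measure_iff.1
    ((Lp.memLp f).mono_measure (R.map_stepMeasure_le hz))

lemma integrableOn_edge {n : ℕ} {z : T.Vertex} (hz : z ∈ R.level (n + 1)) (f : Lp ℂ 2 T.measure) :
    IntegrableOn (fun s => f (z, s)) (Ioc (t n) (t (n + 1))) :=
  (R.memLp_edge hz f).integrable one_le_two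

/-- Edges have finite length, so `L²` convergence on the tree gives `L¹` convergence on each edge.
-/
lemma tendsto_integral_edge {n : ℕ} {z : T.Vertex} (hz : z ∈ R.level (n + 1))
    {f : ℕ → Lp ℂ 2 T.measure} {g : Lp ℂ 2 T.measure} (hfg : Filter.Tendsto f Filter.atTop (𝓝 g))
    {s : ℝ} (hs : s ∈ Icc (t n) (t (n + 1))) :
    Filter.Tendsto (fun j => ∫ τ in (t n)..s, f j (z, τ)) Filter.atTop
      (𝓝 (∫ τ in (t n)..s, g (z, τ))) := by
  have h1 : Filter.Tendsto (fun j => eLpNorm (fun τ => f j (z, τ) - g (z, τ)) 1 (stepMeasure t n))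
      Filter.atTop (𝓝 0) := by
    have h2 := (Lp.tendsto_Lp_iff_tendsto_eLpNorm' f g).1 hfg
    have h3 := ENNReal.Tendsto.mul_const h2
      (b := (stepMeasure t n univ) ^ (1 / (1 : ℝ≥0∞).toReal - 1 / (2 : ℝ≥0∞).toReal))
      (Or.inr (ENNReal.rpow_ne_top_of_nonneg (by norm_num) (measure_ne_top _ _)))
    rw [zero_mul] at h3
    refine tendsto_of_tendsto_of_tendsto_of_le_of_le tendsto_const_nhds h3
      (fun _ => zero_le) fun j => ?_
    refine (eLpNorm_le_eLpNorm_mul_rpow_measure_univ one_le_two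
      ((R.memLp_edge hz (f j)).sub (R.memLp_edge hz g)).1).trans ?_
    gcongr
    have h4 := (measurableEmbedding_mk z).eLpNorm_map_measure (μ := stepMeasure t n)
      (g := ⇑(f j) - ⇑g) (p := 2)
    refine (le_of_eq h4.symm).trans (eLpNorm_mono_measure _ (R.map_stepMeasure_le hz))
  have h2 := tendsto_setIntegral_of_L1' (fun τ => g (z, τ))
    ((R.memLp_edge hz g).integrable one_le_two).1
    (Filter.Eventually.of_forall fun j => (R.memLp_edge hz (f j)).integrable one_le_two) h1
    (Ioc (t n) s)
  have h3 : (stepMeasure t n).restrict (Ioc (t n) s) = volume.restrict (Ioc (t n) s) := by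
    rw [stepMeasure, Measure.restrict_restrict measurableSet_Ioc,
      inter_eq_left.2 (Ioc_subset_Ioc_right hs.2)]
  rw [h3] at h2
  simpa only [intervalIntegral.integral_of_le hs.1] using h2

/-- The values at the vertices converge by induction on the generation, because the increment along
an edge is the integral of the derivative. Together with the limit of the derivatives they define a
continuous primitive, which agrees with the `L²` limit of the functions through an almost everywhere
convergent subsequence. -/
lemma isClosed_sobolev : IsClosed (T.sobolev : Set (Lp ℂ 2 T.measure × Lp ℂ 2 T.measure)) := by
  refine IsSeqClosed.isClosed fun p q hp hpq => ?_
  choose F G hFG hF hG using hp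
  choose hc hprim using hFG
  choose c hc0 hc using hc
  have hpq1 : Filter.Tendsto (fun j => (p j).1) Filter.atTop (𝓝 q.1) :=
    (continuous_fst.tendsto _).comp hpq
  have hpq2 : Filter.Tendsto (fun j => (p j).2) Filter.atTop (𝓝 q.2) :=
    (continuous_snd.tendsto _).comp hpq
  have hrep : ∀ j n, ∀ z ∈ R.level (n + 1), ∀ s ∈ Icc (t n) (t (n + 1)),
      F j z s = c j (T.parent z) + ∫ τ in (t n)..s, (p j).2 (z, τ) := by
    intro j n z hz s hs
    have hz' := R.mem_level.1 hz
    have h1 := (hprim j z (T.ne_root_of_gen hz')).2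
    have h2 := (hc j z (T.ne_root_of_gen hz')).1
    rw [(R.height_of_gen hz').1] at h1 h2
    rw [(R.height_of_gen hz').2] at h1
    rw [h1 s hs, h2]
    congr 1
    refine intervalIntegral.integral_congr_ae ?_
    have h3 := R.ae_measure_iff.1 (hG j) n z hz
    rw [stepMeasure, ae_restrict_iff' measurableSet_Ioc] at h3
    filter_upwards [h3] with τ h4 hτ
    rw [uIoc_of_le hs.1] at hτ
    exact (h4 ⟨hτ.1, hτ.2.trans hs.2⟩).symm
  have hlim : ∀ n, ∀ y, T.gen y = n → ∃ l, Filter.Tendsto (fun j => c j y) Filter.atTop (𝓝 l) := by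
    intro n
    induction n with
    | zero =>
      intro y hy
      refine ⟨0, ?_⟩
      simp only [T.gen_eq_zero_iff.1 hy, hc0]
      exact tendsto_const_nhds
    | succ n ih =>
      intro y hy
      obtain ⟨l, hl⟩ := ih (T.parent y) (T.gen_parent_eq hy)
      have hmem : t (n + 1) ∈ Icc (t n) (t (n + 1)) := ⟨R.t_le (by omega), le_rfl⟩
      refine ⟨_, (hl.add (R.tendsto_integral_edge (R.mem_level.2 hy) hpq2 hmem)).congr fun j => ?_⟩
      rw [← hrep j n y (R.mem_level.2 hy) _ hmem, ← (hc j y (T.ne_root_of_gen hy)).2,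
        (R.height_of_gen hy).2]
  choose l hl using fun y => hlim (T.gen y) y rfl
  have hFlim : ∀ n, ∀ z ∈ R.level (n + 1), ∀ s ∈ Icc (t n) (t (n + 1)),
      Filter.Tendsto (fun j => F j z s) Filter.atTop
        (𝓝 (l (T.parent z) + ∫ τ in (t n)..s, q.2 (z, τ))) := by
    intro n z hz s hs
    exact ((hl (T.parent z)).add (R.tendsto_integral_edge hz hpq2 hs)).congr fun j =>
      (hrep j n z hz s hs).symm
  refine ⟨fun z s => l (T.parent z) + ∫ τ in (T.height (T.parent z))..s, q.2 (z, τ),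
    fun z s => q.2 (z, s), ⟨⟨l, ?_, fun y hy => ?_⟩, fun y hy => ?_⟩, ?_, ae_of_all _ fun _ => rfl⟩
  · have h1 := hl T.root
    simp only [hc0] at h1
    exact tendsto_nhds_unique h1 tendsto_const_nhds
  · beta_reduce
    refine ⟨by rw [intervalIntegral.integral_same, add_zero], ?_⟩
    obtain ⟨n, hn⟩ := exists_gen_eq_succ hy
    rw [(R.height_of_gen hn).1, (R.height_of_gen hn).2]
    refine tendsto_nhds_unique (hFlim n y (R.mem_level.2 hn) _ ⟨R.t_le (by omega), le_rfl⟩)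
      ((hl y).congr fun j => ?_)
    rw [← (hc j y hy).2, (R.height_of_gen hn).2]
  · obtain ⟨n, hn⟩ := exists_gen_eq_succ hy
    rw [(R.height_of_gen hn).1, (R.height_of_gen hn).2]
    refine ⟨?_, fun s _ => ?_⟩
    · rw [intervalIntegrable_iff_integrableOn_Ioc_of_le (R.t_le (by omega))]
      exact R.integrableOn_edge (R.mem_level.2 hn) q.2
    · beta_reduce
      rw [(R.height_of_gen hn).1, intervalIntegral.integral_same, add_zero]
  · obtain ⟨φ, hφm, hφ⟩ := (tendstoInMeasure_of_tendsto_Lp hpq1).exists_seq_tendsto_ae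
    have hall : ∀ᵐ x ∂T.measure, ∀ j, (p j).1 x = F j x.1 x.2 := ae_all_iff.2 hF
    rw [R.ae_measure_iff] at hφ hall ⊢
    intro n z hz
    filter_upwards [hφ n z hz, hall n z hz, ae_stepMeasure_mem t n] with s h1 h2 h3
    simp only [h2] at h1
    have hz' := R.mem_level.1 hz
    simp only [(R.height_of_gen hz').1]
    exact tendsto_nhds_unique h1
      ((hFlim n z hz s ⟨h3.1.le, h3.2⟩).comp hφm.tendsto_atTop)

lemma finrank_zeroSumSpace_pos (k : ℕ) : 0 < Module.finrank ℂ (R.zeroSumSpace k) := by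
  cases k with
  | zero => rw [R.finrank_zeroSumSpace_zero]; exact one_pos
  | succ k =>
    rw [R.finrank_zeroSumSpace_succ]
    exact Nat.mul_pos (Finset.prod_pos fun j _ => R.b_pos j)
      (Nat.sub_pos_of_lt (R.one_lt_b k))

/-- Closedness is inherited from the tree: every `k` has at least one part, and the embedding of
that part together with its adjoint shows that this space is a preimage of the closed space on the
tree. -/
lemma isClosed_weighted_sobolev (k : ℕ) : IsClosed (RegularTree.sobolev b t k :
    Set (Lp ℂ 2 (RegularTree.weightedMeasure b t k) ×
      Lp ℂ 2 (RegularTree.weightedMeasure b t k))) := by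
  let i : R.Index := ⟨k, ⟨0, R.finrank_zeroSumSpace_pos k⟩⟩
  have h : (RegularTree.sobolev b t k : Set (Lp ℂ 2 (RegularTree.weightedMeasure b t k) ×
      Lp ℂ 2 (RegularTree.weightedMeasure b t k)))
      = (fun p => (R.embed i p.1, R.embed i p.2)) ⁻¹' T.sobolev := by
    ext p
    refine ⟨fun hp => R.embed_mem_sobolev i hp, fun hp => ?_⟩
    have h1 := R.adj_embed_mem_sobolev i hp
    simp only [LinearIsometry.adj_apply_self] at h1
    exact h1
  rw [h]
  exact R.isClosed_sobolev.preimage (((R.embed i).continuous.comp continuous_fst).prodMk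
    ((R.embed i).continuous.comp continuous_snd))

end IsRegularWith

end RootedMetricTree
end

noncomputable section

/-! ### Extension by zero -/

namespace RootedMetricTree

namespace IsRegularWith

variable {T : RootedMetricTree} {b : ℕ → ℕ} {t : ℕ → ℝ} (R : T.IsRegularWith b t)

/-- The factor that turns the extension by zero into an isometry. -/
def extensionFactor (b : ℕ → ℕ) (t : ℕ → ℝ) (k : ℕ) (s : ℝ) : ℂ :=
  (Ioi (t k)).indicator (fun _ => (((√(weight b 0 k : ℝ))⁻¹ : ℝ) : ℂ)) s

lemma measurable_extensionFactor (b : ℕ → ℕ) (t : ℕ → ℝ) (k : ℕ) :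
    Measurable (extensionFactor b t k) := measurable_const.indicator measurableSet_Ioi

lemma extensionFactor_of_le (b : ℕ → ℕ) {t : ℕ → ℝ} {k : ℕ} {s : ℝ} (hs : s ≤ t k) :
    extensionFactor b t k s = 0 := indicator_of_notMem (by simpa using hs) _

lemma extensionFactor_of_lt (b : ℕ → ℕ) {t : ℕ → ℝ} {k : ℕ} {s : ℝ} (hs : t k < s) :
    extensionFactor b t k s = (((√(weight b 0 k : ℝ))⁻¹ : ℝ) : ℂ) :=
  indicator_of_mem (mem_Ioi.2 hs) _

lemma weight_zero_mul {k n : ℕ} (h : k ≤ n) : weight b 0 n = weight b 0 k * weight b k n := by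
  induction n, h using Nat.le_induction with
  | base => rw [weight_self, mul_one]
  | succ n hn ih => rw [weight_succ (Nat.zero_le n), weight_succ hn, ih, mul_assoc]

lemma cast_mul_enorm_inv_sqrt_sq {w : ℕ} (hw : 0 < w) :
    (w : ℝ≥0∞) * ‖(((√(w : ℝ))⁻¹ : ℝ) : ℂ)‖ₑ ^ 2 = 1 := by
  have hw' : (0 : ℝ) < w := by exact_mod_cast hw
  rw [← ofReal_norm, Complex.norm_real, norm_inv, Real.norm_of_nonneg (Real.sqrt_nonneg _),
    ← ENNReal.ofReal_pow (by positivity), inv_pow, Real.sq_sqrt hw'.le,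
    ← ENNReal.ofReal_natCast, ← ENNReal.ofReal_mul hw'.le, mul_inv_cancel₀ hw'.ne',
    ENNReal.ofReal_one]

include R

/-- Beyond `t k`, the weight for index `0` is `weight b 0 k` times the weight for index `k`, and the
squared factor is the inverse of this constant. -/
lemma map_withDensity_extensionFactor (k : ℕ) : ((RegularTree.weightedMeasure b t 0).withDensity
    fun s => ‖extensionFactor b t k s‖ₑ ^ 2).map id = RegularTree.weightedMeasure b t k := by
  rw [Measure.map_id]
  ext S hS
  rw [withDensity_apply _ hS, ← lintegral_indicator hS, lintegral_weightedMeasure,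
    weightedMeasure_eq_sum b t k, Measure.sum_apply _ hS]
  refine tsum_congr fun n => ?_
  rw [Measure.smul_apply, smul_eq_mul, lintegral_indicator hS]
  rcases lt_or_ge n k with h | h
  · have h1 : ∀ᵐ s ∂(stepMeasure t n).restrict S, ‖extensionFactor b t k s‖ₑ ^ 2 = 0 := by
      refine ae_restrict_of_ae ?_
      filter_upwards [ae_stepMeasure_mem t n] with s hs
      rw [extensionFactor_of_le b (hs.2.trans (R.t_le h))]
      simp
    rw [weight_of_lt h, lintegral_congr_ae h1]
    simp
  · have h1 : ∀ᵐ s ∂(stepMeasure t n).restrict S, ‖extensionFactor b t k s‖ₑ ^ 2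
        = ‖(((√(weight b 0 k : ℝ))⁻¹ : ℝ) : ℂ)‖ₑ ^ 2 := by
      refine ae_restrict_of_ae ?_
      filter_upwards [ae_stepMeasure_mem t n] with s hs
      rw [extensionFactor_of_lt b ((R.t_le h).trans_lt hs.1)]
    rw [lintegral_congr_ae h1, setLIntegral_const, weight_zero_mul h, Nat.cast_mul, ← mul_assoc,
      mul_right_comm (weight b 0 k : ℝ≥0∞), cast_mul_enorm_inv_sqrt_sq (R.weight_pos (Nat.zero_le k)),
      one_mul]

/-- Extension by zero, as an isometry of `L²((t_k, R), g_k)` into `L²((t_0, R), g_0)`. -/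
def extension (k : ℕ) : Lp ℂ 2 (RegularTree.weightedMeasure b t k) →ₗᵢ[ℂ]
    Lp ℂ 2 (RegularTree.weightedMeasure b t 0) :=
  weightedComp (extensionFactor b t k) id (measurable_extensionFactor b t k) measurable_id
    (R.map_withDensity_extensionFactor k)

/-- The condition at `t k` makes the extension by zero continuous there. -/
lemma extension_mem_sobolev (k : ℕ) {p : Lp ℂ 2 (RegularTree.weightedMeasure b t k) ×
    Lp ℂ 2 (RegularTree.weightedMeasure b t k)} (hp : p ∈ RegularTree.sobolev b t k) :
    (R.extension k p.1, R.extension k p.2) ∈ RegularTree.sobolev b t 0 := by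
  obtain ⟨F, G, h0, h, hF, hG⟩ := hp
  refine ⟨fun s => extensionFactor b t k s * F s, fun s => extensionFactor b t k s * G s, ?_,
    fun n _ => ?_, coeFn_weightedComp_of_ae _ _ _ hF, coeFn_weightedComp_of_ae _ _ _ hG⟩
  · beta_reduce
    rw [extensionFactor_of_le b (R.t_le (Nat.zero_le k)), zero_mul]
  · have h1 : ∀ {s}, t 0 ≤ s → s ≤ t k → IsPrimitiveOn (t 0) s
        (fun s => extensionFactor b t k s * F s) (fun s => extensionFactor b t k s * G s) := by
      intro s hs hs'
      refine (IsPrimitiveOn.zero (t 0) s).congr hs (fun x hx => ?_) (fun x hx => ?_) <;>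
      rw [extensionFactor_of_le b (hx.2.trans hs'), zero_mul]
    rcases le_total n k with hn | hn
    · exact h1 (R.t_le (Nat.zero_le n)) (R.t_le hn)
    · refine (h1 (R.t_le (Nat.zero_le k)) le_rfl).trans (R.t_le (Nat.zero_le k)) (R.t_le hn) ?_
      refine ((h n hn).smul (((√(weight b 0 k : ℝ))⁻¹ : ℝ) : ℂ)).congr (R.t_le hn)
        (fun x hx => ?_) (fun x hx => ?_)
      · rcases hx.1.eq_or_lt with h2 | h2
        · rw [← h2, h0, mul_zero, mul_zero]
        · rw [extensionFactor_of_lt b h2]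
      · rw [extensionFactor_of_lt b hx.1]

lemma coeFn_extension (k : ℕ) (u : Lp ℂ 2 (RegularTree.weightedMeasure b t k)) :
    ∀ᵐ s ∂(RegularTree.weightedMeasure b t 0), R.extension k u s = extensionFactor b t k s * u s :=
  coeFn_weightedComp _ _ _ u

/-- The adjoint of `extension k` only sees the restriction to `(t_k, R)`. -/
lemma norm_adj_extension_le (k : ℕ) {f g : Lp ℂ 2 (RegularTree.weightedMeasure b t 0)}
    (hg : ∀ᵐ s ∂(RegularTree.weightedMeasure b t 0), g s = (Ioi (t k)).indicator f s) :
    ‖(R.extension k).adj f‖ ≤ ‖g‖ := by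
  have h : (R.extension k).adj f = (R.extension k).adj g := by
    refine ext_inner_left ℂ fun y => ?_
    rw [ContinuousLinearMap.adjoint_inner_right, ContinuousLinearMap.adjoint_inner_right,
      L2.inner_def, L2.inner_def]
    refine integral_congr_ae ?_
    filter_upwards [R.coeFn_extension k y, hg] with s h1 h2
    change ⟪R.extension k y s, f s⟫_ℂ = ⟪R.extension k y s, g s⟫_ℂ
    rw [h1, h2]
    rcases le_or_gt s (t k) with hs | hs
    · rw [extensionFactor_of_le b hs, zero_mul, inner_zero_left, inner_zero_left]
    · rw [indicator_of_mem (mem_Ioi.2 hs)]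
  rw [h]
  exact (R.extension k).norm_adj_apply_le _

lemma tendsto_norm_of_indicator {f : Lp ℂ 2 (RegularTree.weightedMeasure b t 0)}
    {g : ℕ → Lp ℂ 2 (RegularTree.weightedMeasure b t 0)}
    (hg : ∀ k, ∀ᵐ s ∂(RegularTree.weightedMeasure b t 0), g k s = (Ioi (t k)).indicator f s) :
    Filter.Tendsto (fun k => ‖g k‖) Filter.atTop (𝓝 0) := by
  have h1 : Filter.Tendsto (fun k => ⟪g k, g k⟫_ℂ) Filter.atTop (𝓝 0) := by
    have hf : Integrable (fun s => ‖f s‖ ^ 2) (RegularTree.weightedMeasure b t 0) :=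
      (Lp.memLp f).integrable_norm_pow two_ne_zero
    have h2 := tendsto_integral_of_dominated_convergence
      (μ := RegularTree.weightedMeasure b t 0) (F := fun k s => ⟪g k s, g k s⟫_ℂ)
      (f := fun _ => 0) (fun s => ‖f s‖ ^ 2) (fun k => (L2.integrable_inner (g k) (g k)).1)
      hf (fun k => ?_) ?_
    · simpa only [L2.inner_def, integral_zero] using h2
    · filter_upwards [hg k] with s hs
      rw [hs, inner_self_eq_norm_sq_to_K, norm_pow, RCLike.norm_ofReal, abs_norm]
      gcongr
      exact norm_indicator_le_norm_self _ _
    -- Almost every `s` lies below some `t n`, so the indicators vanish at `s` from some index on.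
    · have h3 : ∀ᵐ s ∂(RegularTree.weightedMeasure b t 0), ∃ n, s ≤ t n :=
        R.ae_weightedMeasure_iff.2 fun n _ => by
          filter_upwards [ae_stepMeasure_mem t n] with s hs using ⟨n + 1, hs.2⟩
      filter_upwards [h3, ae_all_iff.2 hg] with s hs hs'
      obtain ⟨n, hn⟩ := hs
      refine tendsto_const_nhds.congr' ?_
      filter_upwards [Filter.eventually_ge_atTop n] with k hk
      rw [hs' k, indicator_of_notMem (by simpa using hn.trans (R.t_le hk)), inner_zero_left]
  have h3 := (Real.continuous_sqrt.tendsto _).comp h1.norm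
  simpa [Function.comp_def, inner_self_eq_norm_sq_to_K] using h3

lemma tendsto_norm_adj_extension (f : Lp ℂ 2 (RegularTree.weightedMeasure b t 0)) :
    Filter.Tendsto (fun k => ‖(R.extension k).adj f‖) Filter.atTop (𝓝 0) := by
  have hf : ∀ k, MemLp ((Ioi (t k)).indicator f) 2 (RegularTree.weightedMeasure b t 0) := fun k =>
    (Lp.memLp f).indicator measurableSet_Ioi
  exact squeeze_zero (fun _ => norm_nonneg _)
    (fun k => R.norm_adj_extension_le k (hf k).coeFn_toLp)
    (R.tendsto_norm_of_indicator fun k => (hf k).coeFn_toLp)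

end IsRegularWith

end RootedMetricTree
end

noncomputable section

/-! ### The decomposition of the Schrödinger operator -/

namespace RootedMetricTree

lemma measurable_radial (T : RootedMetricTree) {V : ℝ → ℝ} (hV : Measurable V) :
    Measurable fun x : T.Vertex × ℝ => V x.2 := hV.comp measurable_snd

namespace IsRegularWith

variable {T : RootedMetricTree} {b : ℕ → ℕ} {t : ℕ → ℝ} (R : T.IsRegularWith b t)

include R

lemma ae_measure_of_Icc {Q : ℝ → Prop} (hQ : ∀ n, ∀ s ∈ Icc 0 (t n), Q s) :
    ∀ᵐ x ∂T.measure, Q x.2 :=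
  R.ae_measure_iff.2 fun n _ _ => by
    filter_upwards [ae_stepMeasure_mem t n] with s hs
    exact hQ (n + 1) s ⟨by rw [← R.t_zero]; exact (R.t_le (Nat.zero_le n)).trans hs.1.le, hs.2⟩

lemma ae_weightedMeasure_of_Icc (k : ℕ) {Q : ℝ → Prop} (hQ : ∀ n, ∀ s ∈ Icc 0 (t n), Q s) :
    ∀ᵐ s ∂(RegularTree.weightedMeasure b t k), Q s :=
  R.ae_weightedMeasure_iff.2 fun n _ => by
    filter_upwards [ae_stepMeasure_mem t n] with s hs
    exact hQ (n + 1) s ⟨by rw [← R.t_zero]; exact (R.t_le (Nat.zero_le n)).trans hs.1.le, hs.2⟩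

variable {V : ℝ → ℝ} (hV : Measurable V) (m : ℝ)

lemma embed_formMul (i : R.Index) (u : Lp ℂ 2 (RegularTree.weightedMeasure b t i.1)) :
    R.embed i (formMul _ hV m u)
      = formMul T.measure (T.measurable_radial hV) m (R.embed i u) :=
  weightedComp_mulOperator _ _ _ (measurable_formWeight hV m) (norm_formWeight_le V m) u

lemma extension_formMul (k : ℕ) (u : Lp ℂ 2 (RegularTree.weightedMeasure b t k)) :
    R.extension k (formMul _ hV m u) = formMul _ hV m (R.extension k u) :=
  weightedComp_mulOperator _ _ _ (measurable_formWeight hV m) (norm_formWeight_le V m) u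

lemma completeSpace_formSpace :
    CompleteSpace (formSpace T.sobolev (T.measurable_radial hV) m) :=
  (isClosed_formSpace R.isClosed_sobolev _ m).completeSpace_coe

lemma completeSpace_weighted_formSpace (k : ℕ) :
    CompleteSpace (formSpace (RegularTree.sobolev b t k) hV m) :=
  (isClosed_formSpace (R.isClosed_weighted_sobolev k) _ m).completeSpace_coe

lemma isResolventAt_schrodinger {m : ℝ} (hm : ∀ n, ∀ s ∈ Icc 0 (t n), 1 ≤ V s + m)
    [CompleteSpace (formSpace T.sobolev (T.measurable_radial hV) m)] :
    IsResolventAt (formEmbedding T.sobolev (T.measurable_radial hV) m ∘L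
      (formEmbedding T.sobolev (T.measurable_radial hV) m).adjoint) m (T.schrodinger V hV) :=
  isResolventAt_formOperator T.sobolev (T.measurable_radial hV)
    (R.ae_measure_of_Icc (Q := fun s => 1 ≤ V s + m) hm)

lemma isResolventAt_weighted_schrodinger {m : ℝ} (hm : ∀ n, ∀ s ∈ Icc 0 (t n), 1 ≤ V s + m)
    (k : ℕ) [CompleteSpace (formSpace (RegularTree.sobolev b t k) hV m)] :
    IsResolventAt (formEmbedding (RegularTree.sobolev b t k) hV m ∘L
      (formEmbedding (RegularTree.sobolev b t k) hV m).adjoint) m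
      (RegularTree.schrodinger b t k V hV) :=
  isResolventAt_formOperator (RegularTree.sobolev b t k) hV (R.ae_weightedMeasure_of_Icc k hm)

lemma isCompactOperator_weighted
    (h : IsCompactOperator (formEmbedding T.sobolev (T.measurable_radial hV) m)) (k : ℕ) :
    IsCompactOperator (formEmbedding (RegularTree.sobolev b t k) hV m) := by
  have := R.completeSpace_formSpace hV m
  let i : R.Index := ⟨k, ⟨0, R.finrank_zeroSumSpace_pos k⟩⟩
  exact isCompactOperator_of_intertwine (formEmbedding_formTransport (R.embed_formMul hV m i)
    fun p hp => R.embed_mem_sobolev i hp) h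

lemma isCompactOperator_of_weighted
    (h : IsCompactOperator (formEmbedding (RegularTree.sobolev b t 0) hV m)) :
    IsCompactOperator (formEmbedding T.sobolev (T.measurable_radial hV) m) := by
  have := R.completeSpace_formSpace hV m
  have := fun k => R.completeSpace_weighted_formSpace hV m k
  have h1 : ∀ k, IsCompactOperator (formEmbedding (RegularTree.sobolev b t k) hV m) := fun k =>
    isCompactOperator_of_intertwine (formEmbedding_formTransport (R.extension_formMul hV m k)
      fun p hp => R.extension_mem_sobolev k hp) h
  have h2 : Filter.Tendsto (fun k => ‖formEmbedding (RegularTree.sobolev b t k) hV m‖)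
      Filter.atTop (𝓝 0) :=
    tendsto_norm_of_intertwine (fun k => formEmbedding_formTransport (R.extension_formMul hV m k)
      fun p hp => R.extension_mem_sobolev k hp) h R.tendsto_norm_adj_extension
  -- Only finitely many indices lie over each `k`, so convergence of the norms in `k` leaves
  -- finitely many parts of norm above `ε`.
  have h3 : ∀ ε > 0,
      {i : R.Index | ε < ‖formEmbedding (RegularTree.sobolev b t i.1) hV m‖}.Finite := by
    intro ε hε
    obtain ⟨N, hN⟩ := Filter.eventually_atTop.1 (h2.eventually_lt_const hε)
    refine ((Finset.range N).sigma fun _ => Finset.univ).finite_toSet.subset fun i hi => ?_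
    have h4 : i.1 < N := by
      by_contra h5
      exact lt_asymm (hN i.1 (not_lt.1 h5)) hi
    simpa using h4
  have h4 := formTransport_orthogonalFamily (R.embed_formMul hV m)
    (fun i p hp => R.embed_mem_sobolev i hp) R.orthogonalFamily_embed
  have h5 := fun i => formEmbedding_adj_formTransport (R.embed_formMul hV m i)
    (fun p hp => R.embed_mem_sobolev i hp) fun p hp => R.adj_embed_mem_sobolev i hp
  exact R.orthogonalFamily_embed.isCompactOperator R.eq_zero_of_adj_embed h4 h5
    (fun i => h1 i.1) h3

lemma eigenvalueCount_eq_tsum {m : ℝ} (hm : ∀ n, ∀ s ∈ Icc 0 (t n), 1 ≤ V s + m) (r : ℝ) :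
    eigenvalueCount (T.schrodinger V hV) r
      = ∑' k, (Module.finrank ℂ (R.zeroSumSpace k) : ℕ∞) *
          eigenvalueCount (RegularTree.schrodinger b t k V hV) r := by
  have := R.completeSpace_formSpace hV m
  have := fun k => R.completeSpace_weighted_formSpace hV m k
  have h := R.orthogonalFamily_embed.eigenvalueCount_eq_tsum R.eq_zero_of_adj_embed
    (fun i => formEmbedding_formTransport (R.embed_formMul hV m i)
      fun p hp => R.embed_mem_sobolev i hp)
    (fun i => formEmbedding_adj_formTransport (R.embed_formMul hV m i)
      (fun p hp => R.embed_mem_sobolev i hp) fun p hp => R.adj_embed_mem_sobolev i hp)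
    (R.isResolventAt_schrodinger hV hm) (fun i => R.isResolventAt_weighted_schrodinger hV hm i.1) r
  refine h.trans ?_
  -- The sum over all parts is grouped by `k`; the parts over one `k` have the same counting
  -- function.
  refine (Summable.tsum_sigma' (fun k => ENat.summable_all _) (ENat.summable_all _)).trans
    (tsum_congr fun k => ?_)
  rw [tsum_fintype]
  change ∑ _ : Fin (Module.finrank ℂ (R.zeroSumSpace k)),
    eigenvalueCount (RegularTree.schrodinger b t k V hV) r = _
  rw [Finset.sum_const, Finset.card_univ, Fintype.card_fin, nsmul_eq_mul]

lemma hasDiscreteSpectrum_iff {m : ℝ} (hm : ∀ n, ∀ s ∈ Icc 0 (t n), 1 ≤ V s + m) :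
    HasDiscreteSpectrum (T.schrodinger V hV) ↔
      IsCompactOperator (formEmbedding T.sobolev (T.measurable_radial hV) m) := by
  have := R.completeSpace_formSpace hV m
  exact (R.isResolventAt_schrodinger hV hm).hasDiscreteSpectrum_iff

lemma hasDiscreteSpectrum_weighted_iff {m : ℝ} (hm : ∀ n, ∀ s ∈ Icc 0 (t n), 1 ≤ V s + m) (k : ℕ) :
    HasDiscreteSpectrum (RegularTree.schrodinger b t k V hV) ↔
      IsCompactOperator (formEmbedding (RegularTree.sobolev b t k) hV m) := by
  have := fun k => R.completeSpace_weighted_formSpace hV m k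
  exact (R.isResolventAt_weighted_schrodinger hV hm k).hasDiscreteSpectrum_iff

lemma eigenvalueCount_ne_top {m : ℝ} (hm : ∀ n, ∀ s ∈ Icc 0 (t n), 1 ≤ V s + m)
    (h : HasDiscreteSpectrum (T.schrodinger V hV)) (r : ℝ) :
    eigenvalueCount (T.schrodinger V hV) r ≠ ⊤ := by
  have := R.completeSpace_formSpace hV m
  exact (R.isResolventAt_schrodinger hV hm).eigenvalueCount_ne_top
    ((R.hasDiscreteSpectrum_iff hV hm).1 h) r

end IsRegularWith

end RootedMetricTree

end

/-- `N(r; A_V) = N(r; A_{V,0}) + ∑_{k ≥ 1} b_1 ⋯ b_{k-1} (b_k - 1) N(r; A_{V,k})`; the sum is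
indexed by `i = k - 1`. -/
theorem theorem5p1 (T : RootedMetricTree)
    (hroot : T.branching T.root = 1)
    (hbranch : ∀ y, y ≠ T.root → 1 < T.branching y)
    (hreg : T.IsRegular)
    (b : ℕ → ℕ) (hb : ∀ y, T.branching y = b (T.gen y))
    (t : ℕ → ℝ) (ht : ∀ y, T.height y = t (T.gen y))
    (V : ℝ → ℝ) (hV : Measurable V)
    (hVbelow : ∃ c : ℝ, ∀ n, ∀ s ∈ Set.Icc 0 (t n), c ≤ V s) :
    (HasDiscreteSpectrum (T.schrodinger V hV) ↔
      HasDiscreteSpectrum (RegularTree.schrodinger b t 0 V hV)) ∧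
    (HasDiscreteSpectrum (T.schrodinger V hV) →
      (∀ k, HasDiscreteSpectrum (RegularTree.schrodinger b t k V hV)) ∧
      ∀ r : ℝ,
        eigenvalueCount (T.schrodinger V hV) r ≠ ⊤ ∧
        eigenvalueCount (T.schrodinger V hV) r =
          eigenvalueCount (RegularTree.schrodinger b t 0 V hV) r +
            ∑' i : ℕ, (((∏ j ∈ Finset.Icc 1 i, b j) * (b (i + 1) - 1) : ℕ) : ℕ∞) *
              eigenvalueCount (RegularTree.schrodinger b t (i + 1) V hV) r) := by
  have R : T.IsRegularWith b t := ⟨hroot, hbranch, hb, ht⟩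
  obtain ⟨c, hc⟩ := hVbelow
  -- The shift `m = 1 - c` is what makes the form weight at most `1`.
  have hm : ∀ n, ∀ s ∈ Icc 0 (t n), 1 ≤ V s + (1 - c) := fun n s hs => by
    have := hc n s hs
    linarith
  have hall : HasDiscreteSpectrum (T.schrodinger V hV) →
      ∀ k, HasDiscreteSpectrum (RegularTree.schrodinger b t k V hV) := fun h k =>
    (R.hasDiscreteSpectrum_weighted_iff hV hm k).2
      (R.isCompactOperator_weighted hV _ ((R.hasDiscreteSpectrum_iff hV hm).1 h) k)
  refine ⟨⟨fun h => hall h 0, fun h => (R.hasDiscreteSpectrum_iff hV hm).2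
    (R.isCompactOperator_of_weighted hV _ ((R.hasDiscreteSpectrum_weighted_iff hV hm 0).1 h))⟩,
    fun h => ⟨hall h, fun r => ⟨R.eigenvalueCount_ne_top hV hm h r, ?_⟩⟩⟩
  rw [R.eigenvalueCount_eq_tsum hV hm, tsum_eq_zero_add' (ENat.summable_all _),
    R.finrank_zeroSumSpace_zero, Nat.cast_one, one_mul]
  simp only [R.finrank_zeroSumSpace_succ]
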